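/- Let $K_0(\mathrm{Var}_{\mathbb C})$ be the Grothendieck ring of complex varieties (relations $[X]=[Y]+[X\setminus Y]$ for closed $Y\subset X$, product $[X][Y]=[X\times Y]$), let $\mathbb L=[\mathbb A^1]=q$ and $\mathcal V=K_0(\mathrm{Var}_{\mathbb C})\otimes_{\mathbb Z[\mathbb L]}\mathbb Q(\mathbb L^{1/2})$, and put $[X]_{\mathrm{vir}}=q^{-\frac12\dim X}[X]\in\mathcal V$. Let $Q$ be a quiver (possibly infinite, with finitely many arrows between any two vertices), with Euler form $\chi(\alpha,\beta)=\sum_i\alpha_i\beta_i-\sum_{a:i\to j}\alpha_i\beta_j$ and $\langle\alpha,\beta\rangle=\chi(\alpha,\beta)-\chi(\beta,\alpha)$ on the group $\Gamma(Q)$ of finitely supported functions $Q_0\to\mathbb Z$; let $\Gamma_+(Q)\subset\Gamma(Q)$ be the functions with values in $\mathbb N$. Let $Z=-d+ir:\Gamma(Q)\to\mathbb C$ be a homomorphism with $Z(j)\in\mathbb H_+=\{\rho e^{i\pi\varphi}:\rho>0,\ 0<\varphi\le1\}$ for all $j\in Q_0$ (a stability function), with slope $\mu_Z=d/r\in\mathbb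 R\cup\{\infty\}$. A representation $M$ is $Z$-semistable (stable) if $\mu_Z(\underline{\dim}\,N)\le\mu_Z(\underline{\dim}\,M)$ (respectively $<$) for all proper nonzero subrepresentations $N$. If $Q_0$ is finite, let $R_Z(Q)\subset R(Q)=\mathbb A^{Q_1}$ be the open subvariety of $Z$-semistable abelian representations (those of dimension one at every vertex), with the action of $G(Q)=(\mathbb C^*)^{Q_0}$, and let $M_Z(Q)=R_Z(Q)/\!/G(Q)$ be the GIT quotient. For $\alpha\in\Gamma_+(Q)$ let $Q(\alpha)$ be the quiver with vertices $i_k$ ($i\in Q_0$, $1\le k\le\alpha_i$), with as many arrows from $i_k$ to $j_{k'}$ as there are from $i$ to $j$ in $Q$, and with the induced stability function $Z(i_k)=Z(i)$. Put $f_Z(\alpha)=[R_Z(Q(\alpha))]_{\mathrm{vir}}/[G(Q(\alpha))]_{\mathrm{vir}}\in\mathcal V$; here $[G(Q(\alpha))]_{\mathrm{vir}}$ is invertible in $\mathcal V$. Let $l\subset\mathbb H_+$ be a ray such that $\langle\alpha,\beta\rangle=0$ whenever $\alpha,\beta\in\Gamma_+(Q)$, $Z(\alpha),Z(\beta)\in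 l$ and $f_Z(\alpha),f_Z(\beta)\ne0$. Then the equation $$1+\sum_{Z(\alpha)\in l}f_Z(\alpha)\frac{x^\alpha}{\alpha!}=\exp\Bigg(\frac{\sum_{Z(\alpha)\in l}g_Z(\alpha)\frac{x^\alpha}{\alpha!}}{q^{1/2}-q^{-1/2}}\Bigg),\qquad \alpha!=\prod_i\alpha_i!,$$ of commutative power series over $\mathcal V$ in the variables $x_i$, $i\in Q_0$, has a unique solution $(g_Z(\alpha))_{\alpha\in\Gamma_+(Q),\,Z(\alpha)\in l}$ in $\mathcal V$ (the abelian quiver invariants). Let $\alpha\in\Gamma_+(Q)$ with $Z(\alpha)\in l$, and let $Z^{\mathrm{def}}$ be any stability function on $Q(\alpha)$ such that, for all non-empty $I,J\subset Q(\alpha)_0$ and $\mu(I)=\mu(\sum_{i\in I}i)$: 1. $\mu_{Z^{\mathrm{def}}}(I)\ne\mu_{Z^{\mathrm{def}}}(J)$ if $I\ne J$; 2. $\mu_{Z^{\mathrm{def}}}(I)<\mu_{Z^{\mathrm{def}}}(J)$ if $\mu_Z(I)<\mu_Z(J)$. (Abelian $Z^{\mathrm{def}}$-semistable representations of $Q(\alpha)$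 are then $Z^{\mathrm{def}}$-stable.) Then the GIT quotient $M_{Z^{\mathrm{def}}}(Q(\alpha))=R_{Z^{\mathrm{def}}}(Q(\alpha))/\!/G(Q(\alpha))$ exists as a variety, and $$g_Z(\alpha)=(q^{1/2}-q^{-1/2})\,\frac{[R_{Z^{\mathrm{def}}}(Q(\alpha))]_{\mathrm{vir}}}{[G(Q(\alpha))]_{\mathrm{vir}}}=[M_{Z^{\mathrm{def}}}(Q(\alpha))]_{\mathrm{vir}}\in\mathcal V.$$ -/

import Mathlib

open CategoryTheory CategoryTheory.Limits AlgebraicGeometry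
open scoped TensorProduct Polynomial

noncomputable section

namespace AbelianQuiver

/-! ### Complex varieties and the Grothendieck ring -/

/-- `Spec ℂ`. -/
abbrev SpecC : Scheme.{0} := Spec (CommRingCat.of ℂ)

/-- A complex algebraic variety: a separated scheme of finite type over `ℂ`. (Nilpotents are
allowed; they do not matter in the Grothendieck ring, since `[X] = [X_red]` there by the
relation for the closed subvariety `X_red` with empty complement.) -/
structure Variety where
  /-- the underlying scheme -/
  X : Scheme.{0}
  /-- the structure morphism -/
  str : X ⟶ SpecC
  [locallyOfFiniteType : LocallyOfFiniteType str]
  [quasiCompact : QuasiCompact str]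
  [isSeparated : IsSeparated str]

attribute [instance] Variety.locallyOfFiniteType Variety.quasiCompact Variety.isSeparated

namespace Variety

/-- The point `Spec ℂ`. -/
def point : Variety where
  X := SpecC
  str := 𝟙 _

/-- The product `X × Y` over `ℂ`. -/
def prod (X Y : Variety) : Variety where
  X := pullback X.str Y.str
  str := pullback.fst X.str Y.str ≫ X.str

/-- The affine space `𝔸^n` over `ℂ` with coordinates indexed by a finite type. -/
def affine (n : Type) [Finite n] : Variety where
  X := 𝔸(n; SpecC)
  str := 𝔸(n; SpecC) ↘ SpecC

/-- An open subset of a variety, as a variety. -/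
def ofOpens (X : Variety) (U : X.X.Opens) : Variety :=
  have : IsLocallyNoetherian X.X := LocallyOfFiniteType.isLocallyNoetherian X.str
  have : CompactSpace X.X := (quasiCompact_iff_compactSpace X.str).mp inferInstance
  have : IsNoetherian X.X := { }
  { X := U
    str := U.ι ≫ X.str }

end Variety

/-- The relations of the Grothendieck ring of varieties, imposed on the polynomial ring
on all varieties. -/
inductive K0Rel : MvPolynomial Variety ℤ → Prop
  /-- isomorphic varieties have the same class -/
  | iso (X Y : Variety) (e : X.X ≅ Y.X) (he : e.hom ≫ Y.str = X.str) :
      K0Rel (MvPolynomial.X X - MvPolynomial.X Y)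
  /-- `[X] = [Y] + [X \ Y]` for a closed subvariety `Y` of `X` -/
  | cut (X Y U : Variety) (i : Y.X ⟶ X.X) (j : U.X ⟶ X.X)
      (hi : i ≫ X.str = Y.str) (hj : j ≫ X.str = U.str)
      (hci : IsClosedImmersion i) (hoj : IsOpenImmersion j)
      (h : Set.range j = (Set.range i)ᶜ) :
      K0Rel (MvPolynomial.X X - (MvPolynomial.X Y + MvPolynomial.X U))
  /-- `[X × Y] = [X] [Y]` -/
  | prod (X Y : Variety) :
      K0Rel (MvPolynomial.X (X.prod Y) - MvPolynomial.X X * MvPolynomial.X Y)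
  /-- the class of the point is `1` -/
  | point : K0Rel (MvPolynomial.X Variety.point - 1)

/-- The Grothendieck ring `K₀(Var_ℂ)`. Additively it is the group generated by isomorphism
classes of varieties modulo `[X] = [Y] + [X \ Y]`; the product is `[X][Y] = [X × Y]`. -/
def K0 : Type 1 := MvPolynomial Variety ℤ ⧸ Ideal.span ({p | K0Rel p})

instance : CommRing K0 :=
  inferInstanceAs (CommRing (MvPolynomial Variety ℤ ⧸ Ideal.span ({p | K0Rel p})))

/-- The class `[X]` in `K₀(Var_ℂ)`. -/
def K0.cls (X : Variety) : K0 := Ideal.Quotient.mk (Ideal.span ({p | K0Rel p})) (MvPolynomial.X X)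

/-- The class `𝕃 = [𝔸¹]`. -/
def K0.lefschetz : K0 := K0.cls (Variety.affine Unit)

/-- The field `ℚ(𝕃^{1/2})` of rational functions in the variable `𝕃^{1/2}`. -/
def HalfField : Type := RatFunc ℚ

instance : Field HalfField := inferInstanceAs (Field (RatFunc ℚ))
instance : Algebra ℚ HalfField := inferInstanceAs (Algebra ℚ (RatFunc ℚ))

/-- The variable `𝕃^{1/2} = q^{1/2}`. -/
def qh : HalfField := (RatFunc.X : RatFunc ℚ)

/-- `γ = q^{1/2} - q^{-1/2}`. -/
def gam : HalfField := qh - qh⁻¹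

/-- `ℤ[𝕃] → K₀(Var_ℂ)`. -/
instance : Algebra ℤ[X] K0 :=
  (Polynomial.eval₂RingHom (Int.castRingHom K0) K0.lefschetz).toAlgebra

/-- `ℤ[𝕃] → ℚ(𝕃^{1/2})`, `𝕃 ↦ (𝕃^{1/2})²`. -/
instance : Algebra ℤ[X] HalfField :=
  (Polynomial.eval₂RingHom (Int.castRingHom HalfField) (qh ^ 2)).toAlgebra

/-- The ring `𝒱 = K₀(Var_ℂ) ⊗_{ℤ[𝕃]} ℚ(𝕃^{1/2})`. -/
abbrev Mot : Type 1 := HalfField ⊗[ℤ[X]] K0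

instance : Algebra ℚ Mot := ((algebraMap HalfField Mot).comp (algebraMap ℚ HalfField)).toAlgebra

/-- The motive `[X] ∈ 𝒱`. -/
def motive (X : Variety) : Mot := 1 ⊗ₜ K0.cls X

/-- The Krull dimension of a variety, as a natural number (`0` for the empty variety). -/
def dimension (X : Variety) : ℕ := ((topologicalKrullDim X.X).unbotD 0).toNat

/-- The virtual motive `[X]_vir = q^{-dim X / 2} [X]`. -/
def virtualMotive (X : Variety) : Mot := (qh⁻¹) ^ dimension X • motive X

/-! ### Quivers, dimension vectors and stability functions -/

/-- The bilinear form `r(α, β) = ∑_{a : i → j} α_i β_j`. -/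
def arrowForm (V : Type) [Quiver.{0} V] (α β : V →₀ ℤ) : ℤ :=
  α.sum fun i m => β.sum fun j n => m * n * (Nat.card (i ⟶ j) : ℤ)

/-- The Euler-Ringel form `χ(α, β) = ∑_i α_i β_i - ∑_{a : i → j} α_i β_j`. -/
def eulerForm (V : Type) [Quiver.{0} V] (α β : V →₀ ℤ) : ℤ :=
  (α.sum fun i m => m * β i) - arrowForm V α β

/-- The skew-symmetric form `⟨α, β⟩ = χ(α, β) - χ(β, α)`. -/
def skewForm (V : Type) [Quiver.{0} V] (α β : V →₀ ℤ) : ℤ :=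
  eulerForm V α β - eulerForm V β α

/-- The inclusion of `Γ₊(Q)` in `Γ(Q)`. -/
def toInt {V : Type} (α : V →₀ ℕ) : V →₀ ℤ := α.mapRange (fun n : ℕ => (n : ℤ)) Nat.cast_zero

/-- `ℍ₊ = {r e^{iπφ} : r > 0, 0 < φ ≤ 1}`. -/
def upperHalf : Set ℂ :=
  {z | ∃ r φ : ℝ, 0 < r ∧ 0 < φ ∧ φ ≤ 1 ∧ z = r * Complex.exp (Complex.I * Real.pi * φ)}

/-- Rays `l ⊂ ℍ₊`. -/
def IsRay (l : Set ℂ) : Prop :=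
  ∃ z ∈ upperHalf, l = {w | ∃ t : ℝ, 0 < t ∧ w = t * z}

/-- A stability function (central charge) on a quiver with set of vertices `V`. -/
structure Stability (V : Type) where
  /-- the homomorphism `Z : Γ(Q) → ℂ` -/
  Z : (V →₀ ℤ) →+ ℂ
  mem_upperHalf : ∀ j : V, Z (Finsupp.single j 1) ∈ upperHalf

/-- The slope `μ_Z(α) = d(α) / r(α) ∈ ℝ ∪ {∞}`, where `Z(α) = -d(α) + i r(α)`. -/
def Stability.slope {V : Type} (Z : Stability V) (α : V →₀ ℤ) : WithTop ℝ :=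
  open Classical in
  if (Z.Z α).im = 0 then ⊤ else ((-(Z.Z α).re / (Z.Z α).im : ℝ) : WithTop ℝ)

/-- The slope `μ_Z(I) = μ_Z(1_I)` of a finite set of vertices. -/
def Stability.slopeSet {V : Type} (Z : Stability V) (I : Finset V) : WithTop ℝ :=
  Z.slope (∑ i ∈ I, Finsupp.single i 1)

/-- `Z'` is a generic deformation of `Z` (on a quiver with finite set of vertices): distinct
non-empty sets of vertices have distinct `Z'`-slopes, and strict inequalities between `Z`-slopes
persist for `Z'`. (These two properties imply that `Z'`-semistable abelian representations are
`Z'`-stable and `Z`-semistable, and that `Z`-stable ones are `Z'`-stable.) -/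
def IsDeformation {V : Type} (Z Z' : Stability V) : Prop :=
  (∀ I J : Finset V, I.Nonempty → J.Nonempty → I ≠ J → Z'.slopeSet I ≠ Z'.slopeSet J) ∧
  (∀ I J : Finset V, I.Nonempty → J.Nonempty → Z.slopeSet I < Z.slopeSet J →
    Z'.slopeSet I < Z'.slopeSet J)

/-- The vertices `i_k`, `1 ≤ k ≤ α_i`, of the quiver `Q(α)`. -/
def Split {V : Type} (α : V →₀ ℕ) : Type := Σ i : V, Fin (α i)

/-- The quiver `Q(α)`: arrows from `i_k` to `j_{k'}` are the arrows from `i` to `j`. -/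
instance {V : Type} [Quiver.{0} V] (α : V →₀ ℕ) : Quiver.{0} (Split α) where
  Hom x y := x.1 ⟶ y.1

instance {V : Type} [Quiver.{0} V] [h : ∀ i j : V, Finite (i ⟶ j)] (α : V →₀ ℕ)
    (x y : Split α) : Finite (x ⟶ y) := h x.1 y.1

instance {V : Type} (α : V →₀ ℕ) : Finite (Split α) := by
  let f : Split α → Σ i : α.support, Fin (α i) := fun x =>
    ⟨⟨x.1, Finsupp.mem_support_iff.mpr (fun h => (Fin.cast h x.2).elim0)⟩, x.2⟩
  refine Finite.of_injective f ?_
  rintro ⟨i, k⟩ ⟨j, m⟩ h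
  have h1 : i = j := congrArg (fun y => (y.1 : V)) h
  subst h1
  have h2 : k = m := by simpa [f] using h
  rw [h2]

/-- The stability function on `Q(α)` induced by `Z(i_k) = Z(i)`. -/
def Stability.split {V : Type} (Z : Stability V) (α : V →₀ ℕ) : Stability (Split α) where
  Z := Z.Z.comp (Finsupp.mapDomain.addMonoidHom (Sigma.fst : (Σ i : V, Fin (α i)) → V))
  mem_upperHalf j := by
    have h := Z.mem_upperHalf (Sigma.fst (j : Σ i : V, Fin (α i)))
    have e : Finsupp.mapDomain (Sigma.fst : (Σ i : V, Fin (α i)) → V)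
        (Finsupp.single j (1 : ℤ)) = Finsupp.single (Sigma.fst j) 1 := Finsupp.mapDomain_single
    change Z.Z (Finsupp.mapDomain (Sigma.fst : (Σ i : V, Fin (α i)) → V)
        (Finsupp.single j (1 : ℤ))) ∈ upperHalf
    rw [e]
    exact h

/-! ### Semistable representations -/

/-- Finite-dimensional representations of a quiver over a field. -/
structure Rep (K : Type) [Field K] (V : Type) [Quiver.{0} V] where
  /-- the vector spaces at the vertices -/
  space : V → Type
  [addCommGroup : ∀ i, AddCommGroup (space i)]
  [module : ∀ i, Module K (space i)]
  [finite : ∀ i, Module.Finite K (space i)]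
  /-- the linear maps of the arrows -/
  map : ∀ {i j : V}, (i ⟶ j) → (space i →ₗ[K] space j)

attribute [instance] Rep.addCommGroup Rep.module Rep.finite

namespace Rep

variable {K : Type} [Field K] {V : Type} [Quiver.{0} V]

/-- A family of subspaces is a subrepresentation. -/
def IsSubrep (M : Rep K V) (N : ∀ i, Submodule K (M.space i)) : Prop :=
  ∀ (i j : V) (a : i ⟶ j), N i ≤ (N j).comap (M.map a)

/-- The dimension vector of a family of subspaces. -/
def dimVec [Finite V] (M : Rep K V) (N : ∀ i, Submodule K (M.space i)) : V →₀ ℤ :=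
  Finsupp.equivFunOnFinite.symm fun i => (Module.finrank K (N i) : ℤ)

/-- `M` is `Z`-semistable: `μ_Z(N) ≤ μ_Z(M)` for all proper nonzero subrepresentations `N`. -/
def IsSemistable [Finite V] (Z : Stability V) (M : Rep K V) : Prop :=
  ∀ N : (∀ i, Submodule K (M.space i)), M.IsSubrep N → N ≠ ⊥ → N ≠ ⊤ →
    Z.slope (M.dimVec N) ≤ Z.slope (M.dimVec ⊤)

/-- The abelian representation (one-dimensional at every vertex) with given scalars. -/
def abelian (c : ∀ {i j : V}, (i ⟶ j) → K) : Rep K V where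
  space _ := K
  map a := c a • LinearMap.id

end Rep

/-- The arrows of a quiver. -/
abbrev Arrows (V : Type) [Quiver.{0} V] : Type := Σ i j : V, (i ⟶ j)

/-- The space `R(Q) = 𝔸^{Q₁}` of abelian representations. -/
def repSpace (V : Type) [Quiver.{0} V] [Finite V] [∀ i j : V, Finite (i ⟶ j)] : Variety :=
  Variety.affine (Arrows V)

/-- The coordinate function on `R(Q)` of an arrow. -/
def coordinate {V : Type} [Quiver.{0} V] [Finite V] [∀ i j : V, Finite (i ⟶ j)]
    {i j : V} (a : i ⟶ j) : Γ((repSpace V).X, ⊤) :=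
  AffineSpace.coord SpecC (⟨i, j, a⟩ : Arrows V)

/-- The abelian representation over the residue field `κ(x)` given by a point `x` of `R(Q)`. -/
def repAt {V : Type} [Quiver.{0} V] [Finite V] [∀ i j : V, Finite (i ⟶ j)]
    (x : (repSpace V).X) : Rep ((repSpace V).X.residueField x) V :=
  Rep.abelian fun a => (repSpace V).X.Γevaluation x (coordinate a)

/-- Semistability of an abelian representation, in terms of supports of subrepresentations. -/
theorem isSemistable_abelian_iff {K : Type} [Field K] {V : Type} [Quiver.{0} V] [Finite V]
    (Z : Stability V) (c : ∀ {i j : V}, (i ⟶ j) → K) :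
    (Rep.abelian c).IsSemistable Z ↔
      ∀ I : Set V, (∀ (i j : V) (a : i ⟶ j), i ∈ I → c a ≠ 0 → j ∈ I) →
        I.Nonempty → I ≠ Set.univ →
        Z.slope (Finsupp.equivFunOnFinite.symm (I.indicator 1)) ≤
          Z.slope (Finsupp.equivFunOnFinite.symm 1) := by
  classical
  have htop : (Rep.abelian c).dimVec ⊤ = Finsupp.equivFunOnFinite.symm 1 := by
    ext i
    change (Module.finrank K (⊤ : Submodule K K) : ℤ) = 1
    simp
  constructor
  · intro h I hI hne huniv
    let N : ∀ i, Submodule K ((Rep.abelian c).space i) := fun i =>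
      if i ∈ I then (⊤ : Submodule K K) else (⊥ : Submodule K K)
    have hN : (Rep.abelian c).dimVec N = Finsupp.equivFunOnFinite.symm (I.indicator 1) := by
      ext i
      change (Module.finrank K
        ((if i ∈ I then (⊤ : Submodule K K) else (⊥ : Submodule K K) : Submodule K K)) : ℤ) =
          I.indicator 1 i
      by_cases hi : i ∈ I
      · rw [if_pos hi]; simp [hi]
      · rw [if_neg hi]; simp [hi]
    rw [← hN, ← htop]
    apply h
    · intro i j a (x : K) hx
      change c a * x ∈ (if j ∈ I then (⊤ : Submodule K K) else (⊥ : Submodule K K))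
      change x ∈ (if i ∈ I then (⊤ : Submodule K K) else (⊥ : Submodule K K)) at hx
      by_cases hi : i ∈ I
      · by_cases hc : c a = 0
        · rw [hc, zero_mul]; exact Submodule.zero_mem _
        · rw [if_pos (hI i j a hi hc)]; trivial
      · rw [if_neg hi, Submodule.mem_bot] at hx
        rw [hx, mul_zero]; exact Submodule.zero_mem _
    · intro h0
      obtain ⟨i, hi⟩ := hne
      have h1 : (if i ∈ I then (⊤ : Submodule K K) else (⊥ : Submodule K K)) = ⊥ := congrFun h0 i
      rw [if_pos hi] at h1
      exact top_ne_bot h1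
    · intro h0
      apply huniv
      ext i
      have h1 : (if i ∈ I then (⊤ : Submodule K K) else (⊥ : Submodule K K)) = ⊤ := congrFun h0 i
      by_contra hi
      rw [if_neg (by simpa using hi)] at h1
      exact bot_ne_top h1
  · intro h N hN h0 h1
    let N' : V → Submodule K K := N
    have hN' : ∀ i, N' i = ⊥ ∨ N' i = ⊤ := fun i => eq_bot_or_eq_top (N' i)
    let I : Set V := {i | N' i = ⊤}
    have hdim : (Rep.abelian c).dimVec N = Finsupp.equivFunOnFinite.symm (I.indicator 1) := by
      ext i
      change (Module.finrank K (N' i) : ℤ) = I.indicator 1 i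
      rcases hN' i with hi | hi
      · have : i ∉ I := fun h2 => bot_ne_top (hi.symm.trans h2)
        rw [hi]; simp [this]
      · have : i ∈ I := hi
        rw [hi]; simp [this]
    rw [hdim, htop]
    apply h
    · intro i j a hi hc
      have h2 : c a * (1 : K) ∈ N' j := hN i j a (show (1 : K) ∈ N' i by rw [hi]; trivial)
      rcases hN' j with hj | hj
      · rw [hj, Submodule.mem_bot, mul_one] at h2
        exact absurd h2 hc
      · exact hj
    · by_contra hne
      rw [Set.not_nonempty_iff_eq_empty] at hne
      apply h0
      funext i
      rcases hN' i with hi | hi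
      · exact hi
      · have : i ∈ I := hi
        rw [hne] at this
        exact this.elim
    · intro huniv
      apply h1
      funext i
      have : i ∈ I := by rw [huniv]; trivial
      exact this

/-- The open locus `R_Z(Q) ⊂ R(Q)` of `Z`-semistable abelian representations. -/
def semistableOpens {V : Type} [Quiver.{0} V] [Finite V] [∀ i j : V, Finite (i ⟶ j)]
    (Z : Stability V) : (repSpace V).X.Opens where
  carrier := {x | (repAt x).IsSemistable Z}
  is_open' := by
    have e : {x : (repSpace V).X | (repAt x).IsSemistable Z} =
        ⋂ I ∈ {I : Set V | I.Nonempty ∧ I ≠ Set.univ ∧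
            ¬ Z.slope (Finsupp.equivFunOnFinite.symm (I.indicator 1)) ≤
              Z.slope (Finsupp.equivFunOnFinite.symm 1)},
          ⋃ p ∈ {p : Arrows V | p.1 ∈ I ∧ p.2.1 ∉ I},
            ((repSpace V).X.basicOpen (coordinate p.2.2) : Set (repSpace V).X) := by
      ext x
      have hx : ∀ p : Arrows V, x ∈ (repSpace V).X.basicOpen (coordinate p.2.2) ↔
          (repSpace V).X.Γevaluation x (coordinate p.2.2) ≠ 0 := fun p =>
        (Scheme.evaluation_ne_zero_iff_mem_basicOpen (U := ⊤) _ x trivial _).symm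
      simp only [Set.mem_ofPred_eq, Set.mem_iInter, Set.mem_iUnion, SetLike.mem_coe, hx]
      rw [repAt, isSemistable_abelian_iff]
      constructor
      · rintro h I ⟨h1, h2, h3⟩
        by_contra hcon
        refine h3 (h I (fun i j a hi ha => ?_) h1 h2)
        by_contra hj
        exact hcon ⟨⟨i, j, a⟩, ⟨hi, hj⟩, ha⟩
      · intro h I hI h1 h2
        by_contra h3
        obtain ⟨⟨i, j, a⟩, ⟨hi, hj⟩, ha⟩ := h I ⟨h1, h2, h3⟩
        exact hj (hI i j a hi ha)
    rw [e]
    refine (Set.toFinite _).isOpen_biInter fun I _ => ?_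
    exact isOpen_biUnion fun p _ => ((repSpace V).X.basicOpen _).isOpen

/-- The variety `R_Z(Q)`. -/
def semistableLocus {V : Type} [Quiver.{0} V] [Finite V] [∀ i j : V, Finite (i ⟶ j)]
    (Z : Stability V) : Variety :=
  (repSpace V).ofOpens (semistableOpens Z)

/-- The torus `G(Q) = (ℂ^*)^{Q₀}`: the locus in `𝔸^{Q₀}` where all coordinates are non-zero. -/
def torus (V : Type) [Finite V] : Variety :=
  (Variety.affine V).ofOpens
    ((Variety.affine V).X.basicOpen (∏ᶠ i : V, AffineSpace.coord SpecC i))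

/-! ### The moduli space -/

section Moduli

variable {V : Type} [Quiver.{0} V] [Finite V] [∀ i j : V, Finite (i ⟶ j)]

/-- Two `T`-valued points `x, x'` of `R(Q)` are related by a `T`-valued point
`t ∈ (Γ(T, 𝒪)ˣ)^{Q₀}` of `G(Q)`: `x'_a = t_j x_a t_i⁻¹` for all arrows `a : i → j`. -/
def SameOrbit {T : Scheme.{0}} (x x' : T ⟶ (repSpace V).X) : Prop :=
  x ≫ (repSpace V).str = x' ≫ (repSpace V).str ∧
  ∃ t : V → Γ(T, ⊤)ˣ, ∀ (i j : V) (a : i ⟶ j),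
    x'.appTop (coordinate a) = t j * x.appTop (coordinate a) * ↑(t i)⁻¹

/-- A morphism from `R_Z(Q)` is `G(Q)`-invariant. -/
def IsInvariantHom (Z : Stability V) {W : Scheme.{0}} (h : (semistableLocus Z).X ⟶ W) : Prop :=
  ∀ (T : Scheme.{0}) (x x' : T ⟶ (semistableLocus Z).X),
    SameOrbit (x ≫ (semistableOpens Z).ι) (x' ≫ (semistableOpens Z).ι) → x ≫ h = x' ≫ h

/-- A function on an open subset of `R_Z(Q)` is `G(Q)`-invariant. -/
def IsInvariantSection (Z : Stability V) {U : (semistableLocus Z).X.Opens}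
    (s : Γ((semistableLocus Z).X, U)) : Prop :=
  ∀ (T : Scheme.{0}) (x x' : T ⟶ (U : Scheme.{0})),
    SameOrbit (x ≫ U.ι ≫ (semistableOpens Z).ι) (x' ≫ U.ι ≫ (semistableOpens Z).ι) →
      x.appTop (U.topIso.inv s) = x'.appTop (U.topIso.inv s)

/-- A subset of `R_Z(Q)` is `G(Q)`-invariant. -/
def IsInvariantSet (Z : Stability V) (C : Set (semistableLocus Z).X) : Prop :=
  ∀ (T : Scheme.{0}) (x x' : T ⟶ (semistableLocus Z).X),
    SameOrbit (x ≫ (semistableOpens Z).ι) (x' ≫ (semistableOpens Z).ι) →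
      ∀ t : T, x t ∈ C ↔ x' t ∈ C

/-- The variety `M` together with `π : R_Z(Q) → M` is the GIT quotient
`M_Z(Q) = R_Z(Q) // G(Q)`: a good quotient in the sense of geometric invariant theory.
The last field says that it is also a categorical quotient, so that `(M, π)` is unique up to
a unique isomorphism. -/
structure IsGITQuotient (Z : Stability V) (M : Variety) (π : (semistableLocus Z).X ⟶ M.X) :
    Prop where
  over_base : π ≫ M.str = (semistableLocus Z).str
  invariant : IsInvariantHom Z π
  affine : IsAffineHom π
  surjective : Function.Surjective π
  /-- `𝒪_M → π_* 𝒪` is injective with image the invariant functions -/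
  injective : ∀ U : M.X.Opens, Function.Injective (π.app U)
  invariants : ∀ (U : M.X.Opens) (s : Γ((semistableLocus Z).X, π ⁻¹ᵁ U)),
    IsInvariantSection Z s ↔ s ∈ Set.range (π.app U)
  /-- images of closed invariant sets are closed -/
  closed : ∀ C : Set (semistableLocus Z).X, IsClosed C → IsInvariantSet Z C → IsClosed (π '' C)
  /-- disjoint closed invariant sets have disjoint images -/
  separates : ∀ C D : Set (semistableLocus Z).X, IsClosed C → IsClosed D →
    IsInvariantSet Z C → IsInvariantSet Z D → Disjoint C D → Disjoint (π '' C) (π '' D)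
  universal : ∀ (W : Scheme.{0}) (w : W ⟶ SpecC) (h : (semistableLocus Z).X ⟶ W),
    h ≫ w = (semistableLocus Z).str → IsInvariantHom Z h →
      ∃! k : M.X ⟶ W, k ≫ w = M.str ∧ π ≫ k = h

end Moduli

/-! ### Abelian quiver invariants -/

section Invariants

variable {V : Type} [Quiver.{0} V] [∀ i j : V, Finite (i ⟶ j)]

/-- `[R_Z(Q)]_vir / [G(Q)]_vir` for a quiver with finitely many vertices and arrows. -/
def stackMotive [Finite V] (Z : Stability V) : Mot :=
  virtualMotive (semistableLocus Z) * Ring.inverse (virtualMotive (torus V))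

/-- `f_Z(α) = [R_Z(Q(α))]_vir / [G(Q(α))]_vir`. -/
def fInv (Z : Stability V) (α : V →₀ ℕ) : Mot := stackMotive (Z.split α)

/-- The dimension vectors `α ∈ Γ₊(Q)` with `Z(α) ∈ l`. -/
def OnRay (Z : Stability V) (l : Set ℂ) : Type := {α : V →₀ ℕ // Z.Z (toInt α) ∈ l}

/-- `α! = ∏_i α_i!`. -/
def multiFactorial (α : V →₀ ℕ) : ℕ := α.prod fun _ n => n.factorial

/-- The power series `∑_{Z(α) ∈ l} c(α) x^α / α!` over `𝒱` in the variables `x_i`, `i ∈ Q₀`. -/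
def raySeries (Z : Stability V) (l : Set ℂ) (c : OnRay Z l → Mot) : MvPowerSeries V Mot :=
  open Classical in
  fun α => if h : Z.Z (toInt α) ∈ l then
    ((multiFactorial α : HalfField)⁻¹) • c ⟨α, h⟩ else 0

/-- The condition on a ray: `⟨α, β⟩ = 0` whenever `Z(α), Z(β) ∈ l` and
`f_Z(α), f_Z(β) ≠ 0`. -/
def IsAdmissibleRay (Z : Stability V) (l : Set ℂ) : Prop :=
  ∀ α β : OnRay Z l, fInv Z α.1 ≠ 0 → fInv Z β.1 ≠ 0 → skewForm V (toInt α.1) (toInt β.1) = 0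

/-- The defining equation of the abelian quiver invariants `g(α) = g_Z(α)`, `Z(α) ∈ l`:
`1 + ∑ f_Z(α) x^α / α! = exp ((∑ g(α) x^α / α!) / (q^{1/2} - q^{-1/2}))`. -/
def IsAbelianInvariant (Z : Stability V) (l : Set ℂ) (g : OnRay Z l → Mot) : Prop :=
  1 + raySeries Z l (fun α => fInv Z α.1) =
    (PowerSeries.exp Mot).subst (gam⁻¹ • raySeries Z l g)

end Invariants

end AbelianQuiver

end

set_option linter.unusedSectionVars false

namespace AbelianQuiver

/-! ### Exponentials of multivariate power series -/

section PowerSeriesExp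

variable {σ R : Type*} [CommRing R]

/-- This is the chain rule. A coefficient of given degree sees only finitely many terms of `f`,
because `g` has no constant term; truncating `f` reduces the claim to the chain rule of a derivation
on polynomials. -/
theorem pderiv_subst {f : PowerSeries R} {g : MvPowerSeries σ R}
    (hg : MvPowerSeries.constantCoeff g = 0) (i : σ) :
    MvPowerSeries.pderiv R i (f.subst g) =
      (PowerSeries.derivative R f).subst g * MvPowerSeries.pderiv R i g := by
  classical
  have hs : PowerSeries.HasSubst g := .of_constantCoeff_zero hg
  have hz : ∀ (m : ℕ) (e : σ →₀ ℕ), e.degree < m → MvPowerSeries.coeff e (g ^ m) = 0 :=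
    fun m e h => MvPowerSeries.coeff_eq_zero_of_constantCoeff_nilpotent (m := 1)
      (by simpa using hg) (by omega)
  have key : ∀ (m : ℕ) (e : σ →₀ ℕ) (F : PowerSeries R), e.degree < m →
      MvPowerSeries.coeff e (F.subst g) =
        MvPowerSeries.coeff e ((F.trunc m : PowerSeries R).subst g) := by
    intro m e F h
    rw [PowerSeries.coeff_subst hs, PowerSeries.coeff_subst hs]
    refine finsum_congr fun d => ?_
    obtain hd | hd := lt_or_ge d m
    · rw [PowerSeries.coeff_coe_trunc_of_lt hd]
    · rw [hz d e (by omega), smul_zero, smul_zero]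
  ext e
  -- A derivative raises the relevant degree by one and shortens the truncation by one, so any bound
  -- from `e.degree + 2` on would do.
  set m := e.degree + 3 with hm
  rw [MvPowerSeries.coeff_pderiv, key m _ f (by simp; omega), ← MvPowerSeries.coeff_pderiv]
  have hp : MvPowerSeries.pderiv R i ((f.trunc m : PowerSeries R).subst g) =
      ((PowerSeries.derivative R (f.trunc m : PowerSeries R)).subst g) *
        MvPowerSeries.pderiv R i g := by
    rw [PowerSeries.subst_coe hs, PowerSeries.derivative_coe, PowerSeries.subst_coe hs,
      Derivation.comp_aeval_eq (a := g) (MvPowerSeries.pderiv R i) (f.trunc m), smul_eq_mul]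
  rw [hp, MvPowerSeries.coeff_mul, MvPowerSeries.coeff_mul]
  refine Finset.sum_congr rfl fun ⟨a, b⟩ hab => ?_
  congr 1
  have hdeg : a.degree ≤ e.degree := by
    rw [← Finset.HasAntidiagonal.mem_antidiagonal.mp hab, map_add]; exact Nat.le_add_right _ _
  rw [PowerSeries.derivative_coe, ← PowerSeries.trunc_derivative' f m]
  exact (key (m - 1) a _ (by omega)).symm

/-- Substitution into a series without constant term preserves supports in a set closed under
addition. -/
theorem coeff_subst_eq_zero {f : MvPowerSeries σ R} (hf : MvPowerSeries.constantCoeff f = 0)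
    {P : Set (σ →₀ ℕ)} (hP : ∀ a ∈ P, ∀ b ∈ P, a + b ∈ P)
    (hfP : ∀ a ∉ P, MvPowerSeries.coeff a f = 0) (F : PowerSeries R)
    (hF : PowerSeries.constantCoeff F = 0) :
    ∀ a ∉ P, MvPowerSeries.coeff a (F.subst f) = 0 := by
  classical
  intro a ha
  rw [PowerSeries.coeff_subst (.of_constantCoeff_zero hf)]
  refine finsum_eq_zero_of_forall_eq_zero fun n => ?_
  rcases Nat.eq_zero_or_pos n with rfl | hn
  · rw [PowerSeries.coeff_zero_eq_constantCoeff_apply, hF, zero_smul]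
  · obtain ⟨n, rfl⟩ := Nat.exists_eq_succ_of_ne_zero hn.ne'
    have h : ∀ n : ℕ, ∀ a ∉ P, MvPowerSeries.coeff a (f ^ (n + 1)) = 0 := by
      intro n
      induction n with
      | zero => simpa using hfP
      | succ n ih =>
        intro a ha
        rw [pow_succ, MvPowerSeries.coeff_mul]
        refine Finset.sum_eq_zero fun ⟨b, c⟩ hbc => ?_
        by_cases hb : b ∈ P
        · by_cases hc : c ∈ P
          · exact absurd (Finset.HasAntidiagonal.mem_antidiagonal.mp hbc ▸ hP b hb c hc) ha
          · rw [hfP c hc, mul_zero]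
        · rw [ih b hb, zero_mul]
    rw [h n a ha, smul_zero]

variable [Algebra ℚ R]

theorem isAddTorsionFree_of_rat : IsAddTorsionFree R :=
  IsAddTorsionFree.of_module_rat R

theorem pderiv_exp_subst {g : MvPowerSeries σ R} (hg : MvPowerSeries.constantCoeff g = 0) (i : σ) :
    MvPowerSeries.pderiv R i ((PowerSeries.exp R).subst g) =
      (PowerSeries.exp R).subst g * MvPowerSeries.pderiv R i g := by
  rw [pderiv_subst hg, PowerSeries.derivative_exp]

theorem constantCoeff_exp_subst {g : MvPowerSeries σ R}
    (hg : MvPowerSeries.constantCoeff g = 0) :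
    MvPowerSeries.constantCoeff ((PowerSeries.exp R).subst g) = 1 := by
  rw [PowerSeries.constantCoeff_subst (.of_constantCoeff_zero hg), finsum_eq_single _ 0]
  · simp
  · intro n hn
    simp [hg, hn]

/-- Differentiating gives `E ∂g = E ∂h` with the same unit `E`. Without additive torsion, a series
is determined by its partial derivatives and its constant term. -/
theorem exp_subst_injective {g h : MvPowerSeries σ R} (hg : MvPowerSeries.constantCoeff g = 0)
    (hh : MvPowerSeries.constantCoeff h = 0)
    (e : (PowerSeries.exp R).subst g = (PowerSeries.exp R).subst h) : g = h := by
  have := isAddTorsionFree_of_rat (R := R)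
  refine MvPowerSeries.pderiv.ext (fun i => ?_) (hg.trans hh.symm)
  have hu : IsUnit ((PowerSeries.exp R).subst g : MvPowerSeries σ R) := by
    rw [MvPowerSeries.isUnit_iff_constantCoeff, constantCoeff_exp_subst hg]
    exact isUnit_one
  apply hu.mul_left_cancel
  rw [← pderiv_exp_subst hg, e, pderiv_exp_subst hh]

/-- With `u = (1 + f)⁻¹`, obtained by substituting into the derivative of the logarithm, the product
`E * u` has vanishing partial derivatives and constant term `1`, so it is `1`. -/
theorem exp_subst_log_subst {f : MvPowerSeries σ R} (hf : MvPowerSeries.constantCoeff f = 0) :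
    MvPowerSeries.constantCoeff ((PowerSeries.log R).subst f) = 0 ∧
    (PowerSeries.exp R).subst ((PowerSeries.log R).subst f : MvPowerSeries σ R) = 1 + f := by
  have := isAddTorsionFree_of_rat (R := R)
  have hs : PowerSeries.HasSubst f := .of_constantCoeff_zero hf
  have h0 : MvPowerSeries.constantCoeff ((PowerSeries.log R).subst f) = 0 := by
    rw [PowerSeries.constantCoeff_subst hs]
    refine finsum_eq_zero_of_forall_eq_zero fun n => ?_
    rcases Nat.eq_zero_or_pos n with rfl | hn
    · simp
    · simp [hf, hn.ne']
  refine ⟨h0, ?_⟩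
  set u : MvPowerSeries σ R := (PowerSeries.derivative R (PowerSeries.log R)).subst f with hu
  have h1 : (1 + PowerSeries.X) * PowerSeries.derivative R (PowerSeries.log R) = 1 := by
    rw [PowerSeries.deriv_log]
    ext n
    rw [add_mul, one_mul, map_add]
    rcases n with _ | n
    · simp
    · rw [PowerSeries.coeff_succ_X_mul]
      simp [PowerSeries.coeff_one, pow_succ]
  have h2 : (1 + f) * u = 1 := by
    have := congrArg (PowerSeries.substAlgHom (R := R) (S := R) hs) h1
    rw [map_mul, map_add, map_one, PowerSeries.coe_substAlgHom, PowerSeries.subst_X hs] at this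
    exact this
  have hd : ∀ i, MvPowerSeries.pderiv R i ((PowerSeries.log R).subst f) =
      u * MvPowerSeries.pderiv R i f := fun i => pderiv_subst hf i
  set E : MvPowerSeries σ R := (PowerSeries.exp R).subst ((PowerSeries.log R).subst f) with hE
  have hEd : ∀ i, MvPowerSeries.pderiv R i E = E * (u * MvPowerSeries.pderiv R i f) := fun i => by
    rw [hE, pderiv_exp_subst h0, hd]
  have hud : ∀ i, MvPowerSeries.pderiv R i u = - u ^ 2 * MvPowerSeries.pderiv R i f := fun i => by
    have h3 := congrArg (MvPowerSeries.pderiv R i) h2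
    rw [Derivation.leibniz, map_add, MvPowerSeries.pderiv_one, zero_add, smul_eq_mul,
      smul_eq_mul] at h3
    linear_combination u * h3 - (MvPowerSeries.pderiv R i u) * h2
  have h4 : E * u = 1 := by
    refine MvPowerSeries.pderiv.ext (fun i => ?_) ?_
    · rw [Derivation.leibniz, hEd, hud, MvPowerSeries.pderiv_one, smul_eq_mul, smul_eq_mul]
      ring
    · have h5 := congrArg MvPowerSeries.constantCoeff h2
      rw [map_mul, map_add, map_one, hf, add_zero, one_mul] at h5
      rw [map_mul, h5, constantCoeff_exp_subst h0, map_one, one_mul]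
  linear_combination (1 + f) * h4 - E * h2

end PowerSeriesExp

/-! ### Polarization -/

section Polarization

variable {σ R U : Type} [CommRing R] (p : U → σ)

/-- The number of elements of `W` over each point. -/
noncomputable def fiberCount (W : Finset U) : σ →₀ ℕ := ∑ v ∈ W, Finsupp.single (p v) 1

@[simp] theorem fiberCount_empty : fiberCount p (∅ : Finset U) = 0 := rfl

theorem multiFactorial_add_single (β : σ →₀ ℕ) (i : σ) :
    multiFactorial (β + Finsupp.single i 1) = (β i + 1) * multiFactorial β := by
  classical
  have h : ∀ γ : σ →₀ ℕ, γ.support ⊆ insert i β.support →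
      multiFactorial γ = ∏ j ∈ insert i β.support, (γ j).factorial := fun γ hγ =>
    Finsupp.prod_of_support_subset _ hγ _ (by simp)
  rw [h β (Finset.subset_insert _ _), h (β + Finsupp.single i 1)]
  · rw [← Finset.mul_prod_erase _ _ (Finset.mem_insert_self i _),
      ← Finset.mul_prod_erase _ _ (Finset.mem_insert_self i _), ← mul_assoc]
    congr 1
    · simp [Nat.factorial_succ]
    · refine Finset.prod_congr rfl fun j hj => ?_
      simp [Finsupp.single_eq_of_ne (Finset.ne_of_mem_erase hj)]
  · intro j hj
    by_cases hji : j = i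
    · simp [hji]
    · simp only [Finsupp.mem_support_iff, Finsupp.add_apply,
        Finsupp.single_eq_of_ne hji, add_zero] at hj
      simp [hj]

variable [DecidableEq U]

theorem fiberCount_insert {W : Finset U} {v : U} (hv : v ∉ W) :
    fiberCount p (insert v W) = fiberCount p W + Finsupp.single (p v) 1 := by
  rw [fiberCount, Finset.sum_insert hv, add_comm]; rfl

end Polarization

/-! ### Polarized coefficients of products and exponentials. -/

section Polarization

variable {σ U : Type} {R : Type*} [CommRing R] (p : U → σ)

/-- The coefficient of `x^β / β!`, where `β` counts the elements of `W`. -/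
noncomputable def polarCoeff (F : MvPowerSeries σ R) (W : Finset U) : R :=
  (multiFactorial (fiberCount p W) : R) * MvPowerSeries.coeff (fiberCount p W) F

theorem polarCoeff_add (F G : MvPowerSeries σ R) (W : Finset U) :
    polarCoeff p (F + G) W = polarCoeff p F W + polarCoeff p G W := by
  rw [polarCoeff, map_add, mul_add]; rfl

variable [DecidableEq U]

/-- The exponent produced by differentiation is exactly what the factorial gains. Hence, in
polarized form, a derivative just adds a new vertex. -/
theorem polarCoeff_pderiv (F : MvPowerSeries σ R) {W : Finset U} {v : U} (hv : v ∉ W) :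
    polarCoeff p (MvPowerSeries.pderiv R (p v) F) W = polarCoeff p F (insert v W) := by
  rw [polarCoeff, polarCoeff, MvPowerSeries.coeff_pderiv, fiberCount_insert p hv,
    multiFactorial_add_single]
  push_cast
  ring

/-- Once the variables are made distinct, no binomial coefficients remain and multiplication is a
sum over splittings of `W`. The induction on `W` is the Leibniz rule. -/
theorem polarCoeff_mul (F G : MvPowerSeries σ R) (W : Finset U) :
    polarCoeff p (F * G) W = ∑ J ∈ W.powerset, polarCoeff p F J * polarCoeff p G (W \ J) := by
  induction W using Finset.induction_on generalizing F G with
  | empty => simp [polarCoeff, multiFactorial]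
  | insert v W hv ih =>
    rw [← polarCoeff_pderiv p _ hv, Derivation.leibniz, polarCoeff_add, smul_eq_mul, smul_eq_mul,
      ih, mul_comm G, ih, Finset.sum_powerset_insert hv]
    congr 1
    · refine Finset.sum_congr rfl fun J hJ => ?_
      have hvJ : v ∉ J := fun h => hv (Finset.mem_powerset.mp hJ h)
      rw [polarCoeff_pderiv p _ (fun h => hv (Finset.mem_sdiff.mp h).1),
        Finset.insert_sdiff_of_notMem _ hvJ]
    · refine Finset.sum_congr rfl fun J hJ => ?_
      have hvJ : v ∉ J := fun h => hv (Finset.mem_powerset.mp hJ h)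
      rw [polarCoeff_pderiv p _ hvJ, Finset.insert_sdiff_insert,
        Finset.sdiff_insert_of_notMem hv]

/-- The polarized form of the relation `∂ exp G = exp G ∂ G`. -/
theorem polarCoeff_exp_subst [Algebra ℚ R] {G : MvPowerSeries σ R}
    (hG : MvPowerSeries.constantCoeff G = 0) {W : Finset U} {v : U} (hv : v ∈ W) :
    polarCoeff p ((PowerSeries.exp R).subst G) W =
      ∑ J ∈ W.powerset with v ∈ J,
        polarCoeff p G J * polarCoeff p ((PowerSeries.exp R).subst G) (W \ J) := by
  obtain ⟨W, hvW, rfl⟩ : ∃ W', v ∉ W' ∧ W = insert v W' :=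
    ⟨W.erase v, Finset.notMem_erase v W, (Finset.insert_erase hv).symm⟩
  rw [← polarCoeff_pderiv p _ hvW, pderiv_exp_subst hG, mul_comm, polarCoeff_mul,
    Finset.sum_filter, Finset.sum_powerset_insert hvW]
  have h0 : ∀ J ∈ W.powerset, v ∉ J := fun J hJ h => hvW (Finset.mem_powerset.mp hJ h)
  -- The factor `∂ G` received the variable of `v`, so exactly the subsets containing `v` survive.
  rw [Finset.sum_eq_zero (fun J hJ => if_neg (h0 J hJ)), zero_add]
  refine Finset.sum_congr rfl fun J hJ => ?_
  rw [if_pos (Finset.mem_insert_self _ _), polarCoeff_pderiv p _ (h0 J hJ),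
    Finset.insert_sdiff_insert, Finset.sdiff_insert_of_notMem hvW]

end Polarization

end AbelianQuiver

namespace AbelianQuiver

/-! ### Counting supports of semistable abelian representations -/

section Supports

variable {U A : Type*} [DecidableEq U] [DecidableEq A] (s t : A → U)

/-- A set of vertices is closed under a set of arrows. -/
def ClosedUnder (S : Finset A) (I : Finset U) : Prop := ∀ a ∈ S, s a ∈ I → t a ∈ I

/-- All non-empty closed subsets of `W` satisfy `P`. -/
def AllClosed (P : Finset U → Prop) (W : Finset U) (S : Finset A) : Prop :=
  ∀ I ⊆ W, I.Nonempty → ClosedUnder s t S I → P I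

variable [Fintype A]

/-- The arrows from `W` to `W'`. -/
def arrowsBetween (W W' : Finset U) : Finset A := {a | s a ∈ W ∧ t a ∈ W'}

theorem mem_arrowsBetween {W W' : Finset U} {a : A} :
    a ∈ arrowsBetween s t W W' ↔ s a ∈ W ∧ t a ∈ W' := by
  simp [arrowsBetween]

variable {k : Type*} [CommRing k] (a b x : k)

open Classical in
/-- The number `∑_S x^{|S|}` of supports `S` of representations of `W`, all of whose closed
subsets satisfy `P`. -/
noncomputable def supportCount (P : Finset U → Prop) (W : Finset U) : k :=
  ∑ S ∈ (arrowsBetween s t W W).powerset with AllClosed s t P W S, x ^ S.card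

/-- The normalized number of supports. -/
noncomputable def weightedCount (P : Finset U → Prop) (W : Finset U) : k :=
  a ^ W.card * b ^ (arrowsBetween s t W W).card * supportCount s t x P W

theorem supportCount_congr {P Q : Finset U → Prop} {W : Finset U}
    (h : ∀ I ⊆ W, I.Nonempty → (P I ↔ Q I)) :
    supportCount s t x P W = supportCount s t x Q W := by
  classical
  unfold supportCount
  congr 1
  refine Finset.filter_congr fun S _ => ?_
  exact ⟨fun H I hI hne hc => (h I hI hne).mp (H I hI hne hc),
    fun H I hI hne hc => (h I hI hne).mpr (H I hI hne hc)⟩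

theorem closedUnder_self {W : Finset U} {S : Finset A} (hS : S ⊆ arrowsBetween s t W W) :
    ClosedUnder s t S W := fun _ ha _ => ((mem_arrowsBetween s t).mp (hS ha)).2

/-- `W` itself is closed under every set of arrows between its own vertices. -/
theorem supportCount_eq_zero {P : Finset U → Prop} {W : Finset U} (hW : W.Nonempty)
    (h : ¬ P W) : supportCount s t x P W = 0 := by
  classical
  unfold supportCount
  rw [Finset.filter_eq_empty_iff.mpr, Finset.sum_empty]
  intro S hS H
  exact h (H W subset_rfl hW (closedUnder_self s t (Finset.mem_powerset.mp hS)))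

theorem weightedCount_empty (P : Finset U → Prop) : weightedCount s t a b x P ∅ = 1 := by
  classical
  have h : arrowsBetween s t (∅ : Finset U) ∅ = ∅ := by
    ext; simp [mem_arrowsBetween]
  have h2 : AllClosed s t P ∅ ∅ := fun I hI hne => by
    rw [Finset.subset_empty.mp hI] at hne
    exact absurd hne (by simp)
  simp [weightedCount, supportCount, h, Finset.filter_singleton, h2]

/-- Hypotheses on a slope function `μ` refining a coarse trichotomy of the sets of vertices: those
satisfying `low`, those satisfying `L`, and the others. -/
structure SlopeData (low L : Finset U → Prop) (μ : Finset U → WithTop ℝ) : Prop where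
  injective : ∀ I J, I.Nonempty → J.Nonempty → μ I = μ J → I = J
  union_lt : ∀ K J, K.Nonempty → J.Nonempty → Disjoint K J → (μ (K ∪ J) < μ K ↔ μ J < μ K)
  union_lt_of_lt : ∀ I J K, I.Nonempty → J.Nonempty → K.Nonempty → Disjoint I J →
    μ I < μ K → μ J < μ K → μ (I ∪ J) < μ K
  low_lt : ∀ J K, J.Nonempty → K.Nonempty → low J → L K → μ J < μ K
  lt_high : ∀ J K, J.Nonempty → K.Nonempty → ¬ low J → ¬ L J → L K → μ K < μ J
  not_low : ∀ J, L J → ¬ low J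
  nonempty : ∀ J, L J → J.Nonempty
  sdiff : ∀ K W, L K → L W → K ⊆ W → (W \ K).Nonempty → L (W \ K)

variable {s t x} {low L : Finset U → Prop} {μ : Finset U → WithTop ℝ}

/-- The count of stable supports on `K`. -/
noncomputable def stableCount (s t : A → U) (x : k) (μ : Finset U → WithTop ℝ) (K : Finset U) : k :=
  supportCount s t x (fun I => μ I ≤ μ K) K

/-- Together with `SlopeData.mem_of_lt`: when `E` consists of the sets on the ray with slope below
that of `K`, the condition `low J ∨ J ∈ E` means exactly `μ J < μ K`. -/
theorem SlopeData.lt_of_mem (hμ : SlopeData low L μ) {E : Finset (Finset U)} {K : Finset U}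
    (hK : L K) (hEK : ∀ J ∈ E, μ J < μ K) {J : Finset U} (hJ : J.Nonempty)
    (h : low J ∨ J ∈ E) : μ J < μ K :=
  h.elim (fun h => hμ.low_lt J K hJ (hμ.nonempty K hK) h hK) (hEK J)

theorem SlopeData.mem_of_lt (hμ : SlopeData low L μ) {E : Finset (Finset U)} {K : Finset U}
    (hK : L K) (hlower : ∀ J, L J → μ J < μ K → J ∈ E) {J : Finset U} (hJ : J.Nonempty)
    (h : μ J < μ K) : low J ∨ J ∈ E := by
  by_contra hcon
  push Not at hcon
  by_cases hL : L J
  · exact hcon.2 (hlower J hL h)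
  · exact absurd h (hμ.lt_high J K hJ (hμ.nonempty K hK) hcon.1 hL hK).not_gt

theorem closedUnder_inter {S : Finset A} {I K : Finset U} (hI : ClosedUnder s t S I)
    (hS : S ⊆ arrowsBetween s t K K) : ClosedUnder s t S (I ∩ K) := fun a ha h =>
  Finset.mem_inter.mpr ⟨hI a ha (Finset.mem_inter.mp h).1, ((mem_arrowsBetween s t).mp (hS ha)).2⟩

theorem ClosedUnder.mono {S S' : Finset A} {I : Finset U} (hI : ClosedUnder s t S I)
    (h : S' ⊆ S) : ClosedUnder s t S' I := fun a ha => hI a (h ha)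

/-- Supports on `W` for which `K` is the closed subset of maximal slope are composed of a stable
support on `K`, a support on `W \ K` and any set of arrows from `W \ K` to `K`. -/
theorem SlopeData.allClosed_union (hμ : SlopeData low L μ) {E : Finset (Finset U)}
    {K W : Finset U} (hK : L K) (hEK : ∀ J ∈ E, μ J < μ K)
    (hlower : ∀ J, L J → μ J < μ K → J ∈ E) (hKW : K ⊆ W) {S₁ S₂ S₃ : Finset A}
    (h₁ : S₁ ⊆ arrowsBetween s t K K) (h₂ : S₂ ⊆ arrowsBetween s t (W \ K) (W \ K))
    (h₃ : S₃ ⊆ arrowsBetween s t (W \ K) K) :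
    AllClosed s t (fun I => low I ∨ I ∈ insert K E) W (S₁ ∪ S₂ ∪ S₃) ↔
      AllClosed s t (fun I => μ I ≤ μ K) K S₁ ∧
        AllClosed s t (fun I => low I ∨ I ∈ E) (W \ K) S₂ := by
  have hKne := hμ.nonempty K hK
  -- Arrows may enter `K` from `W \ K` but none leaves `K`, so adjoining `K` to a closed subset of
  -- `W \ K` keeps it closed.
  have hcl : ∀ J ⊆ W \ K, ClosedUnder s t S₂ J → ClosedUnder s t (S₁ ∪ S₂ ∪ S₃) (K ∪ J) := by
    intro J hJ hc a ha hs
    rcases Finset.mem_union.mp ha with ha | ha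
    · rcases Finset.mem_union.mp ha with ha | ha
      · exact Finset.mem_union_left _ ((mem_arrowsBetween s t).mp (h₁ ha)).2
      · refine Finset.mem_union_right _ (hc a ha ?_)
        rcases Finset.mem_union.mp hs with hs | hs
        · exact absurd hs (Finset.mem_sdiff.mp ((mem_arrowsBetween s t).mp (h₂ ha)).1).2
        · exact hs
    · exact Finset.mem_union_left _ ((mem_arrowsBetween s t).mp (h₃ ha)).2
  have hcl₁ : ∀ I ⊆ K, ClosedUnder s t S₁ I → ClosedUnder s t (S₁ ∪ S₂ ∪ S₃) I := by
    intro I hI hc a ha hs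
    rcases Finset.mem_union.mp ha with ha | ha
    · rcases Finset.mem_union.mp ha with ha | ha
      · exact hc a ha hs
      · exact absurd (hI hs) (Finset.mem_sdiff.mp ((mem_arrowsBetween s t).mp (h₂ ha)).1).2
    · exact absurd (hI hs) (Finset.mem_sdiff.mp ((mem_arrowsBetween s t).mp (h₃ ha)).1).2
  constructor
  · intro H
    refine ⟨fun I hI hne hc => ?_, fun J hJ hne hc => ?_⟩
    · rcases H I (hI.trans hKW) hne (hcl₁ I hI hc) with h | h
      · exact (hμ.lt_of_mem hK hEK hne (Or.inl h)).le
      · rcases Finset.mem_insert.mp h with rfl | h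
        · exact le_rfl
        · exact (hEK I h).le
    -- The hypothesis bounds the slope of `K ∪ J`; the seesaw property `union_lt` transfers the
    -- bound to `J` alone.
    · have hdis : Disjoint K J := Finset.disjoint_of_subset_right hJ Finset.disjoint_sdiff
      have hne' : (K ∪ J).Nonempty := hKne.mono Finset.subset_union_left
      have h : low (K ∪ J) ∨ K ∪ J ∈ insert K E := H (K ∪ J) (Finset.union_subset hKW (hJ.trans Finset.sdiff_subset)) hne' (hcl J hJ hc)
      rw [Finset.mem_insert, or_left_comm] at h
      rcases h with h | h
      · obtain ⟨v, hv⟩ := hne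
        exact absurd (h ▸ Finset.mem_union_right _ hv) (Finset.disjoint_right.mp hdis hv)
      · exact hμ.mem_of_lt hK hlower hne
          ((hμ.union_lt K J hKne hne hdis).mp (hμ.lt_of_mem hK hEK hne' h))
  · rintro ⟨H₁, H₂⟩ I hI hne hc
    by_cases hIK : I = K
    · exact Or.inr (hIK ▸ Finset.mem_insert_self _ _)
    -- The parts of `I` inside and outside `K` are closed separately. Each non-empty part has slope
    -- below `μ K`, except the inner part when it equals `K`; slopes of disjoint unions are then
    -- controlled by the seesaw properties.
    suffices h : μ I < μ K from
      (hμ.mem_of_lt hK hlower hne h).imp_right Finset.mem_insert_of_mem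
    have hc₁ : ClosedUnder s t S₁ (I ∩ K) := closedUnder_inter
      (hc.mono (Finset.subset_union_left.trans Finset.subset_union_left)) h₁
    have hc₂ : ClosedUnder s t S₂ (I ∩ (W \ K)) := closedUnder_inter
      (hc.mono (Finset.subset_union_right.trans Finset.subset_union_left)) h₂
    have hu : (I ∩ K) ∪ (I ∩ (W \ K)) = I := by
      rw [← Finset.inter_union_distrib_left, Finset.union_sdiff_of_subset hKW,
        Finset.inter_eq_left.mpr hI]
    have hdis : Disjoint (I ∩ K) (I ∩ (W \ K)) :=
      Finset.disjoint_of_subset_left Finset.inter_subset_right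
        (Finset.disjoint_of_subset_right Finset.inter_subset_right Finset.disjoint_sdiff)
    have key₁ : (I ∩ K).Nonempty → I ∩ K ≠ K → μ (I ∩ K) < μ K := fun h hn =>
      lt_of_le_of_ne (H₁ _ Finset.inter_subset_right h hc₁)
        (fun he => hn (hμ.injective _ _ h hKne he))
    have key₂ : (I ∩ (W \ K)).Nonempty → μ (I ∩ (W \ K)) < μ K := fun h =>
      hμ.lt_of_mem hK hEK h (H₂ _ Finset.inter_subset_right h hc₂)
    rw [← hu] at hne hIK ⊢
    rcases Finset.eq_empty_or_nonempty (I ∩ K) with h1 | h1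
    · rw [h1, Finset.empty_union] at hne ⊢
      exact key₂ hne
    · rcases Finset.eq_empty_or_nonempty (I ∩ (W \ K)) with h2 | h2
      · rw [h2, Finset.union_empty] at hIK ⊢
        exact key₁ h1 hIK
      · by_cases h3 : I ∩ K = K
        · rw [h3] at hdis ⊢
          exact (hμ.union_lt K _ hKne h2 hdis).mpr (key₂ h2)
        · exact hμ.union_lt_of_lt _ _ _ h1 h2 hKne hdis (key₁ h1 h3) (key₂ h2)

/-- If `K` is not closed, admitting it changes nothing. If it is closed, the support decomposes as
in `SlopeData.allClosed_union`, and the unrestricted arrows from `W \ K` to `K` contribute a power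
of `x + 1` by the binomial theorem. -/
theorem SlopeData.supportCount_insert (hμ : SlopeData low L μ) {E : Finset (Finset U)}
    {K W : Finset U} (hK : L K) (hEK : ∀ J ∈ E, μ J < μ K)
    (hlower : ∀ J, L J → μ J < μ K → J ∈ E) (hKW : K ⊆ W) :
    supportCount s t x (fun I => low I ∨ I ∈ insert K E) W =
      supportCount s t x (fun I => low I ∨ I ∈ E) W +
        stableCount s t x μ K * supportCount s t x (fun I => low I ∨ I ∈ E) (W \ K) *
          (x + 1) ^ (arrowsBetween s t (W \ K) K).card := by
  classical
  have hKne := hμ.nonempty K hK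
  rw [supportCount, ← Finset.sum_filter_not_add_sum_filter _ (fun S => ClosedUnder s t S K)]
  congr 1
  · rw [supportCount, Finset.filter_filter]
    congr 1
    refine Finset.filter_congr fun S hS => ⟨?_, ?_⟩
    · rintro ⟨H, hnc⟩ I hI hne hc
      refine (H I hI hne hc).imp_right fun h => ?_
      rcases Finset.mem_insert.mp h with rfl | h
      · exact absurd hc hnc
      · exact h
    · intro H
      refine ⟨fun I hI hne hc => (H I hI hne hc).imp_right Finset.mem_insert_of_mem, fun hc => ?_⟩
      rcases H K hKW hKne hc with h | h
      · exact hμ.not_low K hK h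
      · exact (hEK K h).false
  · have hq : (x + 1) ^ (arrowsBetween s t (W \ K) K).card =
        ∑ S ∈ (arrowsBetween s t (W \ K) K).powerset, x ^ S.card := by
      rw [← Finset.sum_pow_mul_eq_add_pow]
      simp
    rw [hq, stableCount, supportCount, supportCount, Finset.sum_mul_sum, ← Finset.sum_product',
      Finset.sum_mul_sum, ← Finset.sum_product', Finset.filter_filter]
    -- Closedness of `K` excludes just one of the four kinds of arrows, those from `K` to `W \ K`.
    have hd : ∀ {a : A}, a ∈ arrowsBetween s t W W → ClosedUnder s t {a} K →
        a ∈ arrowsBetween s t K K ∪ arrowsBetween s t (W \ K) (W \ K) ∪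
          arrowsBetween s t (W \ K) K := by
      intro a ha hc
      have hc := hc a (Finset.mem_singleton_self a)
      simp only [Finset.mem_union, mem_arrowsBetween, Finset.mem_sdiff] at ha ⊢
      tauto
    have hcc : ∀ {S₁ S₂ S₃ : Finset A}, S₁ ⊆ arrowsBetween s t K K →
        S₂ ⊆ arrowsBetween s t (W \ K) (W \ K) → S₃ ⊆ arrowsBetween s t (W \ K) K →
        Disjoint S₁ S₂ ∧ Disjoint (S₁ ∪ S₂) S₃ ∧
        (S₁ ∪ S₂ ∪ S₃) ∩ arrowsBetween s t K K = S₁ ∧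
        (S₁ ∪ S₂ ∪ S₃) ∩ arrowsBetween s t (W \ K) (W \ K) = S₂ ∧
        (S₁ ∪ S₂ ∪ S₃) ∩ arrowsBetween s t (W \ K) K = S₃ ∧
        (S₁ ∪ S₂ ∪ S₃) ⊆ arrowsBetween s t W W ∧ ClosedUnder s t (S₁ ∪ S₂ ∪ S₃) K := by
      intro S₁ S₂ S₃ h₁ h₂ h₃
      have h₁' := fun a ha => (mem_arrowsBetween s t).mp (@h₁ a ha)
      have h₂' := fun a ha => (mem_arrowsBetween s t).mp (@h₂ a ha)
      have h₃' := fun a ha => (mem_arrowsBetween s t).mp (@h₃ a ha)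
      simp only [Finset.mem_sdiff] at h₁' h₂' h₃'
      refine ⟨?_, ?_, ?_, ?_, ?_, ?_, ?_⟩
      · rw [Finset.disjoint_left]; intro a; specialize h₁' a; specialize h₂' a; tauto
      · rw [Finset.disjoint_left]; intro a; rw [Finset.mem_union]
        specialize h₁' a; specialize h₂' a; specialize h₃' a; tauto
      · ext a; simp only [Finset.mem_inter, Finset.mem_union, mem_arrowsBetween]
        specialize h₁' a; specialize h₂' a; specialize h₃' a; tauto
      · ext a; simp only [Finset.mem_inter, Finset.mem_union, mem_arrowsBetween, Finset.mem_sdiff]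
        specialize h₁' a; specialize h₂' a; specialize h₃' a; tauto
      · ext a; simp only [Finset.mem_inter, Finset.mem_union, mem_arrowsBetween, Finset.mem_sdiff]
        specialize h₁' a; specialize h₂' a; specialize h₃' a; tauto
      · intro a; simp only [Finset.mem_union, mem_arrowsBetween]
        specialize h₁' a; specialize h₂' a; specialize h₃' a
        have := @hKW (s a); have := @hKW (t a); tauto
      · intro a; rw [Finset.mem_union, Finset.mem_union]
        specialize h₁' a; specialize h₂' a; specialize h₃' a; tauto
    refine Finset.sum_nbij' (fun S => ((S ∩ arrowsBetween s t K K,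
        S ∩ arrowsBetween s t (W \ K) (W \ K)), S ∩ arrowsBetween s t (W \ K) K))
      (fun S => S.1.1 ∪ S.1.2 ∪ S.2) ?_ ?_ ?_ ?_ ?_
    · intro S hS
      simp only [Finset.mem_filter, Finset.mem_powerset] at hS
      obtain ⟨hSW, hS, hc⟩ := hS
      have hu : S ∩ arrowsBetween s t K K ∪ S ∩ arrowsBetween s t (W \ K) (W \ K) ∪
          S ∩ arrowsBetween s t (W \ K) K = S := by
        rw [← Finset.inter_union_distrib_left, ← Finset.inter_union_distrib_left,
          Finset.inter_eq_left]
        exact fun a ha => hd (hSW ha) (hc.mono (Finset.singleton_subset_iff.mpr ha))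
      rw [← hu, hμ.allClosed_union hK hEK hlower hKW Finset.inter_subset_right
        Finset.inter_subset_right Finset.inter_subset_right] at hS
      simp only [Finset.mem_product, Finset.mem_filter, Finset.mem_powerset]
      exact ⟨⟨⟨Finset.inter_subset_right, hS.1⟩, Finset.inter_subset_right, hS.2⟩,
        Finset.inter_subset_right⟩
    · rintro ⟨⟨S₁, S₂⟩, S₃⟩ hS
      simp only [Finset.mem_product, Finset.mem_filter, Finset.mem_powerset] at hS ⊢
      obtain ⟨⟨⟨h₁, H₁⟩, h₂, H₂⟩, h₃⟩ := hS
      obtain ⟨-, -, -, -, -, h6, h7⟩ := hcc h₁ h₂ h₃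
      exact ⟨h6, (hμ.allClosed_union hK hEK hlower hKW h₁ h₂ h₃).mpr ⟨H₁, H₂⟩, h7⟩
    · intro S hS
      simp only [Finset.mem_filter, Finset.mem_powerset] at hS
      obtain ⟨hSW, hS, hc⟩ := hS
      dsimp only
      rw [← Finset.inter_union_distrib_left, ← Finset.inter_union_distrib_left,
        Finset.inter_eq_left]
      exact fun a ha => hd (hSW ha) (hc.mono (Finset.singleton_subset_iff.mpr ha))
    · rintro ⟨⟨S₁, S₂⟩, S₃⟩ hS
      simp only [Finset.mem_product, Finset.mem_filter, Finset.mem_powerset] at hS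
      obtain ⟨⟨⟨h₁, H₁⟩, h₂, H₂⟩, h₃⟩ := hS
      obtain ⟨-, -, h3, h4, h5, -, -⟩ := hcc h₁ h₂ h₃
      dsimp only
      rw [h3, h4, h5]
    · intro S hS
      simp only [Finset.mem_filter, Finset.mem_powerset] at hS
      obtain ⟨hSW, hS, hc⟩ := hS
      have hu : S ∩ arrowsBetween s t K K ∪ S ∩ arrowsBetween s t (W \ K) (W \ K) ∪
          S ∩ arrowsBetween s t (W \ K) K = S := by
        rw [← Finset.inter_union_distrib_left, ← Finset.inter_union_distrib_left,
          Finset.inter_eq_left]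
        exact fun a ha => hd (hSW ha) (hc.mono (Finset.singleton_subset_iff.mpr ha))
      obtain ⟨h1, h2, -⟩ := hcc (S₁ := S ∩ arrowsBetween s t K K) Finset.inter_subset_right
        (S₂ := S ∩ arrowsBetween s t (W \ K) (W \ K)) Finset.inter_subset_right
        (S₃ := S ∩ arrowsBetween s t (W \ K) K) Finset.inter_subset_right
      rw [← pow_add, ← pow_add, ← Finset.card_union_of_disjoint h1,
        ← Finset.card_union_of_disjoint h2, hu]

theorem card_arrowsBetween_self {K W : Finset U} (hKW : K ⊆ W) :
    (arrowsBetween s t W W).card = (arrowsBetween s t K K).card +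
      (arrowsBetween s t (W \ K) (W \ K)).card + (arrowsBetween s t K (W \ K)).card +
      (arrowsBetween s t (W \ K) K).card := by
  have hu : arrowsBetween s t W W = arrowsBetween s t K K ∪ arrowsBetween s t (W \ K) (W \ K) ∪
      arrowsBetween s t K (W \ K) ∪ arrowsBetween s t (W \ K) K := by
    ext a
    simp only [Finset.mem_union, mem_arrowsBetween, Finset.mem_sdiff]
    have := @hKW (s a); have := @hKW (t a); tauto
  rw [hu, Finset.card_union_of_disjoint, Finset.card_union_of_disjoint,
    Finset.card_union_of_disjoint]
  all_goals
    rw [Finset.disjoint_left]; intro a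
    simp only [Finset.mem_union, mem_arrowsBetween, Finset.mem_sdiff]; tauto

variable {a b}

/-- The normalization makes the step multiplicative: with `n` arrows in each direction between `K`
and `W \ K`, the extra factor is `b ^ (2 * n) * (x + 1) ^ n = 1`. -/
theorem SlopeData.weightedCount_insert (hμ : SlopeData low L μ) (hb : b ^ 2 * (x + 1) = 1)
    (hadm : ∀ K W, L K → L W → Disjoint K W →
      (∃ S ⊆ arrowsBetween s t K K, AllClosed s t (fun I => low I ∨ L I) K S) →
      (∃ S ⊆ arrowsBetween s t W W, AllClosed s t (fun I => low I ∨ L I) W S) →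
      (arrowsBetween s t K W).card = (arrowsBetween s t W K).card)
    {E : Finset (Finset U)} (hEL : ∀ J ∈ E, L J)
    {K W : Finset U} (hK : L K) (hEK : ∀ J ∈ E, μ J < μ K)
    (hlower : ∀ J, L J → μ J < μ K → J ∈ E) (hW : L W) (hKW : K ⊆ W) :
    weightedCount s t a b x (fun I => low I ∨ I ∈ insert K E) W =
      weightedCount s t a b x (fun I => low I ∨ I ∈ E) W +
        weightedCount s t a b x (fun I => μ I ≤ μ K) K *
          weightedCount s t a b x (fun I => low I ∨ I ∈ E) (W \ K) := by
  classical
  have hKne := hμ.nonempty K hK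
  rw [weightedCount, hμ.supportCount_insert hK hEK hlower hKW, mul_add]
  congr 1
  rw [weightedCount, weightedCount, stableCount]
  set n₁ := supportCount s t x (fun I => μ I ≤ μ K) K with hn₁
  set n₂ := supportCount s t x (fun I => low I ∨ I ∈ E) (W \ K) with hn₂
  -- Equality of the arrow numbers is available only if both pieces carry an allowed support; if one
  -- of the counts vanishes, the term vanishes anyway.
  by_cases h₁ : n₁ = 0
  · rw [h₁]; ring
  by_cases h₂ : n₂ = 0
  · rw [h₂]; ring
  have hcard : (arrowsBetween s t K (W \ K)).card = (arrowsBetween s t (W \ K) K).card := by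
    -- The empty set is not in `L`, so admissibility says nothing about it; here both sets of arrows
    -- are empty.
    rcases Finset.eq_empty_or_nonempty (W \ K) with h0 | h0
    · rw [h0]
      congr 1
      ext a
      simp [mem_arrowsBetween]
    · refine hadm K (W \ K) hK (hμ.sdiff K W hK hW hKW h0) Finset.disjoint_sdiff ?_ ?_
      · rw [hn₁, supportCount] at h₁
        obtain ⟨S, hS, -⟩ := Finset.exists_ne_zero_of_sum_ne_zero h₁
        simp only [Finset.mem_filter, Finset.mem_powerset] at hS
        refine ⟨S, hS.1, fun I hI hne hc => ?_⟩
        by_contra hcon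
        push Not at hcon
        exact (hS.2 I hI hne hc).not_gt (hμ.lt_high I K hne hKne hcon.1 hcon.2 hK)
      · rw [hn₂, supportCount] at h₂
        obtain ⟨S, hS, -⟩ := Finset.exists_ne_zero_of_sum_ne_zero h₂
        simp only [Finset.mem_filter, Finset.mem_powerset] at hS
        exact ⟨S, hS.1, fun I hI hne hc => (hS.2 I hI hne hc).imp_right (hEL I)⟩
  have hW' : W.card = K.card + (W \ K).card := by
    rw [Finset.card_sdiff_of_subset hKW]
    have := Finset.card_le_card hKW
    omega
  have hq : b ^ (arrowsBetween s t (W \ K) K).card * b ^ (arrowsBetween s t (W \ K) K).card *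
      (x + 1) ^ (arrowsBetween s t (W \ K) K).card = 1 := by
    rw [← mul_pow, ← mul_pow, ← pow_two, hb, one_pow]
  rw [card_arrowsBetween_self hKW, hcard, hW', pow_add, pow_add, pow_add, pow_add]
  linear_combination (a ^ K.card * a ^ (W \ K).card * b ^ (arrowsBetween s t K K).card *
    b ^ (arrowsBetween s t (W \ K) (W \ K)).card * n₁ * n₂) * hq

/-- The wall-crossing formula: removing the block that contains a given vertex. -/
theorem SlopeData.weightedCount_eq_sum [Fintype U] (hμ : SlopeData low L μ)
    (hb : b ^ 2 * (x + 1) = 1)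
    (hadm : ∀ K W, L K → L W → Disjoint K W →
      (∃ S ⊆ arrowsBetween s t K K, AllClosed s t (fun I => low I ∨ L I) K S) →
      (∃ S ⊆ arrowsBetween s t W W, AllClosed s t (fun I => low I ∨ L I) W S) →
      (arrowsBetween s t K W).card = (arrowsBetween s t W K).card) [DecidablePred L]
    {W : Finset U} (hW : L W) {v : U} (hv : v ∈ W) :
    weightedCount s t a b x (fun I => low I ∨ L I) W =
      ∑ J ∈ W.powerset with L J ∧ v ∈ J, weightedCount s t a b x (fun I => μ I ≤ μ J) J *
          weightedCount s t a b x (fun I => low I ∨ L I) (W \ J) := by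
  classical
  -- The recursion is proved for every initial segment `E` of the sets in `L`, ordered by slope, and
  -- `E` grows by its element of largest slope.
  suffices h : ∀ E : Finset (Finset U), (∀ J ∈ E, L J) →
      (∀ K ∈ E, ∀ J, L J → μ J < μ K → J ∈ E) → ∀ W, L W → ∀ v ∈ W,
      weightedCount s t a b x (fun I => low I ∨ I ∈ E) W =
        ∑ J ∈ E with J ⊆ W ∧ v ∈ J, weightedCount s t a b x (fun I => μ I ≤ μ J) J *
          weightedCount s t a b x (fun I => low I ∨ I ∈ E) (W \ J) by
    have h' := h (Finset.univ.filter L) (by simp) (by simp +contextual) W hW v hv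
    simp only [Finset.mem_filter, Finset.mem_univ, true_and] at h'
    rw [h']
    congr 1
    ext J
    simp only [Finset.mem_filter, Finset.mem_univ, true_and, Finset.mem_powerset]
    tauto
  intro E
  induction E using Finset.induction_on_max_value μ with
  | empty =>
    -- With nothing admitted, `W` is a closed subset that is neither low nor allowed, so no support
    -- is counted.
    intro _ _ W hW v hv
    rw [weightedCount, supportCount_eq_zero s t x (hμ.nonempty W hW)]
    · simp
    · simpa using hμ.not_low W hW
  | insert K E hKE hmax ih =>
    intro hL hlow W hW v hv
    have hK : L K := hL K (Finset.mem_insert_self _ _)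
    have hKne := hμ.nonempty K hK
    have hEL : ∀ J ∈ E, L J := fun J hJ => hL J (Finset.mem_insert_of_mem hJ)
    have hEK : ∀ J ∈ E, μ J < μ K := fun J hJ => lt_of_le_of_ne (hmax J hJ) fun he =>
      hKE (hμ.injective J K (hμ.nonempty J (hEL J hJ)) hKne he ▸ hJ)
    have hlower : ∀ J, L J → μ J < μ K → J ∈ E := fun J hJ hlt =>
      (Finset.mem_insert.mp (hlow K (Finset.mem_insert_self _ _) J hJ hlt)).resolve_left
        (fun he => by simp [he] at hlt)
    have ih := ih hEL (fun J' hJ' J hJ hlt =>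
      hlower J hJ (hlt.trans (hEK J' hJ')))
    have hstep := fun {W : Finset U} (hW : L W) (hKW : K ⊆ W) =>
      hμ.weightedCount_insert (s := s) (t := t) (a := a) hb hadm hEL hK hEK hlower hW hKW
    have hnot : ∀ W : Finset U, ¬ K ⊆ W →
        weightedCount s t a b x (fun I => low I ∨ I ∈ insert K E) W =
          weightedCount s t a b x (fun I => low I ∨ I ∈ E) W := fun W hKW => by
      rw [weightedCount, weightedCount]
      congr 1
      refine supportCount_congr s t x fun I hI _ => ?_
      have : I ≠ K := fun h => hKW (h ▸ hI)
      simp [this]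
    have hdis : ∀ {J : Finset U}, (∃ v ∈ K, v ∈ J) → ¬ K ⊆ W \ J := fun ⟨v, hvK, hvJ⟩ h =>
      (Finset.mem_sdiff.mp (h hvK)).2 hvJ
    rw [Finset.filter_insert]
    by_cases hKW : K ⊆ W
    · rw [hstep hW hKW]
      by_cases hvK : v ∈ K
      -- Every block `J` in the sum contains `v`, so `W \ J` misses a vertex of `K` and its count is
      -- unchanged. The only new term is `J = K`.
      · rw [if_pos ⟨hKW, hvK⟩, Finset.sum_insert (by simp [hKE]), hnot (W \ K)
          (hdis ⟨v, hvK, hvK⟩), ih W hW v hv, add_comm]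
        congr 1
        refine Finset.sum_congr rfl fun J hJ => ?_
        rw [hnot (W \ J) (hdis ⟨v, hvK, (Finset.mem_filter.mp hJ).2.2⟩)]
      -- Here `K` can only be removed from the complement of a block disjoint from it. These
      -- contributions add up to the stable count of `K` times the recursion for `W \ K`.
      · rw [if_neg (fun h => hvK h.2), ih W hW v hv,
          ih (W \ K) (hμ.sdiff K W hK hW hKW ⟨v, Finset.mem_sdiff.mpr ⟨hv, hvK⟩⟩) v
            (Finset.mem_sdiff.mpr ⟨hv, hvK⟩), Finset.mul_sum]
        have hsub : ∀ J, J ∈ E.filter (fun J => J ⊆ W \ K ∧ v ∈ J) ↔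
            J ∈ (E.filter (fun J => J ⊆ W ∧ v ∈ J)).filter (fun J => Disjoint K J) := by
          intro J
          simp only [Finset.mem_filter, Finset.subset_sdiff, disjoint_comm (a := J)]
          tauto
        rw [Finset.ext hsub, Finset.sum_filter (fun J => Disjoint K J), ← Finset.sum_add_distrib]
        refine Finset.sum_congr rfl fun J hJ => ?_
        obtain ⟨hJE, hJW, hvJ⟩ := Finset.mem_filter.mp hJ
        by_cases hKJ : Disjoint K J
        · rw [if_pos hKJ]
          have hKWJ : K ⊆ W \ J := Finset.subset_sdiff.mpr ⟨hKW, hKJ⟩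
          rw [hstep (hμ.sdiff J W (hEL J hJE) hW hJW
            (hKne.mono hKWJ)) hKWJ, sdiff_sdiff_comm]
          ring
        · rw [if_neg hKJ, add_zero]
          obtain ⟨u, hu⟩ := Finset.not_disjoint_iff.mp hKJ
          rw [hnot (W \ J) (hdis ⟨u, hu⟩)]
    · rw [if_neg (fun h => hKW h.1), hnot W hKW, ih W hW v hv]
      refine Finset.sum_congr rfl fun J hJ => ?_
      rw [hnot (W \ J) (fun h => hKW (h.trans Finset.sdiff_subset))]

end Supports

end AbelianQuiver

namespace AbelianQuiver

/-! ### Slopes -/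

theorem mem_upperHalf_iff {z : ℂ} : z ∈ upperHalf ↔ 0 < z.im ∨ (z.im = 0 ∧ z.re < 0) := by
  constructor
  · rintro ⟨r, φ, hr, h0, h1, rfl⟩
    have e : Complex.I * Real.pi * φ = ((Real.pi * φ : ℝ) : ℂ) * Complex.I := by push_cast; ring
    rw [e, Complex.re_ofReal_mul, Complex.im_ofReal_mul, Complex.exp_ofReal_mul_I_re,
      Complex.exp_ofReal_mul_I_im]
    rcases h1.lt_or_eq with h1 | rfl
    · exact Or.inl (mul_pos hr (Real.sin_pos_of_pos_of_lt_pi (by positivity)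
        (by nlinarith [Real.pi_pos])))
    · right; simp [hr]
  · intro h
    have hz : z ≠ 0 := by rintro rfl; simp at h
    refine ⟨‖z‖, Complex.arg z / Real.pi, norm_pos_iff.mpr hz, ?_, ?_, ?_⟩
    · refine div_pos ?_ Real.pi_pos
      rcases h with h | ⟨h, h'⟩
      · exact lt_of_le_of_ne (Complex.arg_nonneg_iff.mpr h.le) fun h0 =>
          h.ne' (Complex.arg_eq_zero_iff.mp h0.symm).2
      · rw [Complex.arg_eq_pi_iff.mpr ⟨h', h⟩]; exact Real.pi_pos
    · rw [div_le_one Real.pi_pos]; exact Complex.arg_le_pi z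
    · have e : Complex.I * Real.pi * ((Complex.arg z / Real.pi : ℝ) : ℂ) =
          (Complex.arg z : ℂ) * Complex.I := by
        push_cast
        field_simp
      rw [e, Complex.norm_mul_exp_arg_mul_I]

/-- The area form on `ℂ`, which on `ℍ₊` compares slopes. -/
def cross (z w : ℂ) : ℝ := z.im * w.re - z.re * w.im

theorem cross_add_left (z z' w : ℂ) : cross (z + z') w = cross z w + cross z' w := by
  simp [cross]; ring

theorem cross_swap (z w : ℂ) : cross w z = - cross z w := by
  simp [cross]; ring

@[simp] theorem cross_self (z : ℂ) : cross z z = 0 := by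
  simp [cross]; ring

theorem upperHalf_add {z w : ℂ} (hz : z ∈ upperHalf) (hw : w ∈ upperHalf) :
    z + w ∈ upperHalf := by
  rw [mem_upperHalf_iff] at *
  rw [Complex.add_im, Complex.add_re]
  rcases hz with hz | hz <;> rcases hw with hw | hw
  · left; linarith
  · left; linarith
  · left; linarith
  · right; constructor <;> linarith

theorem cross_eq_zero_iff {z w : ℂ} (hz : z ∈ upperHalf) (hw : w ∈ upperHalf) :
    cross z w = 0 ↔ ∃ t : ℝ, 0 < t ∧ z = t * w := by
  constructor
  · intro h
    rw [mem_upperHalf_iff] at *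
    rw [cross] at h
    rcases hw with hw | ⟨hw, hw'⟩
    · have hz' : 0 < z.im := by
        rcases hz with hz | ⟨hz, hz'⟩
        · exact hz
        · rw [hz] at h; nlinarith
      refine ⟨z.im / w.im, div_pos hz' hw, Complex.ext ?_ ?_⟩
      · rw [Complex.re_ofReal_mul]; field_simp; linarith
      · rw [Complex.im_ofReal_mul]; field_simp
    · have h0 : z.im = 0 := by
        rw [hw, mul_zero, sub_zero] at h
        exact (mul_eq_zero.mp h).resolve_right hw'.ne
      have hz' : z.re < 0 := by
        rcases hz with hz | hz
        · exact absurd h0 hz.ne'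
        · exact hz.2
      refine ⟨z.re / w.re, div_pos_of_neg_of_neg hz' hw', Complex.ext ?_ ?_⟩
      · rw [Complex.re_ofReal_mul, div_mul_cancel₀ _ hw'.ne]
      · rw [Complex.im_ofReal_mul, hw, h0]; simp
  · rintro ⟨t, -, rfl⟩
    rw [cross, Complex.im_ofReal_mul, Complex.re_ofReal_mul]; ring

section

variable {V : Type} (Z : Stability V)

/-- For finite slopes this is clearing positive denominators. The form `cross` also gives the right
answer on the negative real axis, where the slope is infinite, and unlike the slope it is additive.
-/
theorem Stability.slope_lt_iff {α β : V →₀ ℤ} (hα : Z.Z α ∈ upperHalf) (hβ : Z.Z β ∈ upperHalf) :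
    Z.slope α < Z.slope β ↔ cross (Z.Z α) (Z.Z β) < 0 := by
  rw [mem_upperHalf_iff] at hα hβ
  rw [Stability.slope, Stability.slope, cross]
  rcases hα with hα | ⟨hα, hα'⟩ <;> rcases hβ with hβ | ⟨hβ, hβ'⟩
  · rw [if_neg hα.ne', if_neg hβ.ne', WithTop.coe_lt_coe, div_lt_div_iff₀ hα hβ]
    constructor <;> intro h <;> linarith
  · rw [if_neg hα.ne', if_pos hβ, hβ]
    simp [mul_neg_of_pos_of_neg hα hβ']
  · rw [if_pos hα, hα]
    simp only [not_top_lt, zero_mul, zero_sub, false_iff, not_lt]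
    nlinarith
  · simp [hα, hβ]

theorem Stability.slope_le_iff {α β : V →₀ ℤ} (hα : Z.Z α ∈ upperHalf) (hβ : Z.Z β ∈ upperHalf) :
    Z.slope α ≤ Z.slope β ↔ cross (Z.Z α) (Z.Z β) ≤ 0 := by
  rw [← not_lt, Z.slope_lt_iff hβ hα, cross_swap]
  constructor <;> intro h <;> linarith

/-- The value of the stability function on a set of vertices. -/
noncomputable def Stability.charge (I : Finset V) : ℂ := Z.Z (∑ i ∈ I, Finsupp.single i 1)

theorem Stability.charge_eq_sum (I : Finset V) :
    Z.charge I = ∑ i ∈ I, Z.Z (Finsupp.single i 1) := map_sum _ _ _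

theorem Stability.charge_mem {I : Finset V} (hI : I.Nonempty) : Z.charge I ∈ upperHalf := by
  rw [Z.charge_eq_sum]
  exact Finset.sum_induction_nonempty _ (· ∈ upperHalf) (fun _ _ => upperHalf_add) hI
    fun i _ => Z.mem_upperHalf i

theorem Stability.slopeSet_lt_iff {I J : Finset V} (hI : I.Nonempty) (hJ : J.Nonempty) :
    Z.slopeSet I < Z.slopeSet J ↔ cross (Z.charge I) (Z.charge J) < 0 :=
  Z.slope_lt_iff (Z.charge_mem hI) (Z.charge_mem hJ)

theorem Stability.slopeSet_le_iff {I J : Finset V} (hI : I.Nonempty) (hJ : J.Nonempty) :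
    Z.slopeSet I ≤ Z.slopeSet J ↔ cross (Z.charge I) (Z.charge J) ≤ 0 :=
  Z.slope_le_iff (Z.charge_mem hI) (Z.charge_mem hJ)

theorem Stability.charge_union [DecidableEq V] {I J : Finset V} (h : Disjoint I J) :
    Z.charge (I ∪ J) = Z.charge I + Z.charge J := by
  rw [Z.charge_eq_sum, Finset.sum_union h, ← Z.charge_eq_sum, ← Z.charge_eq_sum]

/-- A generic deformation defines slope data for the sets of vertices, relative to a ray. -/
theorem slopeData_of_isDeformation [DecidableEq V] {Z Z' : Stability V} (h : IsDeformation Z Z')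
    {z : ℂ} (hz : z ∈ upperHalf) :
    SlopeData (fun J => cross (Z.charge J) z < 0) (fun J => ∃ t : ℝ, 0 < t ∧ Z.charge J = t * z)
      Z'.slopeSet := by
  have hne : ∀ J, (∃ t : ℝ, 0 < t ∧ Z.charge J = t * z) → J.Nonempty := by
    rintro J ⟨t, ht, he⟩
    rw [Finset.nonempty_iff_ne_empty]
    rintro rfl
    rw [Z.charge_eq_sum, Finset.sum_empty] at he
    have : z ≠ 0 := by rintro rfl; simp [mem_upperHalf_iff] at hz
    exact absurd he.symm (mul_ne_zero (by exact_mod_cast ht.ne') this)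
  have hcr : ∀ {t : ℝ} {w : ℂ}, cross w (t * z) = t * cross w z := by
    intro t w
    rw [cross, cross, Complex.im_ofReal_mul, Complex.re_ofReal_mul]; ring
  refine ⟨fun I J hI hJ he => by_contra fun hne => h.1 I J hI hJ hne he, ?_, ?_, ?_, ?_, ?_, hne, ?_⟩
  -- The seesaw property: `cross` is additive in the charge and vanishes on the diagonal.
  · intro K J hK hJ hd
    rw [Z'.slopeSet_lt_iff (hK.mono Finset.subset_union_left) hK, Z'.slopeSet_lt_iff hJ hK,
      Z'.charge_union hd, cross_add_left, cross_self, zero_add]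
  · intro I J K hI hJ hK hd
    rw [Z'.slopeSet_lt_iff (hI.mono Finset.subset_union_left) hK, Z'.slopeSet_lt_iff hI hK,
      Z'.slopeSet_lt_iff hJ hK, Z'.charge_union hd, cross_add_left]
    exact add_neg
  · rintro J K hJ hK hl ⟨t, ht, he⟩
    refine h.2 J K hJ hK ?_
    rw [Z.slopeSet_lt_iff hJ hK, he, hcr]
    exact mul_neg_of_pos_of_neg ht hl
  · rintro J K hJ hK hl hL ⟨t, ht, he⟩
    refine h.2 K J hK hJ ?_
    rw [Z.slopeSet_lt_iff hK hJ, he, cross_swap, hcr, neg_lt_zero]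
    refine mul_pos ht (lt_of_le_of_ne (not_lt.mp hl) fun h0 => hL ?_)
    exact (cross_eq_zero_iff (Z.charge_mem hJ) hz).mp h0.symm
  · rintro J ⟨t, ht, he⟩
    rw [he, cross_swap, hcr]; simp
  -- The difference of the charges is a real multiple of `z`; the multiple is positive because the
  -- charge of a non-empty set lies in `upperHalf`.
  · rintro K W ⟨t, ht, he⟩ ⟨t', ht', he'⟩ hKW hn
    refine (cross_eq_zero_iff (Z.charge_mem hn) hz).mp ?_
    have hu := Z.charge_union (Finset.disjoint_sdiff (s := K) (t := W))
    rw [Finset.union_sdiff_of_subset hKW, he, he'] at hu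
    have : Z.charge (W \ K) = t' * z - t * z := by rw [hu]; ring
    rw [this, cross_swap, sub_eq_add_neg, cross_swap, cross_add_left]
    simp [cross]; ring

end

/-! ### Supports and transport along embeddings of quivers -/

section Transport

variable {U U' A A' : Type*} [DecidableEq U] [DecidableEq A] [DecidableEq U'] [DecidableEq A']
  [Fintype A] [Fintype A'] {s t : A → U} {s' t' : A' → U'} (φ : U' ↪ U) (ψ : A' ↪ A)

theorem arrowsBetween_map (hs : ∀ a, s (ψ a) = φ (s' a)) (ht : ∀ a, t (ψ a) = φ (t' a))
    (hψ : ∀ a, s a ∈ Set.range φ → t a ∈ Set.range φ → a ∈ Set.range ψ) (W : Finset U') :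
    arrowsBetween s t (W.map φ) (W.map φ) = (arrowsBetween s' t' W W).map ψ := by
  ext a
  simp only [mem_arrowsBetween, Finset.mem_map]
  constructor
  · rintro ⟨⟨v, hv, hv'⟩, w, hw, hw'⟩
    obtain ⟨a, rfl⟩ := hψ a ⟨v, hv'⟩ ⟨w, hw'⟩
    rw [hs] at hv'; rw [ht] at hw'
    exact ⟨a, ⟨φ.injective hv' ▸ hv, φ.injective hw' ▸ hw⟩, rfl⟩
  · rintro ⟨a, ⟨h1, h2⟩, rfl⟩
    exact ⟨⟨_, h1, (hs a).symm⟩, _, h2, (ht a).symm⟩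

theorem allClosed_map (hs : ∀ a, s (ψ a) = φ (s' a)) (ht : ∀ a, t (ψ a) = φ (t' a))
    {P : Finset U → Prop} {P' : Finset U' → Prop} {W : Finset U'}
    (hP : ∀ I ⊆ W, I.Nonempty → (P' I ↔ P (I.map φ))) (S : Finset A') :
    AllClosed s t P (W.map φ) (S.map ψ) ↔ AllClosed s' t' P' W S := by
  have hc : ∀ I : Finset U', ClosedUnder s t (S.map ψ) (I.map φ) ↔ ClosedUnder s' t' S I := by
    intro I
    have hm : ∀ v, φ v ∈ I.map φ ↔ v ∈ I := fun v => Finset.mem_map' φ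
    constructor
    · intro H a ha h
      have := H (ψ a) (Finset.mem_map_of_mem ψ ha)
      rw [hs, ht, hm, hm] at this
      exact this h
    · intro H a ha h
      obtain ⟨a, ha', rfl⟩ := Finset.mem_map.mp ha
      rw [hs, hm] at h
      rw [ht, hm]
      exact H a ha' h
  constructor
  · intro H I hI hne hcl
    exact (hP I hI hne).mpr (H _ (Finset.map_subset_map.mpr hI) (hne.map) ((hc I).mpr hcl))
  · intro H I hI hne hcl
    obtain ⟨I, hI', rfl⟩ := Finset.subset_map_iff.mp hI
    have hne' : I.Nonempty := Finset.map_nonempty.mp hne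
    exact (hP I hI' hne').mp (H I hI' hne' ((hc I).mp hcl))

/-- The count sees only the full subquiver on its vertices: `hψ` says that no arrow between vertices
in the image of `φ` is lost. -/
theorem weightedCount_map {k : Type*} [CommRing k] (a b x : k)
    (hs : ∀ a, s (ψ a) = φ (s' a)) (ht : ∀ a, t (ψ a) = φ (t' a))
    (hψ : ∀ a, s a ∈ Set.range φ → t a ∈ Set.range φ → a ∈ Set.range ψ)
    {P : Finset U → Prop} {P' : Finset U' → Prop} {W : Finset U'}
    (hP : ∀ I ⊆ W, I.Nonempty → (P' I ↔ P (I.map φ))) :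
    weightedCount s t a b x P (W.map φ) = weightedCount s' t' a b x P' W := by
  classical
  rw [weightedCount, weightedCount, arrowsBetween_map φ ψ hs ht hψ, Finset.card_map,
    Finset.card_map]
  congr 1
  rw [supportCount, supportCount, arrowsBetween_map φ ψ hs ht hψ]
  symm
  refine Finset.sum_nbij (fun S => S.map ψ) ?_ ?_ ?_ ?_
  · intro S hS
    simp only [Finset.mem_filter, Finset.mem_powerset] at hS ⊢
    exact ⟨Finset.map_subset_map.mpr hS.1, (allClosed_map φ ψ hs ht hP S).mpr hS.2⟩
  · exact (Finset.map_injective ψ).injOn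
  · intro S hS
    simp only [Finset.coe_filter, Finset.mem_powerset, Set.mem_ofPred_eq] at hS
    obtain ⟨S, hS', rfl⟩ := Finset.subset_map_iff.mp hS.1
    refine ⟨S, ?_, rfl⟩
    simp only [Finset.coe_filter, Finset.mem_powerset, Set.mem_ofPred_eq]
    exact ⟨hS', (allClosed_map φ ψ hs ht hP S).mp hS.2⟩
  · intro S _
    rw [Finset.card_map]

end Transport

end AbelianQuiver

namespace AbelianQuiver

noncomputable section

theorem ι_mem {X : Scheme.{0}} (U : X.Opens) (y : (U : Scheme.{0})) : U.ι y ∈ U := y.2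

theorem exists_ι_eq {X : Scheme.{0}} {U : X.Opens} {x : X} (hx : x ∈ U) :
    ∃ y : (U : Scheme.{0}), U.ι y = x := ⟨⟨x, hx⟩, rfl⟩

theorem appTop_comp_apply {X Y Z : Scheme.{0}} (f : X ⟶ Y) (g : Y ⟶ Z) (s : Γ(Z, ⊤)) :
    (f ≫ g).appTop s = f.appTop (g.appTop s) := by
  rw [Scheme.Hom.comp_appTop, CommRingCat.comp_apply]

theorem appTop_id_apply {X : Scheme.{0}} (s : Γ(X, ⊤)) : (𝟙 X : X ⟶ X).appTop s = s := by
  simp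

/-! ### The Grothendieck ring of varieties -/

theorem K0.mk_eq {p q : MvPolynomial Variety ℤ} (h : K0Rel (p - q)) :
    Ideal.Quotient.mk (Ideal.span {p | K0Rel p}) p =
      Ideal.Quotient.mk (Ideal.span {p | K0Rel p}) q :=
  Ideal.Quotient.eq.mpr (Ideal.subset_span h)

theorem K0.cls_eq_of_iso {X Y : Variety} (e : X.X ≅ Y.X) (he : e.hom ≫ Y.str = X.str) :
    K0.cls X = K0.cls Y := K0.mk_eq (.iso X Y e he)

theorem K0.cls_cut {X Y U : Variety} (i : Y.X ⟶ X.X) (j : U.X ⟶ X.X)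
    (hi : i ≫ X.str = Y.str) (hj : j ≫ X.str = U.str) (hci : IsClosedImmersion i)
    (hoj : IsOpenImmersion j) (h : Set.range j = (Set.range i)ᶜ) :
    K0.cls X = K0.cls Y + K0.cls U :=
  (K0.mk_eq (.cut X Y U i j hi hj hci hoj h)).trans (map_add _ _ _)

theorem K0.cls_prod (X Y : Variety) : K0.cls (X.prod Y) = K0.cls X * K0.cls Y :=
  (K0.mk_eq (.prod X Y)).trans (map_mul _ _ _)

theorem K0.cls_point : K0.cls Variety.point = 1 :=
  (K0.mk_eq .point).trans (map_one _)

/-- Cut `X` along itself: the complement is empty. -/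
theorem K0.cls_ofOpens_bot (X : Variety) : K0.cls (X.ofOpens ⊥) = 0 := by
  have h : K0.cls X = K0.cls X + K0.cls (X.ofOpens ⊥) := by
    refine K0.cls_cut (U := X.ofOpens ⊥) (𝟙 X.X) (⊥ : X.X.Opens).ι (Category.id_comp _) rfl
      inferInstance (inferInstanceAs (IsOpenImmersion (⊥ : X.X.Opens).ι)) ?_
    have h1 : Set.range (⊥ : X.X.Opens).ι = ∅ := by simp
    have h2 : Set.range (𝟙 X.X : X.X ⟶ X.X) = Set.univ := by simp
    rw [h2, Set.compl_univ]
    exact h1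
  exact left_eq_add.mp h

theorem K0.cls_ofOpens_top (X : Variety) : K0.cls (X.ofOpens ⊤) = K0.cls X :=
  K0.cls_eq_of_iso (X := X.ofOpens ⊤) X.X.topIso rfl

/-- Cutting an open subset along a closed immersion. -/
theorem K0.cls_ofOpens_cut {X Y : Variety} (z : Y.X ⟶ X.X) (hz : z ≫ X.str = Y.str)
    (hci : IsClosedImmersion z) {U V : X.X.Opens} (hUV : U ≤ V)
    (h : ∀ x ∈ V, x ∈ U ↔ x ∉ Set.range z) :
    K0.cls (X.ofOpens V) = K0.cls (Y.ofOpens (z ⁻¹ᵁ V)) + K0.cls (X.ofOpens U) := by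
  refine K0.cls_cut (X := X.ofOpens V) (Y := Y.ofOpens (z ⁻¹ᵁ V)) (U := X.ofOpens U)
    (z ∣_ V) (X.X.homOfLE hUV) ?_ ?_ (inferInstanceAs (IsClosedImmersion (z ∣_ V)))
    (inferInstanceAs (IsOpenImmersion (X.X.homOfLE hUV))) ?_
  · change z ∣_ V ≫ V.ι ≫ X.str = (z ⁻¹ᵁ V).ι ≫ Y.str
    rw [morphismRestrict_ι_assoc, hz]
  · change X.X.homOfLE hUV ≫ V.ι ≫ X.str = U.ι ≫ X.str
    rw [Scheme.homOfLE_ι_assoc]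
  · ext y
    have h1 : y ∈ Set.range (X.X.homOfLE hUV) ↔ V.ι y ∈ U := by
      constructor
      · rintro ⟨w, rfl⟩
        rw [← Scheme.Hom.comp_apply, Scheme.homOfLE_ι]
        exact ι_mem U w
      · intro hU
        obtain ⟨w, hw⟩ := exists_ι_eq hU
        exact ⟨w, V.ι.injective (by rw [← Scheme.Hom.comp_apply, Scheme.homOfLE_ι, hw])⟩
    have h2 : y ∈ Set.range (z ∣_ V) ↔ V.ι y ∈ Set.range z := by
      constructor
      · rintro ⟨w, rfl⟩
        rw [← Scheme.Hom.comp_apply, morphismRestrict_ι, Scheme.Hom.comp_apply]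
        exact ⟨_, rfl⟩
      · rintro ⟨u, hu⟩
        obtain ⟨w, hw⟩ := exists_ι_eq (U := z ⁻¹ᵁ V) (x := u)
          (show z u ∈ V from hu ▸ ι_mem V y)
        exact ⟨w, V.ι.injective (by
          rw [← Scheme.Hom.comp_apply, morphismRestrict_ι, Scheme.Hom.comp_apply, hw, hu])⟩
    exact h1.trans ((h _ (ι_mem V y)).trans (not_congr h2.symm))

/-- A closed subset of a variety with its reduced structure. -/
def Variety.ofClosed (X : Variety) (C : TopologicalSpace.Closeds X.X) : Variety where
  X := (Scheme.IdealSheafData.vanishingIdeal C).subscheme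
  str := (Scheme.IdealSheafData.vanishingIdeal C).subschemeι ≫ X.str

/-- Inclusion–exclusion for open subsets. -/
theorem K0.cls_ofOpens_sup (X : Variety) (U V : X.X.Opens) :
    K0.cls (X.ofOpens (U ⊔ V)) + K0.cls (X.ofOpens (U ⊓ V)) =
      K0.cls (X.ofOpens U) + K0.cls (X.ofOpens V) := by
  let Y := X.ofClosed U.compl
  let z : Y.X ⟶ X.X := (Scheme.IdealSheafData.vanishingIdeal U.compl).subschemeι
  have hci : IsClosedImmersion z := inferInstanceAs
    (IsClosedImmersion (Scheme.IdealSheafData.vanishingIdeal U.compl).subschemeι)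
  have hz : ∀ x : X.X, x ∈ Set.range z ↔ x ∉ U := by
    intro x
    change x ∈ Set.range (Scheme.IdealSheafData.vanishingIdeal U.compl).subschemeι ↔ x ∉ U
    rw [Scheme.IdealSheafData.range_subschemeι]
    simp
  have h1 := K0.cls_ofOpens_cut (X := X) (Y := Y) z rfl hci (le_sup_left : U ≤ U ⊔ V)
    (fun x _ => by rw [hz, not_not])
  have h2 := K0.cls_ofOpens_cut (X := X) (Y := Y) z rfl hci (inf_le_right : U ⊓ V ≤ V)
    (fun x hx => by rw [hz, not_not]; exact ⟨fun h => h.1, fun h => ⟨h, hx⟩⟩)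
  -- Removing `U` from `U ⊔ V` and removing `U ⊓ V` from `V` leave the same closed piece.
  have h3 : z ⁻¹ᵁ (U ⊔ V) = z ⁻¹ᵁ V := by
    ext y
    refine ⟨fun h => ?_, fun h => Or.inr h⟩
    exact h.resolve_left ((hz _).mp ⟨y, rfl⟩)
  rw [h1, h2, h3]
  ring

/-! ### Affine spaces, tori and coordinate open subsets -/

theorem cls_affine_equiv {m n : Type} [Finite m] [Finite n] (e : m ≃ n) :
    K0.cls (Variety.affine m) = K0.cls (Variety.affine n) := by
  let f : 𝔸(m; SpecC) ≅ 𝔸(n; SpecC) :=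
    { hom := AffineSpace.reindex e.symm SpecC
      inv := AffineSpace.reindex e SpecC
      hom_inv_id := by refine AffineSpace.hom_ext ?_ fun i => ?_
                       · simp
                       · rw [appTop_comp_apply, AffineSpace.reindex_appTop_coord,
                           AffineSpace.reindex_appTop_coord, appTop_id_apply]; simp
      inv_hom_id := by refine AffineSpace.hom_ext ?_ fun i => ?_
                       · simp
                       · rw [appTop_comp_apply, AffineSpace.reindex_appTop_coord,
                           AffineSpace.reindex_appTop_coord, appTop_id_apply]; simp }
  exact K0.cls_eq_of_iso (X := Variety.affine m) (Y := Variety.affine n) f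
    (AffineSpace.reindex_over _ _)

theorem cls_affine_option (n : Type) [Finite n] :
    K0.cls (Variety.affine (Option n)) = K0.cls (Variety.affine n) * K0.lefschetz := by
  rw [K0.lefschetz, ← K0.cls_prod]
  let f : 𝔸(Option n; SpecC) ⟶ pullback (𝔸(n; SpecC) ↘ SpecC) (𝔸(Unit; SpecC) ↘ SpecC) :=
    pullback.lift (AffineSpace.reindex some SpecC) (AffineSpace.reindex (fun _ => none) SpecC)
      (by simp)
  let g : pullback (𝔸(n; SpecC) ↘ SpecC) (𝔸(Unit; SpecC) ↘ SpecC) ⟶ 𝔸(Option n; SpecC) :=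
    AffineSpace.homOfVector (pullback.fst _ _ ≫ 𝔸(n; SpecC) ↘ SpecC)
      (fun o => o.elim ((pullback.snd (𝔸(n; SpecC) ↘ SpecC) (𝔸(Unit; SpecC) ↘ SpecC)).appTop
          (AffineSpace.coord SpecC ()))
        (fun i => (pullback.fst (𝔸(n; SpecC) ↘ SpecC) (𝔸(Unit; SpecC) ↘ SpecC)).appTop
          (AffineSpace.coord SpecC i)))
  have hf1 : f ≫ pullback.fst _ _ = AffineSpace.reindex some SpecC := pullback.lift_fst _ _ _
  have hf2 : f ≫ pullback.snd _ _ = AffineSpace.reindex (fun _ => none) SpecC :=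
    pullback.lift_snd _ _ _
  let e : 𝔸(Option n; SpecC) ≅ pullback (𝔸(n; SpecC) ↘ SpecC) (𝔸(Unit; SpecC) ↘ SpecC) := by
    refine ⟨f, g, ?_, ?_⟩
    · refine AffineSpace.hom_ext ?_ fun o => ?_
      · rw [Category.assoc, AffineSpace.homOfVector_over, reassoc_of% hf1,
          AffineSpace.reindex_over, Category.id_comp]
      · rw [appTop_comp_apply, AffineSpace.homOfVector_appTop_coord]
        rcases o with _ | i
        · rw [Option.elim_none, ← appTop_comp_apply, hf2, AffineSpace.reindex_appTop_coord,
            appTop_id_apply]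
        · rw [Option.elim_some, ← appTop_comp_apply, hf1, AffineSpace.reindex_appTop_coord,
            appTop_id_apply]
    · refine pullback.hom_ext ?_ ?_
      · rw [Category.assoc, hf1, Category.id_comp]
        refine AffineSpace.hom_ext ?_ fun i => ?_
        · rw [Category.assoc, AffineSpace.reindex_over, AffineSpace.homOfVector_over]
        · rw [appTop_comp_apply, AffineSpace.reindex_appTop_coord,
            AffineSpace.homOfVector_appTop_coord]
          rfl
      · rw [Category.assoc, hf2, Category.id_comp]
        refine AffineSpace.hom_ext ?_ fun i => ?_
        · rw [Category.assoc, AffineSpace.reindex_over, AffineSpace.homOfVector_over,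
            pullback.condition]
        · rw [appTop_comp_apply, AffineSpace.reindex_appTop_coord,
            AffineSpace.homOfVector_appTop_coord]
          rfl
  refine K0.cls_eq_of_iso (X := Variety.affine (Option n))
    (Y := (Variety.affine n).prod (Variety.affine Unit)) e ?_
  change f ≫ pullback.fst _ _ ≫ 𝔸(n; SpecC) ↘ SpecC = _
  rw [reassoc_of% hf1, AffineSpace.reindex_over]
  rfl

theorem cls_affine (n : Type) [Finite n] :
    K0.cls (Variety.affine n) = K0.lefschetz ^ Nat.card n := by
  have : ∀ (n : Type) [Finite n],
      (fun n : Type => ∀ h : Finite n, K0.cls (Variety.affine n) = K0.lefschetz ^ Nat.card n) n := by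
    intro n _
    refine Finite.induction_empty_option (P := fun n : Type => ∀ h : Finite n,
      K0.cls (Variety.affine n) = K0.lefschetz ^ Nat.card n) ?_ ?_ ?_ n
    · intro m n e h hn
      have hm := Finite.of_equiv n e.symm
      rw [← cls_affine_equiv e, h hm, Nat.card_congr e]
    · intro _
      rw [Nat.card_of_isEmpty, pow_zero, ← K0.cls_point]
      let e : 𝔸(PEmpty; SpecC) ≅ SpecC :=
        { hom := 𝔸(PEmpty; SpecC) ↘ SpecC
          inv := AffineSpace.homOfVector (𝟙 _) PEmpty.elim
          hom_inv_id := by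
            refine AffineSpace.hom_ext ?_ fun i => i.elim
            rw [Category.assoc, AffineSpace.homOfVector_over, Category.comp_id, Category.id_comp]
          inv_hom_id := AffineSpace.homOfVector_over _ _ }
      exact K0.cls_eq_of_iso (X := Variety.affine PEmpty) (Y := Variety.point) e
        (Category.comp_id _)
    · intro n _ h _
      rw [cls_affine_option, h inferInstance, Finite.card_option, pow_succ]
  exact this n inferInstance

end

end AbelianQuiver

namespace AbelianQuiver

noncomputable section

theorem mem_basicOpen_iff {X : Scheme.{0}} (f : Γ(X, ⊤)) (x : X) :
    x ∈ X.basicOpen f ↔ X.Γevaluation x f ≠ 0 :=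
  (Scheme.evaluation_ne_zero_iff_mem_basicOpen (U := ⊤) _ x trivial _).symm

theorem mem_basicOpen_prod_iff {X : Scheme.{0}} {ι : Type*} (S : Finset ι) (f : ι → Γ(X, ⊤))
    (x : X) : x ∈ X.basicOpen (∏ i ∈ S, f i) ↔ ∀ i ∈ S, x ∈ X.basicOpen (f i) := by
  simp only [mem_basicOpen_iff, map_prod, Finset.prod_ne_zero_iff]

theorem mem_basicOpen_appTop_iff {X Y : Scheme.{0}} (f : X ⟶ Y) (s : Γ(Y, ⊤)) (x : X) :
    x ∈ X.basicOpen (f.appTop s) ↔ f x ∈ Y.basicOpen s := by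
  rw [← Scheme.preimage_basicOpen_top]
  rfl

section Coordinates

variable {n : Type} [Fintype n]

open Classical in
/-- The set of non-vanishing coordinates of a point of affine space. -/
def coordSupport (x : 𝔸(n; SpecC)) : Finset n :=
  {i | x ∈ (𝔸(n; SpecC)).basicOpen (AffineSpace.coord SpecC i)}

theorem mem_coordSupport {x : 𝔸(n; SpecC)} {i : n} :
    i ∈ coordSupport x ↔ x ∈ (𝔸(n; SpecC)).basicOpen (AffineSpace.coord SpecC i) := by
  simp [coordSupport]

/-- The locus in affine space where the coordinates in `S` do not vanish. -/
def coordOpen (S : Finset n) : (𝔸(n; SpecC)).Opens :=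
  (𝔸(n; SpecC)).basicOpen (∏ i ∈ S, AffineSpace.coord SpecC i)

theorem mem_coordOpen {S : Finset n} {x : 𝔸(n; SpecC)} :
    x ∈ coordOpen S ↔ S ⊆ coordSupport x := by
  rw [coordOpen, mem_basicOpen_prod_iff]
  simp only [Finset.subset_iff, mem_coordSupport]

theorem coordOpen_union [DecidableEq n] (S T : Finset n) :
    coordOpen (S ∪ T) = coordOpen S ⊓ coordOpen T := by
  ext x
  exact mem_coordOpen.trans (Finset.union_subset_iff.trans
    (and_congr mem_coordOpen.symm mem_coordOpen.symm))

/-- The union of the loci `coordOpen S`. -/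
def coordOpens (𝒰 : Finset (Finset n)) : (𝔸(n; SpecC)).Opens := ⨆ S ∈ 𝒰, coordOpen S

theorem mem_coordOpens {𝒰 : Finset (Finset n)} {x : 𝔸(n; SpecC)} :
    x ∈ coordOpens 𝒰 ↔ ∃ S ∈ 𝒰, S ⊆ coordSupport x := by
  simp only [coordOpens, TopologicalSpace.Opens.mem_iSup, mem_coordOpen, exists_prop]

theorem mem_coordOpens_of_upper {𝒰 : Finset (Finset n)}
    (h : ∀ S ∈ 𝒰, ∀ T, S ⊆ T → T ∈ 𝒰) {x : 𝔸(n; SpecC)} :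
    x ∈ coordOpens 𝒰 ↔ coordSupport x ∈ 𝒰 :=
  mem_coordOpens.trans ⟨fun ⟨S, hS, hle⟩ => h S hS _ hle, fun h => ⟨_, h, subset_rfl⟩⟩

theorem torus_eq (n : Type) [Fintype n] :
    torus n = (Variety.affine n).ofOpens (coordOpen (Finset.univ : Finset n)) := by
  have h : ∏ᶠ i : n, AffineSpace.coord SpecC i = ∏ i, AffineSpace.coord SpecC i :=
    finprod_eq_prod_of_fintype _
  exact congrArg (fun f => (Variety.affine n).ofOpens ((𝔸(n; SpecC)).basicOpen f)) h

/-- The inclusion of a coordinate subspace. -/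
def coordInclusion (S : Finset n) : 𝔸(S; SpecC) ⟶ 𝔸(n; SpecC) :=
  open Classical in AffineSpace.homOfVector (𝔸(S; SpecC) ↘ SpecC)
    (fun i => if h : i ∈ S then AffineSpace.coord SpecC ⟨i, h⟩ else 0)

theorem coordInclusion_over (S : Finset n) :
    coordInclusion S ≫ 𝔸(n; SpecC) ↘ SpecC = 𝔸(S; SpecC) ↘ SpecC :=
  AffineSpace.homOfVector_over _ _

theorem coordInclusion_reindex (S : Finset n) :
    coordInclusion S ≫ AffineSpace.reindex (Subtype.val : S → n) SpecC = 𝟙 _ := by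
  refine AffineSpace.hom_ext ?_ fun i => ?_
  · rw [Category.assoc, AffineSpace.reindex_over, coordInclusion_over, Category.id_comp]
  · rw [appTop_comp_apply, AffineSpace.reindex_appTop_coord, coordInclusion,
      AffineSpace.homOfVector_appTop_coord, appTop_id_apply, dif_pos i.2]

/-- A section of a separated morphism is a closed immersion; the retraction forgets the coordinates
outside `S`. -/
theorem isClosedImmersion_coordInclusion (S : Finset n) :
    IsClosedImmersion (coordInclusion S) := by
  have : IsClosedImmersion
      (coordInclusion S ≫ AffineSpace.reindex (Subtype.val : S → n) SpecC) := by
    rw [coordInclusion_reindex]; infer_instance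
  exact IsClosedImmersion.of_comp _ (AffineSpace.reindex (Subtype.val : S → n) SpecC)

theorem mem_coordSupport_coordInclusion {S : Finset n} {x : 𝔸(S; SpecC)} {i : n} :
    i ∈ coordSupport (coordInclusion S x) ↔ ∃ h : i ∈ S, ⟨i, h⟩ ∈ coordSupport x := by
  rw [mem_coordSupport, ← mem_basicOpen_appTop_iff, coordInclusion,
    AffineSpace.homOfVector_appTop_coord]
  by_cases h : i ∈ S
  · simp [h, mem_coordSupport]
  · simp [h]

theorem mem_range_coordInclusion {S : Finset n} {y : 𝔸(n; SpecC)} :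
    y ∈ Set.range (coordInclusion S) ↔ coordSupport y ⊆ S := by
  constructor
  · rintro ⟨x, rfl⟩ i hi
    exact (mem_coordSupport_coordInclusion.mp hi).1
  · intro h
    -- Projecting the residue field point to the coordinates in `S` and including it again does not
    -- move it, since its other coordinates vanish.
    let k := (𝔸(n; SpecC)).fromSpecResidueField y
    have e : k ≫ AffineSpace.reindex (Subtype.val : S → n) SpecC ≫ coordInclusion S = k := by
      refine AffineSpace.hom_ext ?_ fun i => ?_
      · rw [Category.assoc, Category.assoc, coordInclusion_over, AffineSpace.reindex_over]
      · rw [appTop_comp_apply, appTop_comp_apply, coordInclusion,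
          AffineSpace.homOfVector_appTop_coord]
        by_cases hi : i ∈ S
        · rw [dif_pos hi, AffineSpace.reindex_appTop_coord]
        · rw [dif_neg hi, map_zero, map_zero]
          have h0 : y ∉ (𝔸(n; SpecC)).basicOpen (AffineSpace.coord SpecC i) := fun hy =>
            hi (h (mem_coordSupport.mpr hy))
          symm
          -- The spectrum of a field is reduced, so a function on it is zero as soon as its
          -- non-vanishing locus is empty.
          rw [← basicOpen_eq_bot_iff, eq_bot_iff]
          intro w hw
          rw [mem_basicOpen_appTop_iff, Scheme.fromSpecResidueField_apply] at hw
          exact absurd hw h0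
    obtain ⟨w, hw⟩ : y ∈ Set.range k := by
      rw [Scheme.range_fromSpecResidueField]; rfl
    rw [← Category.assoc] at e
    refine ⟨(k ≫ AffineSpace.reindex (Subtype.val : S → n) SpecC) w, ?_⟩
    rw [← Scheme.Hom.comp_apply, e, hw]

/-- The class of an open union of coordinate strata. -/
theorem cls_coordOpens_eq_sum_torus (𝒰 : Finset (Finset n))
    (h : ∀ S ∈ 𝒰, ∀ T, S ⊆ T → T ∈ 𝒰) :
    K0.cls ((Variety.affine n).ofOpens (coordOpens 𝒰)) = ∑ S ∈ 𝒰, K0.cls (torus S) := by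
  classical
  induction h𝒰 : 𝒰.card generalizing 𝒰 with
  | zero =>
    rw [Finset.card_eq_zero] at h𝒰
    subst h𝒰
    rw [Finset.sum_empty]
    have : coordOpens (∅ : Finset (Finset n)) = ⊥ := by simp [coordOpens]
    rw [this]
    exact K0.cls_ofOpens_bot (Variety.affine n)
  | succ k ih =>
    -- For a minimal `S`, the points of the open set in the coordinate subspace of `S` have support
    -- exactly `S`. So the closed piece is a torus, and what remains is again given by an upper set.
    obtain ⟨S, hS⟩ := 𝒰.exists_minimal (Finset.card_pos.mp (by omega))
    have hmin : ∀ T ∈ 𝒰, T ⊆ S → T = S := fun T hT hTS =>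
      Finset.Subset.antisymm hTS (hS.2 hT hTS)
    have h' : ∀ T ∈ 𝒰.erase S, ∀ T', T ⊆ T' → T' ∈ 𝒰.erase S := fun T hT T' hTT' =>
      Finset.mem_erase.mpr ⟨fun he => (Finset.mem_erase.mp hT).1
        (hmin T (Finset.mem_erase.mp hT).2 (he ▸ hTT')), h T (Finset.mem_erase.mp hT).2 T' hTT'⟩
    have hle : coordOpens (𝒰.erase S) ≤ coordOpens 𝒰 := fun x hx =>
      (mem_coordOpens_of_upper h).mpr
        (Finset.mem_erase.mp ((mem_coordOpens_of_upper h').mp hx)).2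
    have hpre : coordInclusion S ⁻¹ᵁ coordOpens 𝒰 = coordOpen (Finset.univ : Finset S) := by
      ext x
      have hsub : coordSupport (coordInclusion S x) ⊆ S :=
        mem_range_coordInclusion.mp ⟨x, rfl⟩
      refine (mem_coordOpens_of_upper h).trans (Iff.trans ?_ mem_coordOpen.symm)
      constructor
      · intro hx i _
        have hi : (i : n) ∈ coordSupport (coordInclusion S x) := by
          rw [hmin _ hx hsub]; exact i.2
        exact (mem_coordSupport_coordInclusion.mp hi).2
      · intro hx
        have : coordSupport (coordInclusion S x) = S := Finset.Subset.antisymm hsub fun i hi =>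
          mem_coordSupport_coordInclusion.mpr ⟨hi, hx (Finset.mem_univ _)⟩
        rw [this]; exact hS.1
    have hcut := K0.cls_ofOpens_cut (X := Variety.affine n) (Y := Variety.affine S)
      (coordInclusion S) (coordInclusion_over S) (isClosedImmersion_coordInclusion S) hle
      (fun x hx => by
        refine (mem_coordOpens_of_upper h').trans ?_
        rw [Finset.mem_erase]
        have hx := (mem_coordOpens_of_upper h).mp hx
        refine Iff.trans ?_ (not_congr (mem_range_coordInclusion (y := x))).symm
        exact ⟨fun h1 h2 => h1.1 (hmin _ h1.2 h2), fun h1 => ⟨fun h2 => h1 h2.subset, hx⟩⟩)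
    have hY : K0.cls ((Variety.affine S).ofOpens (coordInclusion S ⁻¹ᵁ coordOpens 𝒰)) =
        K0.cls (torus S) := by
      rw [torus_eq]
      exact congrArg (fun U => K0.cls ((Variety.affine S).ofOpens U)) hpre
    refine hcut.trans ((congrArg₂ (fun a b : K0 => a + b) hY
      (ih _ h' (by rw [Finset.card_erase_of_mem hS.1]; omega))).trans ?_)
    exact Finset.add_sum_erase 𝒰 (fun S => K0.cls (torus S)) hS.1

end Coordinates

/-- Affine space is stratified by the tori of all subsets of the coordinates. By strong induction
all smaller tori are known, and comparison with the expansion of `((𝕃 - 1) + 1)^k` determines the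
open one. -/
theorem cls_torus_aux (k : ℕ) : ∀ (n : Type) [Fintype n], Fintype.card n = k →
    K0.cls (torus n) = (K0.lefschetz - 1) ^ k := by
  classical
  induction k using Nat.strong_induction_on with
  | _ k ih =>
    intro n _ hn
    have h1 := cls_coordOpens_eq_sum_torus (n := n) {Finset.univ} (by
      simp only [Finset.mem_singleton]
      rintro S rfl T hT
      exact Finset.univ_subset_iff.mp hT)
    have h2 := cls_coordOpens_eq_sum_torus (n := n) Finset.univ (by simp)
    have e1 : coordOpens {(Finset.univ : Finset n)} = coordOpen Finset.univ := by
      simp [coordOpens]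
    have e2 : coordOpens (Finset.univ : Finset (Finset n)) = ⊤ := by
      ext x
      exact ⟨fun _ => trivial, fun _ => mem_coordOpens.mpr ⟨_, Finset.mem_univ _, subset_rfl⟩⟩
    rw [e1, ← torus_eq, Finset.sum_singleton] at h1
    rw [e2] at h2
    replace h2 := (K0.cls_ofOpens_top (Variety.affine n)).symm.trans h2
    rw [cls_affine, Nat.card_eq_fintype_card, hn,
      ← Finset.add_sum_erase _ _ (Finset.mem_univ (Finset.univ : Finset n)), ← h1] at h2
    have h3 : ∀ S ∈ (Finset.univ : Finset (Finset n)).erase Finset.univ,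
        K0.cls (torus S) = (K0.lefschetz - 1) ^ S.card := fun S hS =>
      ih S.card (by
        rw [← hn]; exact (Finset.card_lt_iff_ne_univ S).mpr (Finset.mem_erase.mp hS).1)
        S (Fintype.card_coe S)
    rw [Finset.sum_congr rfl h3] at h2
    have h4 : ∑ S : Finset n, (K0.lefschetz - 1) ^ S.card = K0.lefschetz ^ k := by
      have := Finset.sum_pow_mul_eq_add_pow (K0.lefschetz - 1) 1 (Finset.univ : Finset n)
      simpa [hn] using this
    rw [← Finset.add_sum_erase _ _ (Finset.mem_univ (Finset.univ : Finset n)),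
      Finset.card_univ, hn] at h4
    rw [← h4] at h2
    exact (add_right_cancel h2).symm

theorem cls_torus (n : Type) [Finite n] :
    K0.cls (torus n) = (K0.lefschetz - 1) ^ Nat.card n := by
  have := Fintype.ofFinite n
  exact cls_torus_aux _ n (Nat.card_eq_fintype_card).symm

theorem cls_coordOpens {n : Type} [Fintype n] (𝒰 : Finset (Finset n))
    (h : ∀ S ∈ 𝒰, ∀ T, S ⊆ T → T ∈ 𝒰) :
    K0.cls ((Variety.affine n).ofOpens (coordOpens 𝒰)) =
      ∑ S ∈ 𝒰, (K0.lefschetz - 1) ^ S.card := by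
  rw [cls_coordOpens_eq_sum_torus 𝒰 h]
  refine Finset.sum_congr rfl fun S _ => ?_
  rw [cls_torus, Nat.card_eq_fintype_card, Fintype.card_coe]

end

end AbelianQuiver

namespace AbelianQuiver

noncomputable section

/-! ### The semistable locus -/

section Semistable

variable {V : Type} [Quiver.{0} V] [Fintype V] [∀ i j : V, Finite (i ⟶ j)]

open Classical in
/-- The supports of semistable abelian representations. -/
def semistableSupports [Fintype (Arrows V)] (Z : Stability V) : Finset (Finset (Arrows V)) :=
  {S | AllClosed (fun a : Arrows V => a.1) (fun a => a.2.1)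
    (fun I => Z.slopeSet I ≤ Z.slopeSet Finset.univ) Finset.univ S}

theorem mem_semistableSupports [Fintype (Arrows V)] {Z : Stability V} {S : Finset (Arrows V)} :
    S ∈ semistableSupports Z ↔ ∀ I : Finset V, I.Nonempty →
      ClosedUnder (fun a : Arrows V => a.1) (fun a => a.2.1) S I →
        Z.slopeSet I ≤ Z.slopeSet Finset.univ := by
  classical
  refine Finset.mem_filter.trans ?_
  simp [AllClosed]

/-- More non-zero arrows means fewer subrepresentations to test. -/
theorem semistableSupports_upper [Fintype (Arrows V)] (Z : Stability V) :
    ∀ S ∈ semistableSupports Z, ∀ T, S ⊆ T → T ∈ semistableSupports Z := by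
  intro S hS T hST
  rw [mem_semistableSupports] at hS ⊢
  exact fun I hI hc => hS I hI fun a ha => hc a (hST ha)

theorem Stability.slopeSet_eq_indicator (Z : Stability V) (I : Finset V) :
    Z.slopeSet I = Z.slope (Finsupp.equivFunOnFinite.symm ((I : Set V).indicator 1)) := by
  classical
  rw [Stability.slopeSet]
  congr 1
  ext i
  simp [Finsupp.finsetSum_apply, Finsupp.single_apply, Set.indicator_apply]

theorem mem_semistableOpens {Z : Stability V} [Fintype (Arrows V)] {x : (repSpace V).X} :
    x ∈ semistableOpens Z ↔ coordSupport (n := Arrows V) x ∈ semistableSupports Z := by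
  classical
  have hx : ∀ {i j : V} (a : i ⟶ j), (repSpace V).X.Γevaluation x (coordinate a) ≠ 0 ↔
      (⟨i, j, a⟩ : Arrows V) ∈ coordSupport (n := Arrows V) x := fun a =>
    (mem_basicOpen_iff (X := (repSpace V).X) _ x).symm.trans mem_coordSupport.symm
  change (repAt x).IsSemistable Z ↔ _
  rw [repAt, isSemistable_abelian_iff, mem_semistableSupports]
  have huniv : Z.slope (Finsupp.equivFunOnFinite.symm 1) = Z.slopeSet Finset.univ := by
    rw [Z.slopeSet_eq_indicator, Finset.coe_univ, Set.indicator_univ]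
  rw [huniv]
  constructor
  · intro h I hI hc
    by_cases hI' : I = Finset.univ
    · rw [hI']
    rw [Z.slopeSet_eq_indicator]
    refine h I (fun i j a hi ha => ?_) hI (fun h => hI' (Finset.coe_eq_univ.mp h))
    exact hc ⟨i, j, a⟩ ((hx a).mp ha) hi
  · intro h I hc hI _
    have := h I.toFinset (by simpa using hI) (fun a ha hi => by
      simp only [Set.mem_toFinset] at hi ⊢
      exact hc _ _ a.2.2 hi ((hx a.2.2).mpr ha))
    rwa [Z.slopeSet_eq_indicator, Set.coe_toFinset] at this

theorem semistableOpens_eq [Fintype (Arrows V)] (Z : Stability V) :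
    semistableOpens Z = coordOpens (n := Arrows V) (semistableSupports Z) := by
  ext x
  exact mem_semistableOpens.trans
    (mem_coordOpens_of_upper (n := Arrows V) (semistableSupports_upper Z)).symm

theorem cls_semistableLocus [Fintype (Arrows V)] (Z : Stability V) :
    K0.cls (semistableLocus Z) = ∑ S ∈ semistableSupports Z, (K0.lefschetz - 1) ^ S.card :=
  (congrArg (fun U => K0.cls ((Variety.affine (Arrows V)).ofOpens U))
    (semistableOpens_eq Z)).trans (cls_coordOpens _ (semistableSupports_upper Z))

end Semistable

/-! ### Dimensions -/

theorem topologicalKrullDim_le_of_isOpenImmersion {X Y : Scheme.{0}} (f : X ⟶ Y)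
    [IsOpenImmersion f] : topologicalKrullDim X ≤ topologicalKrullDim Y :=
  f.isOpenEmbedding.isInducing.topologicalKrullDim_le

/-- Affine space as the spectrum of a polynomial ring. -/
def affineSpaceIso (n : Type) : 𝔸(n; SpecC) ≅ Spec (CommRingCat.of (MvPolynomial n ℂ)) :=
  AffineSpace.SpecIso n (CommRingCat.of ℂ)

theorem topologicalKrullDim_affineSpace (n : Type) [Finite n] :
    topologicalKrullDim 𝔸(n; SpecC) = Nat.card n := by
  have h : topologicalKrullDim 𝔸(n; SpecC) = topologicalKrullDim
      (Spec (CommRingCat.of (MvPolynomial n ℂ))) :=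
    le_antisymm (topologicalKrullDim_le_of_isOpenImmersion (affineSpaceIso n).hom)
      (topologicalKrullDim_le_of_isOpenImmersion (affineSpaceIso n).inv)
  rw [h]
  refine (PrimeSpectrum.topologicalKrullDim_eq_ringKrullDim (R := MvPolynomial n ℂ)).trans ?_
  rw [MvPolynomial.ringKrullDim_of_isNoetherianRing, ringKrullDim_eq_zero_of_field, zero_add]

/-- The ring of Laurent polynomials in a finite set of variables. -/
abbrev LaurentRing (n : Type) [Fintype n] : Type :=
  Localization.Away (∏ i : n, (MvPolynomial.X i : MvPolynomial n ℂ))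

/-- Setting the first `j` variables to `1` gives an increasing chain of prime kernels. The value `1`
instead of `0` keeps these primes away from the product of the variables, so they survive in the
localization. -/
theorem card_le_ringKrullDim_laurentRing (n : Type) [Fintype n] :
    (Fintype.card n : WithBot ℕ∞) ≤ ringKrullDim (LaurentRing n) := by
  classical
  let e := Fintype.equivFin n
  let φ : ℕ → MvPolynomial n ℂ →ₐ[ℂ] MvPolynomial n ℂ := fun j =>
    MvPolynomial.aeval fun i => if (e i : ℕ) < j then 1 else MvPolynomial.X i
  let p : ℕ → Ideal (MvPolynomial n ℂ) := fun j => RingHom.ker (φ j)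
  have hp : ∀ j, (p j).IsPrime := fun j => RingHom.ker_isPrime _
  have hd : ∀ j, Disjoint (Submonoid.powers (∏ i : n, (MvPolynomial.X i : MvPolynomial n ℂ)) :
      Set (MvPolynomial n ℂ)) (p j) := by
    intro j
    rw [Ideal.disjoint_powers_iff_notMem _ (hp j).isRadical]
    intro h
    have h' : φ j (∏ i : n, MvPolynomial.X i) = 0 := h
    rw [map_prod, Finset.prod_eq_zero_iff] at h'
    obtain ⟨i, -, hi⟩ := h'
    rw [MvPolynomial.aeval_X] at hi
    split_ifs at hi
    · exact one_ne_zero hi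
    · exact MvPolynomial.X_ne_zero i hi
  -- Specializing `j + 1` variables may be done after specializing `j` of them; hence the kernels
  -- increase.
  have hcomp : ∀ j x, φ (j + 1) x = φ (j + 1) (φ j x) := by
    intro j x
    rw [← AlgHom.comp_apply]
    congr 1
    ext1 i
    simp only [φ, MvPolynomial.aeval_X, AlgHom.comp_apply]
    by_cases h : (e i : ℕ) < j
    · simp [h, Nat.lt_succ_of_lt h]
    · simp [h]
  have hlt : ∀ j : Fin (Fintype.card n), p j < p (j + 1) := by
    intro j
    refine lt_of_le_of_ne (fun x hx => ?_) fun h => ?_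
    · have hx : φ j x = 0 := hx
      change φ (j + 1) x = 0
      rw [hcomp, hx, map_zero]
    -- This element witnesses strictness: `φ j` leaves it unchanged, and it takes the value `-1` at
    -- the origin.
    · have h1 : (MvPolynomial.X (e.symm j) - 1 : MvPolynomial n ℂ) ∈ p (j + 1) := by
        change φ (j + 1) _ = 0
        simp [φ]
      rw [← h] at h1
      replace h1 : φ j _ = 0 := h1
      simp only [φ, map_sub, MvPolynomial.aeval_X, map_one, Equiv.apply_symm_apply, lt_irrefl,
        if_false] at h1
      have h2 := congrArg (MvPolynomial.eval fun _ => (0 : ℂ)) h1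
      simp at h2
  let o := IsLocalization.orderIsoOfPrime
    (Submonoid.powers (∏ i : n, (MvPolynomial.X i : MvPolynomial n ℂ))) (LaurentRing n)
  let P : ℕ → PrimeSpectrum (LaurentRing n) := fun j =>
    ⟨(o.symm ⟨p j, hp j, hd j⟩).1, (o.symm ⟨p j, hp j, hd j⟩).2⟩
  refine Order.le_krullDim_iff.mpr ⟨⟨Fintype.card n, fun j => P j, fun j => ?_⟩, rfl⟩
  exact o.symm.lt_iff_lt.mpr (hlt j)

/-- The inclusion of the torus into affine space. -/
def laurentInclusion (n : Type) [Fintype n] :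
    Spec (CommRingCat.of (LaurentRing n)) ⟶ 𝔸(n; SpecC) :=
  Spec.map (CommRingCat.ofHom (algebraMap (MvPolynomial n ℂ) (LaurentRing n))) ≫
    (affineSpaceIso n).inv

instance (n : Type) [Fintype n] : IsOpenImmersion (laurentInclusion n) := by
  have := AlgebraicGeometry.IsOpenImmersion.of_isLocalization (S := LaurentRing n)
    (∏ i : n, (MvPolynomial.X i : MvPolynomial n ℂ))
  unfold laurentInclusion
  infer_instance

theorem laurentInclusion_mem (n : Type) [Fintype n] (x : Spec (CommRingCat.of (LaurentRing n))) :
    laurentInclusion n x ∈ coordOpen (Finset.univ : Finset n) := by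
  rw [coordOpen, ← mem_basicOpen_appTop_iff]
  have h : (laurentInclusion n).appTop (∏ i : n, AffineSpace.coord SpecC i) =
      (Scheme.ΓSpecIso (CommRingCat.of (LaurentRing n))).inv
        (algebraMap (MvPolynomial n ℂ) (LaurentRing n) (∏ i : n, MvPolynomial.X i)) := by
    rw [map_prod, map_prod, map_prod]
    refine Finset.prod_congr rfl fun i _ => ?_
    rw [laurentInclusion, appTop_comp_apply, affineSpaceIso]
    erw [AffineSpace.SpecIso_inv_appTop_coord]
    rw [← CommRingCat.comp_apply, ← Scheme.ΓSpecIso_inv_naturality]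
    rfl
  rw [h]
  have hu : IsUnit ((Scheme.ΓSpecIso (CommRingCat.of (LaurentRing n))).inv
      (algebraMap (MvPolynomial n ℂ) (LaurentRing n) (∏ i : n, MvPolynomial.X i))) :=
    (IsLocalization.Away.algebraMap_isUnit _).map (Scheme.ΓSpecIso _).inv.hom
  rw [Scheme.basicOpen_of_isUnit _ hu]
  trivial

/-- The dimension of an open subset of affine space that contains the torus. -/
theorem topologicalKrullDim_opens {n : Type} [Fintype n] {U : (𝔸(n; SpecC)).Opens}
    (hU : coordOpen Finset.univ ≤ U) : topologicalKrullDim U = Fintype.card n := by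
  refine le_antisymm ?_ ?_
  · refine (topologicalKrullDim_le_of_isOpenImmersion U.ι).trans ?_
    rw [topologicalKrullDim_affineSpace, Nat.card_eq_fintype_card]
  · refine (card_le_ringKrullDim_laurentRing n).trans ?_
    rw [← PrimeSpectrum.topologicalKrullDim_eq_ringKrullDim]
    have hr : Set.range (laurentInclusion n) ⊆ Set.range U.ι := by
      rintro _ ⟨x, rfl⟩
      rw [Scheme.Opens.range_ι]
      exact hU (laurentInclusion_mem n x)
    have : IsOpenImmersion (IsOpenImmersion.lift U.ι (laurentInclusion n) hr) := by
      have h : IsOpenImmersion (IsOpenImmersion.lift U.ι (laurentInclusion n) hr ≫ U.ι) := by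
        rw [IsOpenImmersion.lift_fac]; infer_instance
      exact IsOpenImmersion.of_comp _ U.ι
    exact topologicalKrullDim_le_of_isOpenImmersion
      (IsOpenImmersion.lift U.ι (laurentInclusion n) hr)

theorem dimension_ofOpens_affine {n : Type} [Fintype n] {U : (𝔸(n; SpecC)).Opens}
    (hU : coordOpen Finset.univ ≤ U) :
    dimension ((Variety.affine n).ofOpens U) = Fintype.card n := by
  have h : topologicalKrullDim ((Variety.affine n).ofOpens U).X = Fintype.card n :=
    topologicalKrullDim_opens hU
  rw [dimension, h]
  rfl

theorem dimension_torus (n : Type) [Fintype n] : dimension (torus n) = Fintype.card n := by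
  rw [torus_eq]
  exact dimension_ofOpens_affine le_rfl

/-- A semistable support enlarges to the full one, so the locus contains the open torus.
Non-emptiness matters, since the empty variety is assigned dimension `0`. -/
theorem dimension_semistableLocus {V : Type} [Quiver.{0} V] [Fintype V]
    [∀ i j : V, Finite (i ⟶ j)] [Fintype (Arrows V)] {Z : Stability V}
    (h : (semistableSupports Z).Nonempty) :
    dimension (semistableLocus Z) = Fintype.card (Arrows V) := by
  obtain ⟨S, hS⟩ := h
  refine dimension_ofOpens_affine (n := Arrows V) ?_
  rw [semistableOpens_eq]
  intro x hx
  exact mem_coordOpens.mpr ⟨S, hS, (Finset.subset_univ S).trans (mem_coordOpen.mp hx)⟩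

end

end AbelianQuiver

namespace AbelianQuiver

noncomputable section

/-! ### Motivic invariants of stacks of representations -/

theorem qh_ne_zero : qh ≠ 0 := RatFunc.X_ne_zero

theorem qh_sq_sub_one_ne_zero : qh ^ 2 - 1 ≠ 0 := by
  have h : algebraMap ℚ[X] (RatFunc ℚ) (Polynomial.X ^ 2 - Polynomial.C 1) ≠ 0 := by
    rw [Ne, FaithfulSMul.algebraMap_eq_zero_iff]
    exact Polynomial.X_pow_sub_C_ne_zero two_pos _
  rw [map_sub, map_pow, RatFunc.algebraMap_X, Polynomial.C_1, map_one] at h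
  exact h

theorem gam_eq : gam = qh⁻¹ * (qh ^ 2 - 1) := by
  have := qh_ne_zero
  rw [gam]
  field_simp

theorem gam_ne_zero : gam ≠ 0 := by
  rw [gam_eq]
  exact mul_ne_zero (inv_ne_zero qh_ne_zero) qh_sq_sub_one_ne_zero

/-- The homomorphism `K₀(Var) → 𝒱`. -/
def K0.toMot : K0 →+* Mot := (Algebra.TensorProduct.includeRight : K0 →ₐ[ℤ[X]] Mot).toRingHom

/-- The tensor product over `ℤ[𝕃]` identifies the two images of the variable. -/
theorem toMot_lefschetz : K0.toMot K0.lefschetz = algebraMap HalfField Mot (qh ^ 2) := by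
  have h1 : K0.lefschetz = algebraMap ℤ[X] K0 Polynomial.X :=
    (Polynomial.eval₂_X (Int.castRingHom K0) K0.lefschetz).symm
  have h2 : qh ^ 2 = algebraMap ℤ[X] HalfField Polynomial.X :=
    (Polynomial.eval₂_X (Int.castRingHom HalfField) (qh ^ 2)).symm
  rw [h1, h2, ← IsScalarTower.algebraMap_apply]
  exact (Algebra.TensorProduct.includeRight : K0 →ₐ[ℤ[X]] Mot).commutes Polynomial.X

theorem toMot_lefschetz_sub_one_pow (k : ℕ) :
    K0.toMot ((K0.lefschetz - 1) ^ k) = algebraMap HalfField Mot ((qh ^ 2 - 1) ^ k) := by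
  simp only [map_pow, map_sub, map_one, toMot_lefschetz]

theorem virtualMotive_eq (X : Variety) :
    virtualMotive X = algebraMap HalfField Mot ((qh⁻¹) ^ dimension X) * K0.toMot (K0.cls X) :=
  Algebra.smul_def _ _

theorem virtualMotive_torus (n : Type) [Fintype n] :
    virtualMotive (torus n) = algebraMap HalfField Mot (gam ^ Fintype.card n) := by
  rw [virtualMotive_eq, dimension_torus, cls_torus, toMot_lefschetz_sub_one_pow, ← map_mul,
    Nat.card_eq_fintype_card, gam_eq, mul_pow]

theorem isUnit_algebraMap {x : HalfField} (hx : x ≠ 0) : IsUnit (algebraMap HalfField Mot x) :=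
  (isUnit_iff_ne_zero.mpr hx).map _

theorem isUnit_virtualMotive_torus (n : Type) [Finite n] : IsUnit (virtualMotive (torus n)) := by
  have := Fintype.ofFinite n
  rw [virtualMotive_torus]
  exact isUnit_algebraMap (pow_ne_zero _ gam_ne_zero)

theorem inverse_algebraMap {x : HalfField} (hx : x ≠ 0) :
    Ring.inverse (algebraMap HalfField Mot x) = algebraMap HalfField Mot x⁻¹ := by
  have h := isUnit_algebraMap hx
  rw [← mul_one (Ring.inverse _), ← map_one (algebraMap HalfField Mot), ← mul_inv_cancel₀ hx,
    map_mul, ← mul_assoc, Ring.inverse_mul_cancel _ h, one_mul]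

/-- This reduces motives to combinatorics: the torus accounts for `gam⁻¹` per vertex, the virtual
normalization for `qh⁻¹` per arrow, and each non-zero arrow for `𝕃 - 1`. -/
theorem stackMotive_eq {V : Type} [Quiver.{0} V] [Fintype V] [∀ i j : V, Finite (i ⟶ j)]
    [DecidableEq V] [Fintype (Arrows V)] [DecidableEq (Arrows V)] (Z : Stability V) :
    stackMotive Z = algebraMap HalfField Mot
      (weightedCount (fun a : Arrows V => a.1) (fun a => a.2.1) gam⁻¹ qh⁻¹ (qh ^ 2 - 1)
        (fun I => Z.slopeSet I ≤ Z.slopeSet Finset.univ) Finset.univ) := by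
  have harr : arrowsBetween (fun a : Arrows V => a.1) (fun a => a.2.1) Finset.univ Finset.univ =
      Finset.univ := by
    ext; simp [mem_arrowsBetween]
  have hcount : supportCount (fun a : Arrows V => a.1) (fun a => a.2.1) (qh ^ 2 - 1)
      (fun I => Z.slopeSet I ≤ Z.slopeSet Finset.univ) Finset.univ =
      ∑ S ∈ semistableSupports Z, (qh ^ 2 - 1) ^ S.card := by
    rw [supportCount, harr, Finset.powerset_univ]
    rfl
  rw [weightedCount, harr, hcount, stackMotive, virtualMotive_torus,
    inverse_algebraMap (pow_ne_zero _ gam_ne_zero), virtualMotive_eq, cls_semistableLocus,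
    map_sum, Finset.sum_congr rfl fun S _ => toMot_lefschetz_sub_one_pow S.card, ← map_sum,
    ← map_mul, ← map_mul]
  congr 1
  -- For an empty locus the dimension has its default value, which is harmless because the class is
  -- zero.
  rcases (semistableSupports Z).eq_empty_or_nonempty with h | h
  · simp [h]
  · rw [dimension_semistableLocus h, inv_pow gam, Finset.card_univ, Finset.card_univ]
    ring

theorem algebraMap_injective [Nontrivial Mot] : Function.Injective (algebraMap HalfField Mot) :=
  (algebraMap HalfField Mot).injective

end

end AbelianQuiver

namespace AbelianQuiver

noncomputable section

/-! ### Quotients with local sections -/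

/-- An equivalence relation on the `T`-valued points of a scheme, functorial in `T`. -/
structure PointRel (X : Scheme.{0}) where
  /-- the relation -/
  rel : ∀ {T : Scheme.{0}}, (T ⟶ X) → (T ⟶ X) → Prop
  refl : ∀ {T : Scheme.{0}} (x : T ⟶ X), rel x x
  symm : ∀ {T : Scheme.{0}} {x x' : T ⟶ X}, rel x x' → rel x' x
  trans : ∀ {T : Scheme.{0}} {x x' x'' : T ⟶ X}, rel x x' → rel x' x'' → rel x x''
  comp : ∀ {T T' : Scheme.{0}} (f : T' ⟶ T) {x x' : T ⟶ X}, rel x x' → rel (f ≫ x) (f ≫ x')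

/-- The relation induced by a morphism. -/
def PointRel.comap {X X' : Scheme.{0}} (r : PointRel X) (i : X' ⟶ X) : PointRel X' where
  rel x x' := r.rel (x ≫ i) (x' ≫ i)
  refl x := r.refl _
  symm := r.symm
  trans := r.trans
  comp f x x' h := by
    rw [Category.assoc, Category.assoc]
    exact r.comp f h

/-- A morphism is invariant under a relation. -/
def PointRel.Invariant {X W : Scheme.{0}} (r : PointRel X) (h : X ⟶ W) : Prop :=
  ∀ ⦃T : Scheme.{0}⦄ ⦃x x' : T ⟶ X⦄, r.rel x x' → x ≫ h = x' ≫ h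

/-- A set of points is invariant under a relation. -/
def PointRel.InvariantSet {X : Scheme.{0}} (r : PointRel X) (C : Set X) : Prop :=
  ∀ ⦃T : Scheme.{0}⦄ ⦃x x' : T ⟶ X⦄, r.rel x x' → ∀ t : T, x t ∈ C ↔ x' t ∈ C

/-- An invariant morphism that has local sections, and whose fibres are equivalence classes. -/
structure IsLocalQuotient {X Y : Scheme.{0}} (r : PointRel X) (p : X ⟶ Y) : Prop where
  invariant : r.Invariant p
  exists_section : ∀ y : Y, ∃ (W : Scheme.{0}) (j : W ⟶ Y) (σ : W ⟶ X), IsOpenImmersion j ∧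
    y ∈ Set.range j ∧ σ ≫ p = j ∧
    ∀ ⦃T : Scheme.{0}⦄ (x : T ⟶ X) (v : T ⟶ W), x ≫ p = v ≫ j → r.rel (v ≫ σ) x

section

variable {X Y : Scheme.{0}} {r : PointRel X} {p : X ⟶ Y}

theorem IsLocalQuotient.surjective (hp : IsLocalQuotient r p) : Function.Surjective p := by
  intro y
  obtain ⟨W, j, σ, _, ⟨w, rfl⟩, h, -⟩ := hp.exists_section y
  exact ⟨σ w, by rw [← Scheme.Hom.comp_apply, h]⟩

/-- An invariant morphism factors uniquely through the quotient. -/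
theorem IsLocalQuotient.existsUnique_factor (hp : IsLocalQuotient r p) {W : Scheme.{0}}
    (h : X ⟶ W) (hh : r.Invariant h) : ∃! k : Y ⟶ W, p ≫ k = h := by
  choose U j σ hj hy hσ hrel using hp.exists_section
  let 𝒰 : Y.OpenCover := {
    I₀ := Y, X := U, f := j
    mem₀ := by
      rw [Scheme.presieve₀_mem_precoverage_iff]
      exact ⟨fun x => ⟨x, hy x⟩, hj⟩ }
  -- On an overlap the two local sections are related, so an invariant morphism takes the same value
  -- on both.
  have hglue : ∀ y y' : 𝒰.I₀, pullback.fst (𝒰.f y) (𝒰.f y') ≫ σ y ≫ h =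
      pullback.snd (𝒰.f y) (𝒰.f y') ≫ σ y' ≫ h := by
    intro y y'
    rw [← Category.assoc, ← Category.assoc]
    refine hh (hrel y _ _ ?_)
    rw [Category.assoc, hσ]
    exact pullback.condition.symm
  refine ⟨𝒰.glueMorphisms (fun y => σ y ≫ h) hglue, ?_, ?_⟩
  · refine Scheme.Cover.hom_ext (𝒰.pullback₁ p) _ _ fun y => ?_
    change pullback.fst p (j y) ≫ p ≫ _ = pullback.fst p (j y) ≫ h
    rw [pullback.condition_assoc]
    have h1 := 𝒰.ι_glueMorphisms (fun y => σ y ≫ h) hglue y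
    refine (congrArg (fun f => pullback.snd p (j y) ≫ f) h1).trans ?_
    rw [← Category.assoc]
    exact hh (hrel y _ _ pullback.condition)
  · intro k hk
    refine 𝒰.hom_ext _ _ fun y => ?_
    have h1 := 𝒰.ι_glueMorphisms (fun y => σ y ≫ h) hglue y
    refine Eq.trans ?_ h1.symm
    change j y ≫ k = σ y ≫ h
    rw [← hσ, Category.assoc, hk]

/-- Local quotients are stable under restriction to open subschemes of the target. -/
theorem IsLocalQuotient.of_isPullback (hp : IsLocalQuotient r p) {X' Y' : Scheme.{0}}
    {i' : X' ⟶ X} {p' : X' ⟶ Y'} {i : Y' ⟶ Y} (h : IsPullback i' p' p i) [IsOpenImmersion i] :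
    IsLocalQuotient (r.comap i') p' where
  invariant T x x' hx := by
    rw [← cancel_mono i, Category.assoc, Category.assoc, ← h.w, ← Category.assoc, ← Category.assoc]
    exact hp.invariant hx
  exists_section y := by
    obtain ⟨W, j, σ, hj, ⟨w, hw⟩, hσ, hrel⟩ := hp.exists_section (i y)
    refine ⟨pullback j i, pullback.snd j i, h.lift (pullback.fst j i ≫ σ) (pullback.snd j i)
      (by rw [Category.assoc, hσ, pullback.condition]), inferInstance, ?_, h.lift_snd _ _ _, ?_⟩
    · obtain ⟨z, -, hz⟩ := Scheme.Pullback.exists_preimage_pullback w y hw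
      exact ⟨z, hz⟩
    · intro T x v hx
      change r.rel ((v ≫ h.lift _ _ _) ≫ i') (x ≫ i')
      rw [Category.assoc, h.lift_fst, ← Category.assoc]
      refine hrel _ _ ?_
      rw [Category.assoc, h.w, ← Category.assoc, hx, Category.assoc, Category.assoc,
        pullback.condition]

/-- Both `x` and `w` are images of one point of the fibre product of `p` and `j`. Its two
projections give related scheme-valued points, to which invariance of `C` applies. -/
theorem PointRel.InvariantSet.section_mem_iff {C : Set X}
    (hC : r.InvariantSet C) {W : Scheme.{0}} {j : W ⟶ Y} {σ : W ⟶ X}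
    (hrel : ∀ ⦃T : Scheme.{0}⦄ (x : T ⟶ X) (v : T ⟶ W), x ≫ p = v ≫ j → r.rel (v ≫ σ) x)
    {x : X} {w : W} (hx : p x = j w) : σ w ∈ C ↔ x ∈ C := by
  obtain ⟨z, hz1, hz2⟩ := Scheme.Pullback.exists_preimage_pullback x w hx
  have := hC (hrel (pullback.fst p j) (pullback.snd p j) pullback.condition) z
  rwa [Scheme.Hom.comp_apply, hz1, hz2] at this

/-- Over a chart with section `σ`, the complement of the image is the preimage of the complement of
`C` under `σ`, which is open. -/
theorem IsLocalQuotient.isClosed_image (hp : IsLocalQuotient r p) {C : Set X} (hC : IsClosed C)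
    (hinv : r.InvariantSet C) : IsClosed (p '' C) := by
  rw [← isOpen_compl_iff, isOpen_iff_forall_mem_open]
  intro y hy
  obtain ⟨W, j, σ, hj, ⟨w, rfl⟩, hσ, hrel⟩ := hp.exists_section y
  refine ⟨j '' (σ ⁻¹' Cᶜ), ?_, j.isOpenEmbedding.isOpenMap _
    (hC.isOpen_compl.preimage σ.continuous), w, ?_, rfl⟩
  · rintro _ ⟨w', hw', rfl⟩ ⟨x, hx, hxw⟩
    exact hw' ((hinv.section_mem_iff hrel hxw).mpr hx)
  · intro hw
    exact hy ⟨σ w, hw, by rw [← Scheme.Hom.comp_apply, hσ]⟩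

theorem IsLocalQuotient.disjoint_image (hp : IsLocalQuotient r p) {C D : Set X}
    (hC : r.InvariantSet C) (hD : r.InvariantSet D) (h : Disjoint C D) :
    Disjoint (p '' C) (p '' D) := by
  rw [Set.disjoint_left]
  rintro _ ⟨x, hx, rfl⟩ ⟨x', hx', he⟩
  obtain ⟨W, j, σ, hj, ⟨w, hw⟩, hσ, hrel⟩ := hp.exists_section (p x)
  exact Set.disjoint_left.mp h ((hC.section_mem_iff hrel hw.symm).mpr hx)
    ((hD.section_mem_iff hrel (he.trans hw.symm)).mpr hx')

/-- Functions are morphisms to the affine line. -/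
def lineHom {X : Scheme.{0}} (f : X ⟶ SpecC) (s : Γ(X, ⊤)) : X ⟶ 𝔸(Unit; SpecC) :=
  AffineSpace.homOfVector f fun _ => s

theorem comp_lineHom {X Y : Scheme.{0}} (g : X ⟶ Y) (f : Y ⟶ SpecC) (s : Γ(Y, ⊤)) :
    g ≫ lineHom f s = lineHom (g ≫ f) (g.appTop s) :=
  AffineSpace.comp_homOfVector _ _ _

theorem lineHom_injective {X : Scheme.{0}} {f : X ⟶ SpecC} {s s' : Γ(X, ⊤)}
    (h : lineHom f s = lineHom f s') : s = s' := by
  have := congrArg (fun g : X ⟶ 𝔸(Unit; SpecC) => g.appTop (AffineSpace.coord SpecC ())) h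
  simpa only [lineHom, AffineSpace.homOfVector_appTop_coord] using this

/-- Functions are morphisms to the affine line, so this is the uniqueness of factorizations through
the quotient; `IsLocalQuotient.mem_range_appTop` is their existence. -/
theorem IsLocalQuotient.appTop_injective (hp : IsLocalQuotient r p) (f : Y ⟶ SpecC) :
    Function.Injective p.appTop := by
  intro s s' h
  have hinv : r.Invariant (p ≫ lineHom f s) := fun T x x' hx => by
    rw [← Category.assoc, ← Category.assoc, hp.invariant hx]
  refine lineHom_injective (f := f) ((hp.existsUnique_factor _ hinv).unique rfl ?_)
  rw [comp_lineHom, comp_lineHom, h]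

theorem IsLocalQuotient.mem_range_appTop (hp : IsLocalQuotient r p) (f : Y ⟶ SpecC)
    (s : Γ(X, ⊤)) : s ∈ Set.range p.appTop ↔
      ∀ ⦃T : Scheme.{0}⦄ ⦃x x' : T ⟶ X⦄, r.rel x x' → x.appTop s = x'.appTop s := by
  constructor
  · rintro ⟨u, rfl⟩ T x x' hx
    rw [← appTop_comp_apply, ← appTop_comp_apply, hp.invariant hx]
  · intro h
    have hinv : r.Invariant (lineHom (p ≫ f) s) := fun T x x' hx => by
      rw [comp_lineHom, comp_lineHom, h hx, ← Category.assoc, ← Category.assoc, hp.invariant hx]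
    obtain ⟨k, hk, -⟩ := hp.existsUnique_factor _ hinv
    refine ⟨k.appTop (AffineSpace.coord SpecC ()), ?_⟩
    rw [← appTop_comp_apply, hk, lineHom, AffineSpace.homOfVector_appTop_coord]

end

end

end AbelianQuiver

namespace AbelianQuiver

noncomputable section

/-! ### Geometric invariant theory quotients from local sections -/

section Orbits

variable {V : Type} [Quiver.{0} V] [Finite V] [∀ i j : V, Finite (i ⟶ j)]

/-- The relation of lying in the same orbit of the torus. -/
def sameOrbitRel (V : Type) [Quiver.{0} V] [Finite V] [∀ i j : V, Finite (i ⟶ j)] :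
    PointRel (repSpace V).X where
  rel := SameOrbit
  refl x := ⟨rfl, fun _ => 1, fun i j a => by simp⟩
  symm := by
    rintro T x x' ⟨h, t, ht⟩
    refine ⟨h.symm, fun i => (t i)⁻¹, fun i j a => ?_⟩
    rw [ht i j a, inv_inv]
    linear_combination (-x.appTop (coordinate a)) * (t j).inv_mul -
      (x.appTop (coordinate a) * ↑(t j)⁻¹ * ↑(t j)) * (t i).inv_mul
  trans := by
    rintro T x x' x'' ⟨h, t, ht⟩ ⟨h', t', ht'⟩
    refine ⟨h.trans h', fun i => t' i * t i, fun i j a => ?_⟩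
    rw [ht' i j a, ht i j a, mul_inv]
    push_cast
    ring
  comp := by
    rintro T T' f x x' ⟨h, t, ht⟩
    refine ⟨by rw [Category.assoc, Category.assoc, h], fun i => Units.map f.appTop.hom (t i),
      fun i j a => ?_⟩
    rw [appTop_comp_apply, appTop_comp_apply, ht i j a, map_mul, map_mul, ← map_inv]
    rfl

/-- The inclusion of the semistable locus. -/
def semistableInclusion (Z : Stability V) : (semistableLocus Z).X ⟶ (repSpace V).X :=
  (semistableOpens Z).ι

/-- The relation of lying in the same orbit of the torus, on the semistable locus. -/
def orbitRel (Z : Stability V) : PointRel (semistableLocus Z).X :=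
  (sameOrbitRel V).comap (semistableInclusion Z)

theorem topologicalKrullDim_eq_of_iso {X Y : Scheme.{0}} (e : X ≅ Y) :
    topologicalKrullDim X = topologicalKrullDim Y :=
  le_antisymm (topologicalKrullDim_le_of_isOpenImmersion e.hom)
    (topologicalKrullDim_le_of_isOpenImmersion e.inv)

theorem isPullback_resLE {X Y : Scheme.{0}} (p : X ⟶ Y) (U : Y.Opens) :
    IsPullback (p ⁻¹ᵁ U).ι (p.resLE U (p ⁻¹ᵁ U) le_rfl) p U.ι :=
  (IsOpenImmersion.isPullback _ _ _ _ (Scheme.Hom.resLE_comp_ι _ _).symm (by simp)).flip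

theorem resLE_appTop_topIso_inv {X Y : Scheme.{0}} (p : X ⟶ Y) (U : Y.Opens) (s : Γ(Y, U)) :
    (p.resLE U (p ⁻¹ᵁ U) le_rfl).appTop (U.topIso.inv s) = (p ⁻¹ᵁ U).topIso.inv (p.app U s) := by
  have h := Scheme.Hom.resLE_app_top p (U := U) (V := p ⁻¹ᵁ U) le_rfl
  rw [Scheme.Hom.appLE_eq_app] at h
  have h2 := congrArg (fun f => f (U.topIso.inv s)) h
  refine h2.trans ?_
  exact congrArg (fun u => (p ⁻¹ᵁ U).topIso.inv (p.app U u)) (Iso.inv_hom_id_apply U.topIso s)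

theorem IsLocalQuotient.isGITQuotient {Z : Stability V} {M : Variety}
    {π : (semistableLocus Z).X ⟶ M.X} (hp : IsLocalQuotient (orbitRel Z) π) (haff : IsAffineHom π)
    (hover : π ≫ M.str = (semistableLocus Z).str) : IsGITQuotient Z M π where
  over_base := hover
  invariant T x x' h := hp.invariant h
  affine := haff
  surjective := hp.surjective
  injective U := by
    intro s s' h
    -- Restricting the local quotient to `U` turns sections over `U` into global functions.
    have := (hp.of_isPullback (isPullback_resLE π U)).appTop_injective (U.ι ≫ M.str)
    have h2 := this (a₁ := U.topIso.inv s) (a₂ := U.topIso.inv s') (by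
      rw [resLE_appTop_topIso_inv, resLE_appTop_topIso_inv, h])
    have h3 := congrArg U.topIso.hom h2
    rwa [Iso.inv_hom_id_apply, Iso.inv_hom_id_apply] at h3
  invariants U s := by
    have h1 := (hp.of_isPullback (isPullback_resLE π U)).mem_range_appTop (U.ι ≫ M.str)
      ((π ⁻¹ᵁ U).topIso.inv s)
    have h2 : s ∈ Set.range (π.app U) ↔ (π ⁻¹ᵁ U).topIso.inv s ∈
        Set.range (π.resLE U (π ⁻¹ᵁ U) le_rfl).appTop := by
      constructor
      · rintro ⟨u, rfl⟩
        exact ⟨U.topIso.inv u, resLE_appTop_topIso_inv _ _ _⟩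
      · rintro ⟨u, hu⟩
        refine ⟨U.topIso.hom u, ?_⟩
        have h3 := resLE_appTop_topIso_inv π U (U.topIso.hom u)
        rw [Iso.hom_inv_id_apply, hu] at h3
        have h4 := congrArg (π ⁻¹ᵁ U).topIso.hom h3
        rw [Iso.inv_hom_id_apply, Iso.inv_hom_id_apply] at h4
        exact h4.symm
    rw [h2, h1]
    constructor
    · intro h T x x' hx
      refine h T x x' ?_
      change SameOrbit ((x ≫ _) ≫ semistableInclusion Z) ((x' ≫ _) ≫ _) at hx
      rwa [Category.assoc, Category.assoc] at hx
    · intro h T x x' hx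
      refine h (T := T) (x := x) (x' := x') ?_
      change SameOrbit ((x ≫ _) ≫ semistableInclusion Z) ((x' ≫ _) ≫ _)
      rwa [Category.assoc, Category.assoc]
  closed C hC hinv := hp.isClosed_image hC fun T x x' h => hinv T x x' h
  separates C D _ _ hC' hD' h := hp.disjoint_image (fun T x x' h => hC' T x x' h)
    (fun T x x' h => hD' T x x' h) h
  universal W w h hw hinv := by
    obtain ⟨k, hk, huniq⟩ := hp.existsUnique_factor h fun T x x' hx => hinv T x x' hx
    refine ⟨k, ⟨?_, hk⟩, fun k' hk' => huniq k' hk'.2⟩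
    -- Both `k ≫ w` and `M.str` factor the structure morphism of the locus, so compatibility with
    -- the base follows from uniqueness.
    have hi : (orbitRel Z).Invariant (π ≫ M.str) := fun T x x' hx => by
      rw [← Category.assoc, ← Category.assoc, hp.invariant hx]
    refine (hp.existsUnique_factor _ hi).unique ?_ rfl
    rw [← Category.assoc, hk, hw, hover]

/-- Two GIT quotients have the same virtual motive. -/
theorem IsGITQuotient.virtualMotive_eq {Z : Stability V} {M M' : Variety}
    {π : (semistableLocus Z).X ⟶ M.X} {π' : (semistableLocus Z).X ⟶ M'.X}
    (h : IsGITQuotient Z M π) (h' : IsGITQuotient Z M' π') :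
    virtualMotive M = virtualMotive M' := by
  obtain ⟨k, ⟨hk, hk'⟩, -⟩ := h.universal M'.X M'.str π' h'.over_base h'.invariant
  obtain ⟨k', ⟨hk2, hk2'⟩, -⟩ := h'.universal M.X M.str π h.over_base h.invariant
  let e : M.X ≅ M'.X := {
    hom := k, inv := k'
    hom_inv_id := (h.universal M.X M.str π h.over_base h.invariant).unique
      ⟨by rw [Category.assoc, hk2, hk], by rw [← Category.assoc, hk', hk2']⟩
      ⟨Category.id_comp _, Category.comp_id _⟩
    inv_hom_id := (h'.universal M'.X M'.str π' h'.over_base h'.invariant).unique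
      ⟨by rw [Category.assoc, hk, hk2], by rw [← Category.assoc, hk2', hk']⟩
      ⟨Category.id_comp _, Category.comp_id _⟩ }
  have hdim : dimension M = dimension M' := by
    rw [dimension, dimension, topologicalKrullDim_eq_of_iso e]
  rw [virtualMotive, virtualMotive, motive, motive, hdim, K0.cls_eq_of_iso e hk]

end Orbits

end

end AbelianQuiver

namespace AbelianQuiver

noncomputable section

/-! ### Gluing of slices -/

/-- A family of invariant open subsets with slices: `norm a x` is the normal form, in the slice
`slice a`, of a `T`-valued point `x` of the open subset `opens a`. -/
structure SliceSystem {X : Scheme.{0}} (r : PointRel X) (P : Type) [SemilatticeSup P] where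
  /-- the open subsets -/
  opens : P → X.Opens
  opens_sup : ∀ a b, opens (a ⊔ b) = opens a ⊓ opens b
  exists_mem : ∀ x : X, ∃ a, x ∈ opens a
  invariant : ∀ a, r.InvariantSet (opens a : Set X)
  /-- the slices -/
  slice : P → Scheme.{0}
  /-- the inclusion of the slices -/
  incl : ∀ a, slice a ⟶ X
  incl_mem : ∀ a y, incl a y ∈ opens a
  /-- the normal form -/
  norm : ∀ (a : P) {T : Scheme.{0}} (x : T ⟶ X), (∀ t, x t ∈ opens a) → (T ⟶ slice a)
  comp_norm : ∀ (a : P) {T T' : Scheme.{0}} (f : T' ⟶ T) (x : T ⟶ X) (hx : ∀ t, x t ∈ opens a)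
    (hx' : ∀ t, (f ≫ x) t ∈ opens a), f ≫ norm a x hx = norm a (f ≫ x) hx'
  norm_congr : ∀ (a : P) {T : Scheme.{0}} (x x' : T ⟶ X) (hx : ∀ t, x t ∈ opens a)
    (hx' : ∀ t, x' t ∈ opens a), r.rel x x' → norm a x hx = norm a x' hx'
  norm_incl : ∀ a, norm a (incl a) (incl_mem a) = 𝟙 _
  rel_norm : ∀ (a : P) {T : Scheme.{0}} (x : T ⟶ X) (hx : ∀ t, x t ∈ opens a),
    r.rel (norm a x hx ≫ incl a) x

namespace SliceSystem

variable {X : Scheme.{0}} {r : PointRel X} {P : Type} [SemilatticeSup P] (D : SliceSystem r P)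

theorem opens_anti {a b : P} (h : a ≤ b) : D.opens b ≤ D.opens a := by
  have := D.opens_sup a b
  rw [sup_eq_right.mpr h] at this
  rw [this]
  exact inf_le_left

/-- The normal form in the slice of `b` is still equivalent to `x`, and normal forms are constant on
classes. All cocycle identities for the gluing come from this. -/
theorem norm_norm {a b : P} {T : Scheme.{0}} (x : T ⟶ X) (hb : ∀ t, x t ∈ D.opens b)
    (ha : ∀ t, x t ∈ D.opens a) (h : ∀ t, D.incl b t ∈ D.opens a) :
    D.norm b x hb ≫ D.norm a (D.incl b) h = D.norm a x ha := by
  have hx : ∀ t, (D.norm b x hb ≫ D.incl b) t ∈ D.opens a := fun t =>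
    (D.invariant a (D.rel_norm b x hb) t).mpr (ha t)
  rw [D.comp_norm a _ _ _ hx]
  exact D.norm_congr a _ _ _ _ (D.rel_norm b x hb)

theorem incl_mem_of_le {a b : P} (h : a ≤ b) (y : D.slice b) : D.incl b y ∈ D.opens a :=
  D.opens_anti h (D.incl_mem b y)

/-- The transition maps of the slices. -/
def transition {a b : P} (h : a ≤ b) : D.slice b ⟶ D.slice a :=
  D.norm a (D.incl b) (D.incl_mem_of_le h)

theorem transition_comp {a b c : P} (h : a ≤ b) (h' : b ≤ c) :
    D.transition h' ≫ D.transition h = D.transition (h.trans h') :=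
  D.norm_norm _ _ _ _

theorem transition_apply {a b c : P} (h : a ≤ b) (h' : b ≤ c) (z : D.slice c) :
    D.transition h (D.transition h' z) = D.transition (h.trans h') z := by
  rw [← Scheme.Hom.comp_apply, transition_comp]

/-- The diagram of slices. -/
def diagram : Pᵒᵖ ⥤ Scheme.{0} where
  obj a := D.slice a.unop
  map f := D.transition f.unop.le
  map_id _ := D.norm_incl _
  map_comp _ _ := (D.norm_norm _ _ _ _).symm

theorem comp_mem {Y T : Scheme.{0}} {U : X.Opens} (f : T ⟶ Y) {x : Y ⟶ X}
    (hx : ∀ y, x y ∈ U) (t : T) : (f ≫ x) t ∈ U := by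
  rw [Scheme.Hom.comp_apply]; exact hx _

/-- The slice of the smaller open subset is open in the slice of the larger one. -/
def sliceIso {a b : P} (h : a ≤ b) : D.slice b ≅ ↑(D.incl a ⁻¹ᵁ D.opens b) where
  hom := IsOpenImmersion.lift (D.incl a ⁻¹ᵁ D.opens b).ι (D.transition h) (by
    rw [Scheme.Opens.range_ι]
    rintro _ ⟨y, rfl⟩
    change D.incl a (D.transition h y) ∈ D.opens b
    rw [← Scheme.Hom.comp_apply]
    exact (D.invariant b (D.rel_norm a _ _) y).mpr (D.incl_mem b y))
  inv := D.norm b ((D.incl a ⁻¹ᵁ D.opens b).ι ≫ D.incl a) (fun t => by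
    rw [Scheme.Hom.comp_apply]; exact t.2)
  hom_inv_id := by
    have hx : ∀ t, (D.transition h ≫ D.incl a) t ∈ D.opens b := fun t =>
      (D.invariant b (D.rel_norm a _ _) t).mpr (D.incl_mem b t)
    have hx' : ∀ t, (IsOpenImmersion.lift (D.incl a ⁻¹ᵁ D.opens b).ι (D.transition h) (by
        rw [Scheme.Opens.range_ι]
        rintro _ ⟨y, rfl⟩
        change D.incl a (D.transition h y) ∈ D.opens b
        rw [← Scheme.Hom.comp_apply]
        exact (D.invariant b (D.rel_norm a _ _) y).mpr (D.incl_mem b y)) ≫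
          (D.incl a ⁻¹ᵁ D.opens b).ι ≫ D.incl a) t ∈ D.opens b := by
      rw [← Category.assoc, IsOpenImmersion.lift_fac]; exact hx
    rw [D.comp_norm b _ _ _ hx', ← D.norm_incl b]
    refine D.norm_congr b _ _ _ _ ?_
    rw [← Category.assoc, IsOpenImmersion.lift_fac]
    exact D.rel_norm a _ _
  inv_hom_id := by
    rw [← cancel_mono (D.incl a ⁻¹ᵁ D.opens b).ι, Category.assoc, IsOpenImmersion.lift_fac,
      transition, D.norm_norm _ _ (comp_mem _ fun t => D.incl_mem a t),
      ← D.comp_norm a _ _ (D.incl_mem a), D.norm_incl, Category.comp_id, Category.id_comp]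

theorem sliceIso_hom_ι {a b : P} (h : a ≤ b) :
    (D.sliceIso h).hom ≫ (D.incl a ⁻¹ᵁ D.opens b).ι = D.transition h :=
  IsOpenImmersion.lift_fac _ _ _

instance {a b : P} (h : a ≤ b) : IsOpenImmersion (D.transition h) := by
  rw [← D.sliceIso_hom_ι h]; infer_instance

instance {a b : Pᵒᵖ} (f : a ⟶ b) : IsOpenImmersion (D.diagram.map f) :=
  inferInstanceAs (IsOpenImmersion (D.transition f.unop.le))

theorem mem_range_transition {a b : P} (h : a ≤ b) {y : D.slice a} :
    y ∈ Set.range (D.transition h) ↔ D.incl a y ∈ D.opens b := by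
  have h1 : Set.range (D.transition h) = Set.range (D.incl a ⁻¹ᵁ D.opens b).ι := by
    rw [← D.sliceIso_hom_ι h, Scheme.Hom.comp_base, TopCat.coe_comp, Set.range_comp,
      Set.range_eq_univ.mpr (D.sliceIso h).hom.surjective, Set.image_univ]
  rw [h1, Scheme.Opens.range_ι]
  rfl

/-- Within the slice of `c`, the images of the slices of `a` and `b` intersect in the slice of `a ⊔
b`. This makes the diagram of slices locally directed, hence glueable along open immersions. -/
theorem exists_transition_eq {a b c : P} (hac : c ≤ a) (hbc : c ≤ b) (y : D.slice a)
    (y' : D.slice b) (h : D.transition hac y = D.transition hbc y') :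
    ∃ z : D.slice (a ⊔ b), D.transition le_sup_left z = y ∧ D.transition le_sup_right z = y' := by
  have h1 : D.incl c (D.transition hac y) ∈ D.opens (a ⊔ b) := by
    rw [D.opens_sup]
    exact ⟨(D.mem_range_transition hac).mp ⟨y, rfl⟩,
      (D.mem_range_transition hbc).mp ⟨y', h.symm⟩⟩
  obtain ⟨z, hz⟩ := (D.mem_range_transition (hac.trans le_sup_left)).mpr h1
  refine ⟨z, (D.transition hac).isOpenEmbedding.injective ?_,
    (D.transition hbc).isOpenEmbedding.injective ?_⟩
  · rw [transition_apply, hz]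
  · rw [transition_apply, hz, h]

instance : (D.diagram ⋙ Scheme.forget).IsLocallyDirected where
  cond {i j k} fi fj xi xj h := by
    obtain ⟨z, hz, hz'⟩ := D.exists_transition_eq fi.unop.le fj.unop.le xi xj h
    exact ⟨Opposite.op (i.unop ⊔ j.unop), (homOfLE le_sup_left).op, (homOfLE le_sup_right).op,
      z, hz, hz'⟩

/-- The scheme glued from the slices. -/
def glued : Scheme.{0} := colimit D.diagram

/-- The inclusions of the slices into the glued scheme. -/
def ι (a : P) : D.slice a ⟶ D.glued := colimit.ι D.diagram (Opposite.op a)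

instance (a : P) : IsOpenImmersion (D.ι a) :=
  inferInstanceAs (IsOpenImmersion (colimit.ι D.diagram (Opposite.op a)))

theorem transition_ι {a b : P} (h : a ≤ b) : D.transition h ≫ D.ι a = D.ι b :=
  colimit.w D.diagram (homOfLE h).op

theorem exists_ι_eq (y : D.glued) : ∃ a z, D.ι a z = y := by
  obtain ⟨a, z, h⟩ := Scheme.IsLocallyDirected.ι_jointly_surjective D.diagram y
  exact ⟨a.unop, z, h⟩

theorem ι_eq_ι_iff {a b : P} {y : D.slice a} {y' : D.slice b} :
    D.ι a y = D.ι b y' ↔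
      ∃ z : D.slice (a ⊔ b), D.transition le_sup_left z = y ∧ D.transition le_sup_right z = y' := by
  constructor
  · intro h
    obtain ⟨k, fi, fj, x, hx, hx'⟩ := (Scheme.IsLocallyDirected.ι_eq_ι_iff D.diagram).mp h
    have hle : a ⊔ b ≤ k.unop := sup_le fi.unop.le fj.unop.le
    exact ⟨D.transition hle x, (D.transition_apply le_sup_left hle x).trans hx,
      (D.transition_apply le_sup_right hle x).trans hx'⟩
  · rintro ⟨z, rfl, rfl⟩
    rw [← Scheme.Hom.comp_apply, ← Scheme.Hom.comp_apply, transition_ι, transition_ι]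

theorem opensRange_ι_sup (a b : P) :
    (D.ι (a ⊔ b)).opensRange = (D.ι a).opensRange ⊓ (D.ι b).opensRange := by
  ext y
  constructor
  · rintro ⟨z, rfl⟩
    exact ⟨⟨D.transition le_sup_left z, by rw [← Scheme.Hom.comp_apply, transition_ι]⟩,
      ⟨D.transition le_sup_right z, by rw [← Scheme.Hom.comp_apply, transition_ι]⟩⟩
  · rintro ⟨⟨z, rfl⟩, ⟨z', h⟩⟩
    obtain ⟨w, rfl, -⟩ := D.ι_eq_ι_iff.mp h.symm
    exact ⟨w, by rw [← Scheme.Hom.comp_apply, transition_ι]⟩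

/-- The open cover of `X` by the open subsets of a slice system. -/
def cover : X.OpenCover where
  I₀ := P
  X a := (D.opens a : Scheme.{0})
  f a := (D.opens a).ι
  mem₀ := by
    rw [Scheme.presieve₀_mem_precoverage_iff]
    exact ⟨fun x => ⟨(D.exists_mem x).choose, by
      rw [Scheme.Opens.range_ι]; exact (D.exists_mem x).choose_spec⟩, inferInstance⟩

/-- Both sides factor through the normal form in the slice of `a ⊔ b`. -/
theorem norm_ι {a b : P} {T : Scheme.{0}} (x : T ⟶ X) (ha : ∀ t, x t ∈ D.opens a)
    (hb : ∀ t, x t ∈ D.opens b) : D.norm a x ha ≫ D.ι a = D.norm b x hb ≫ D.ι b := by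
  have hab : ∀ t, x t ∈ D.opens (a ⊔ b) := fun t => by rw [D.opens_sup]; exact ⟨ha t, hb t⟩
  have h1 : D.norm a x ha = D.norm (a ⊔ b) x hab ≫ D.transition le_sup_left :=
    (D.norm_norm _ _ _ _).symm
  have h2 : D.norm b x hb = D.norm (a ⊔ b) x hab ≫ D.transition le_sup_right :=
    (D.norm_norm _ _ _ _).symm
  rw [h1, h2, Category.assoc, Category.assoc, transition_ι, transition_ι]

theorem norm_ι_compat (a b : P) : pullback.fst (D.opens a).ι (D.opens b).ι ≫
    D.norm a (D.opens a).ι (ι_mem _) ≫ D.ι a =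
      pullback.snd (D.opens a).ι (D.opens b).ι ≫ D.norm b (D.opens b).ι (ι_mem _) ≫ D.ι b := by
  have hc : pullback.fst (D.opens a).ι (D.opens b).ι ≫ (D.opens a).ι =
    pullback.snd (D.opens a).ι (D.opens b).ι ≫ (D.opens b).ι := pullback.condition
  have h2 := comp_mem (pullback.snd (D.opens a).ι (D.opens b).ι) (ι_mem (D.opens b))
  rw [← Category.assoc, ← Category.assoc,
    D.comp_norm a _ _ _ (comp_mem _ (ι_mem (D.opens a))),
    D.comp_norm b _ _ _ h2]
  refine Eq.trans ?_ (D.norm_ι (a := a) _ (by rw [← hc]; exact comp_mem _ (ι_mem _)) h2)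
  congr 1
  exact D.norm_congr a _ _ _ _ (by rw [hc]; exact r.refl _)

/-- The quotient map to the glued scheme. -/
def proj : X ⟶ D.glued :=
  D.cover.glueMorphisms (fun a => D.norm a (D.opens a).ι (ι_mem _) ≫ D.ι a) D.norm_ι_compat

theorem ι_proj (a : P) : (D.opens a).ι ≫ D.proj = D.norm a (D.opens a).ι (ι_mem _) ≫ D.ι a :=
  D.cover.ι_glueMorphisms _ D.norm_ι_compat a

theorem comp_proj {a : P} {T : Scheme.{0}} (x : T ⟶ X) (hx : ∀ t, x t ∈ D.opens a) :
    x ≫ D.proj = D.norm a x hx ≫ D.ι a := by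
  have hr : Set.range x ⊆ Set.range (D.opens a).ι := by
    rw [Scheme.Opens.range_ι]; rintro _ ⟨t, rfl⟩; exact hx t
  have h := IsOpenImmersion.lift_fac (D.opens a).ι x hr
  have hx' := comp_mem (IsOpenImmersion.lift (D.opens a).ι x hr) (ι_mem (D.opens a))
  have h1 : x ≫ D.proj = (IsOpenImmersion.lift (D.opens a).ι x hr ≫ (D.opens a).ι) ≫ D.proj := by
    rw [h]
  rw [h1, Category.assoc, ι_proj, ← Category.assoc, D.comp_norm a _ _ _ hx']
  congr 1
  exact D.norm_congr a _ _ _ _ (by rw [h]; exact r.refl _)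

theorem incl_proj (a : P) : D.incl a ≫ D.proj = D.ι a := by
  rw [D.comp_proj _ (D.incl_mem a), D.norm_incl, Category.id_comp]

/-- If the image of `x`, computed in the chart of `b`, also lies in the chart of `a`, it comes from
the slice of `a ⊔ b`. The normal form of `x` is then in `opens (a ⊔ b)`, and invariance carries this
back to `x`. -/
theorem proj_mem_iff {a : P} {x : X} : D.proj x ∈ Set.range (D.ι a) ↔ x ∈ D.opens a := by
  have key : ∀ {b : P} (x : (D.opens b : Scheme.{0})), D.proj ((D.opens b).ι x) =
      D.ι b (D.norm b (D.opens b).ι (ι_mem _) x) := fun {b} x => by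
    rw [← Scheme.Hom.comp_apply, ι_proj, Scheme.Hom.comp_apply]
  constructor
  · rintro ⟨y, hy⟩
    obtain ⟨b, hb⟩ := D.exists_mem x
    obtain ⟨x, rfl⟩ := AbelianQuiver.exists_ι_eq hb
    rw [key] at hy
    obtain ⟨z, -, hz⟩ := D.ι_eq_ι_iff.mp hy
    have h1 := (D.mem_range_transition le_sup_right).mp ⟨z, hz⟩
    rw [← Scheme.Hom.comp_apply] at h1
    have h2 := (D.invariant _ (D.rel_norm b _ (ι_mem _)) x).mp h1
    exact D.opens_anti le_sup_left h2
  · intro hx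
    obtain ⟨x, rfl⟩ := AbelianQuiver.exists_ι_eq hx
    exact ⟨_, (key x).symm⟩

theorem proj_preimage_opensRange (a : P) : D.proj ⁻¹ᵁ (D.ι a).opensRange = D.opens a := by
  ext x
  exact D.proj_mem_iff

theorem isLocalQuotient : IsLocalQuotient r D.proj where
  invariant T x x' h := by
    -- Equality of morphisms is local on `T`; near `t` both points lie in a single `opens a`, where
    -- related points have equal normal forms.
    refine Scheme.hom_ext_of_forall _ _ fun t => ?_
    obtain ⟨a, ha⟩ := D.exists_mem (x t)
    have ha' : ∀ u : (x ⁻¹ᵁ D.opens a : T.Opens).toScheme, ((x ⁻¹ᵁ D.opens a).ι ≫ x) u ∈ D.opens a := fun u => by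
      rw [Scheme.Hom.comp_apply]; exact u.2
    have hr := r.comp (x ⁻¹ᵁ D.opens a).ι h
    have ha'' : ∀ u : (x ⁻¹ᵁ D.opens a : T.Opens).toScheme, ((x ⁻¹ᵁ D.opens a).ι ≫ x') u ∈ D.opens a := fun u =>
      (D.invariant a hr u).mp (ha' u)
    refine ⟨x ⁻¹ᵁ D.opens a, ha, ?_⟩
    rw [← Category.assoc, ← Category.assoc, D.comp_proj _ ha', D.comp_proj _ ha'',
      D.norm_congr a _ _ ha' ha'' hr]
  exists_section y := by
    obtain ⟨a, z, rfl⟩ := D.exists_ι_eq y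
    refine ⟨D.slice a, D.ι a, D.incl a, inferInstance, ⟨z, rfl⟩, D.incl_proj a, ?_⟩
    intro T x v h
    have hx : ∀ t, x t ∈ D.opens a := fun t => D.proj_mem_iff.mp ⟨v t, by
      rw [← Scheme.Hom.comp_apply, ← Scheme.Hom.comp_apply, h]⟩
    rw [D.comp_proj x hx, cancel_mono] at h
    rw [← h]
    exact D.rel_norm a x hx

end SliceSystem

end

end AbelianQuiver

namespace AbelianQuiver

noncomputable section

/-! ### Spanning trees -/

section Trees

variable {U A : Type*} [DecidableEq U] [DecidableEq A] [Fintype U] (s t : A → U)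

/-- The data of a tree of arrows in `S` with set of vertices `B` and root `v₀`. For every vertex `v`
of the tree, `weight v` is the unique path in the tree from the root to `v`, as a sum of arrows. -/
structure TreeData (S : Finset A) (v₀ : U) (B : Finset U) where
  /-- the arrows of the tree -/
  tree : Finset A
  /-- the paths from the root -/
  weight : U → A → ℤ
  root_mem : v₀ ∈ B
  card_tree : tree.card + 1 = B.card
  tree_subset : tree ⊆ S
  ends_mem : ∀ a ∈ tree, s a ∈ B ∧ t a ∈ B
  weight_support : ∀ v a, a ∉ tree → weight v a = 0
  weight_arrow : ∀ a ∈ tree, weight (t a) = weight (s a) + Pi.single a 1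
  degree : ∀ v ∈ B, ∀ (G : Type) [CommGroup G] (g : U → G),
    ∏ a ∈ tree, (g (t a) / g (s a)) ^ weight v a = g v / g v₀

variable {s t} {S : Finset A} {v₀ : U}

/-- The tree without arrows. -/
def TreeData.root (S : Finset A) (v₀ : U) : TreeData s t S v₀ {v₀} where
  tree := ∅
  weight := 0
  root_mem := by simp
  card_tree := by simp
  tree_subset := by simp
  ends_mem := by simp
  weight_support := by simp
  weight_arrow := by simp
  degree := by simp

/-- An arrow across the boundary of `B` can be added to the tree. The path to its new end is the
path to the old end followed by this arrow, with a sign according to its orientation. -/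
theorem TreeData.exists_insert {B : Finset U} (D : TreeData s t S v₀ B) {a : A} (ha : a ∈ S)
    (h : (s a ∈ B ∧ t a ∉ B) ∨ (s a ∉ B ∧ t a ∈ B)) :
    ∃ v ∉ B, Nonempty (TreeData s t S v₀ (insert v B)) := by
  have haT : a ∉ D.tree := fun h' => by
    have := D.ends_mem a h'
    tauto
  have hprod : ∀ (G : Type) [CommGroup G] (g : U → G) (e : A → ℤ) (c : ℤ), (e a = c) →
      ∏ b ∈ insert a D.tree, (g (t b) / g (s b)) ^ e b =
        (g (t a) / g (s a)) ^ c * ∏ b ∈ D.tree, (g (t b) / g (s b)) ^ e b := by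
    intro G _ g e c hc
    rw [Finset.prod_insert haT, hc]
  have hdeg : ∀ v ∈ B, ∀ (G : Type) [CommGroup G] (g : U → G),
      ∏ b ∈ insert a D.tree, (g (t b) / g (s b)) ^ D.weight v b = g v / g v₀ := by
    intro v hv G _ g
    rw [hprod G g (D.weight v) 0 (D.weight_support v a haT), zpow_zero, one_mul, D.degree v hv]
  have hsingle : ∀ (G : Type) [CommGroup G] (g : U → G) (w : A → ℤ) (c : ℤ), (w a = 0) →
      ∏ b ∈ insert a D.tree, (g (t b) / g (s b)) ^ (w + Pi.single a c : A → ℤ) b =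
        (g (t a) / g (s a)) ^ c * ∏ b ∈ insert a D.tree, (g (t b) / g (s b)) ^ w b := by
    intro G _ g w c hw
    rw [hprod G g _ c (by simp [hw]), hprod G g _ 0 hw, zpow_zero, one_mul]
    congr 1
    refine Finset.prod_congr rfl fun b hb => ?_
    have : b ≠ a := fun h => haT (h ▸ hb)
    simp [this]
  -- Here `u` is the new vertex, `p` its neighbour in the tree, and `c` is `1` or `-1` according to
  -- whether `a` points towards `u` or away from it.
  have key : ∀ (u p : U) (c : ℤ), u ∉ B → p ∈ B →
      (∀ (G : Type) [CommGroup G] (g : U → G), (g (t a) / g (s a)) ^ c * g p = g u) →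
      (s a ∈ insert u B ∧ t a ∈ insert u B) →
      (Function.update D.weight u (D.weight p + Pi.single a c) (t a) =
        Function.update D.weight u (D.weight p + Pi.single a c) (s a) + Pi.single a 1) →
      Nonempty (TreeData s t S v₀ (insert u B)) := by
    intro u p c hu hp hg hends hw
    have hne : ∀ v ∈ B, v ≠ u := fun v hv h => hu (h ▸ hv)
    refine ⟨{
      tree := insert a D.tree
      weight := Function.update D.weight u (D.weight p + Pi.single a c)
      root_mem := Finset.mem_insert_of_mem D.root_mem
      card_tree := by
        rw [Finset.card_insert_of_notMem haT, Finset.card_insert_of_notMem hu, D.card_tree]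
      tree_subset := Finset.insert_subset ha D.tree_subset
      ends_mem := ?_
      weight_support := ?_
      weight_arrow := ?_
      degree := ?_ }⟩
    · intro b hb
      rcases Finset.mem_insert.mp hb with rfl | hb
      · exact hends
      · exact ⟨Finset.mem_insert_of_mem (D.ends_mem b hb).1,
          Finset.mem_insert_of_mem (D.ends_mem b hb).2⟩
    · intro v b hb
      rw [Finset.mem_insert, not_or] at hb
      by_cases hv : v = u
      · subst hv
        simp [D.weight_support p b hb.2, hb.1]
      · rw [Function.update_of_ne hv]
        exact D.weight_support v b hb.2
    · intro b hb
      rcases Finset.mem_insert.mp hb with rfl | hb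
      · exact hw
      · rw [Function.update_of_ne (hne _ (D.ends_mem b hb).1),
          Function.update_of_ne (hne _ (D.ends_mem b hb).2), D.weight_arrow b hb]
    · intro v hv G _ g
      rcases Finset.mem_insert.mp hv with rfl | hv
      · rw [Function.update_self, hsingle G g _ c (D.weight_support p a haT), hdeg p hp,
          ← mul_div_assoc, hg G g]
      · rw [Function.update_of_ne (hne v hv), hdeg v hv]
  rcases h with ⟨h1, h2⟩ | ⟨h1, h2⟩
  · refine ⟨t a, h2, key (t a) (s a) 1 h2 h1 (fun G _ g => by simp)
      ⟨Finset.mem_insert_of_mem h1, Finset.mem_insert_self _ _⟩ ?_⟩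
    have : s a ≠ t a := fun h => h2 (h ▸ h1)
    rw [Function.update_self, Function.update_of_ne this]
  · refine ⟨s a, h1, key (s a) (t a) (-1) h1 h2 (fun G _ g => by simp)
      ⟨Finset.mem_insert_self _ _, Finset.mem_insert_of_mem h2⟩ ?_⟩
    have : t a ≠ s a := fun h => h1 (h ▸ h2)
    rw [Function.update_self, Function.update_of_ne this, add_assoc, ← Pi.single_add]
    simp

/-- Connectivity in the form that no proper non-empty vertex set is isolated lets the tree grow from
the root by one vertex at a time. -/
theorem nonempty_treeData (v₀ : U) (hconn : ∀ B : Finset U, B.Nonempty → B ≠ Finset.univ →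
    ∃ a ∈ S, (s a ∈ B ∧ t a ∉ B) ∨ (s a ∉ B ∧ t a ∈ B)) :
    Nonempty (TreeData s t S v₀ Finset.univ) := by
  have key : ∀ k, k < Fintype.card U → ∃ B : Finset U, B.card = k + 1 ∧
      Nonempty (TreeData s t S v₀ B) := by
    intro k
    induction k with
    | zero => exact fun _ => ⟨{v₀}, by simp, ⟨TreeData.root S v₀⟩⟩
    | succ k ih =>
      intro hk
      obtain ⟨B, hB, ⟨D⟩⟩ := ih (by omega)
      obtain ⟨a, ha, h⟩ := hconn B ⟨v₀, D.root_mem⟩ (fun h => by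
        rw [h, Finset.card_univ] at hB; omega)
      obtain ⟨v, hv, hD⟩ := D.exists_insert ha h
      exact ⟨insert v B, by rw [Finset.card_insert_of_notMem hv, hB], hD⟩
  have hpos : 0 < Fintype.card U := Fintype.card_pos_iff.mpr ⟨v₀⟩
  obtain ⟨B, hB, hD⟩ := key (Fintype.card U - 1) (by omega)
  have : B = Finset.univ := Finset.eq_univ_of_card B (by omega)
  rwa [← this]

end Trees

/-! ### Points of affine spaces -/

open Classical in
/-- A unit, made from an element of a ring that may not be one. -/
def unitPart {R : Type*} [CommRing R] (r : R) : Rˣ := if h : IsUnit r then h.unit else 1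

theorem coe_unitPart {R : Type*} [CommRing R] {r : R} (h : IsUnit r) : (unitPart r : R) = r := by
  rw [unitPart, dif_pos h, IsUnit.unit_spec]

theorem map_unitPart {R R' : Type*} [CommRing R] [CommRing R'] (f : R →+* R') {r : R}
    (h : IsUnit r) : Units.map (f : R →* R') (unitPart r) = unitPart (f r) := by
  ext
  rw [Units.coe_map, coe_unitPart (h.map f), MonoidHom.coe_coe, coe_unitPart h]

@[simp] theorem unitPart_one {R : Type*} [CommRing R] : unitPart (1 : R) = 1 := by
  ext
  rw [coe_unitPart isUnit_one, Units.val_one]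

theorem isUnit_of_forall_mem_basicOpen {T : Scheme.{0}} {f : Γ(T, ⊤)}
    (h : ∀ x : T, x ∈ T.basicOpen f) : IsUnit f := by
  refine RingedSpace.isUnit_of_isUnit_germ T.toLocallyRingedSpace.toRingedSpace ⊤ f fun x hx => ?_
  exact (Scheme.mem_basicOpen T f x hx).mp (h x)

theorem forall_mem_coordOpen_iff {n : Type} [Fintype n] {T : Scheme.{0}} {S : Finset n}
    {x : T ⟶ 𝔸(n; SpecC)} :
    (∀ y, x y ∈ coordOpen S) ↔ ∀ i ∈ S, IsUnit (x.appTop (AffineSpace.coord SpecC i)) := by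
  have h1 : (∀ y, x y ∈ coordOpen S) ↔
      ∀ i ∈ S, ∀ y, y ∈ T.basicOpen (x.appTop (AffineSpace.coord SpecC i)) := by
    simp only [mem_basicOpen_appTop_iff, mem_coordOpen, Finset.subset_iff, mem_coordSupport]
    tauto
  rw [h1]
  refine forall₂_congr fun i _ => ⟨isUnit_of_forall_mem_basicOpen, fun h y => ?_⟩
  rw [Scheme.basicOpen_of_isUnit _ h]
  trivial

end

end AbelianQuiver

namespace AbelianQuiver

noncomputable section

/-! ### Slices of the action of the torus -/

/-- This is the invariance of a normalized coordinate: a change of gauge multiplies path products by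
ratios to the gauge at the root, and the root factor cancels. -/
theorem mul_inv_eq_of_ratio {G : Type*} [CommGroup G] (w w' z z' z₀ : G) :
    w * w'⁻¹ = (w * (z / z₀)) * (z' * z⁻¹) * (w' * (z' / z₀))⁻¹ := by
  have h1 : ∀ y c : G, y * (c * y⁻¹) = c := fun y c => by
    rw [mul_comm c, mul_inv_cancel_left]
  rw [eq_comm, ← div_eq_mul_inv, div_eq_iff_eq_mul]
  simp only [div_eq_mul_inv]
  rw [show w * (z * z₀⁻¹) * (z' * z⁻¹) = z * ((w * z' * z₀⁻¹) * z⁻¹) by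
      simp only [mul_comm, mul_left_comm, mul_assoc],
    show w * w'⁻¹ * (w' * (z' * z₀⁻¹)) = w' * ((w * z' * z₀⁻¹) * w'⁻¹) by
      simp only [mul_comm, mul_left_comm, mul_assoc], h1, h1]

section Slices

variable {V : Type} [Quiver.{0} V] [Fintype V] [DecidableEq V] [∀ i j : V, Finite (i ⟶ j)]
  [Fintype (Arrows V)] [DecidableEq (Arrows V)]

/-- The coordinates of a `T`-valued abelian representation. -/
def arrowCoord {T : Scheme.{0}} (x : T ⟶ (repSpace V).X) (p : Arrows V) : Γ(T, ⊤) :=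
  x.appTop (coordinate p.2.2)

theorem arrowCoord_comp {T T' : Scheme.{0}} (f : T' ⟶ T) (x : T ⟶ (repSpace V).X)
    (p : Arrows V) : arrowCoord (f ≫ x) p = f.appTop (arrowCoord x p) :=
  appTop_comp_apply f x _

/-- The `T`-valued abelian representation with given coordinates. -/
def repHom {T : Scheme.{0}} (f : T ⟶ SpecC) (v : Arrows V → Γ(T, ⊤)) : T ⟶ (repSpace V).X :=
  AffineSpace.homOfVector f v

theorem arrowCoord_repHom {T : Scheme.{0}} (f : T ⟶ SpecC) (v : Arrows V → Γ(T, ⊤))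
    (p : Arrows V) : arrowCoord (repHom f v) p = v p :=
  AffineSpace.homOfVector_appTop_coord f v p

theorem repHom_str {T : Scheme.{0}} (f : T ⟶ SpecC) (v : Arrows V → Γ(T, ⊤)) :
    repHom f v ≫ (repSpace V).str = f :=
  AffineSpace.homOfVector_over f v

theorem sameOrbit_iff {T : Scheme.{0}} {x x' : T ⟶ (repSpace V).X} :
    SameOrbit x x' ↔ x ≫ (repSpace V).str = x' ≫ (repSpace V).str ∧
      ∃ t : V → Γ(T, ⊤)ˣ, ∀ p : Arrows V,
        arrowCoord x' p = t p.2.1 * arrowCoord x p * ↑(t p.1)⁻¹ :=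
  and_congr_right fun _ => exists_congr fun _ => ⟨fun h p => h _ _ p.2.2, fun h i j a => h ⟨i, j, a⟩⟩

/-- The locus of representations where the arrows in `S` are invertible. -/
def arrowOpen (S : Finset (Arrows V)) : (repSpace V).X.Opens := coordOpen (n := Arrows V) S

theorem forall_mem_arrowOpen_iff {T : Scheme.{0}} {S : Finset (Arrows V)}
    {x : T ⟶ (repSpace V).X} :
    (∀ y, x y ∈ arrowOpen S) ↔ ∀ p ∈ S, IsUnit (arrowCoord x p) :=
  forall_mem_coordOpen_iff (n := Arrows V)

theorem mem_arrowOpen_iff {T : Scheme.{0}} {S : Finset (Arrows V)} {x : T ⟶ (repSpace V).X}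
    {y : T} : x y ∈ arrowOpen S ↔ ∀ p ∈ S, T.Γevaluation y (arrowCoord x p) ≠ 0 := by
  have h : x y ∈ arrowOpen S ↔ ∀ p ∈ S, y ∈ T.basicOpen (arrowCoord x p) := by
    refine (mem_coordOpen (n := Arrows V)).trans ?_
    exact forall₂_congr fun p _ =>
      (mem_coordSupport (n := Arrows V)).trans (mem_basicOpen_appTop_iff x _ y).symm
  rw [h]
  exact forall₂_congr fun p _ => mem_basicOpen_iff _ _

theorem invariantSet_arrowOpen (S : Finset (Arrows V)) :
    (sameOrbitRel V).InvariantSet (arrowOpen S : Set (repSpace V).X) := by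
  intro T x x' h t
  obtain ⟨-, u, hu⟩ := sameOrbit_iff.mp h
  refine mem_arrowOpen_iff.trans (Iff.trans (forall₂_congr fun p _ => ?_) mem_arrowOpen_iff.symm)
  rw [hu p, map_mul, map_mul]
  have h1 : T.Γevaluation t (u p.2.1 : Γ(T, ⊤)) ≠ 0 := ((u p.2.1).isUnit.map _).ne_zero
  have h2 : T.Γevaluation t (↑(u p.1)⁻¹ : Γ(T, ⊤)) ≠ 0 := ((u p.1)⁻¹.isUnit.map _).ne_zero
  exact ⟨fun h => mul_ne_zero (mul_ne_zero h1 h) h2,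
    fun h => right_ne_zero_of_mul (left_ne_zero_of_mul h)⟩

variable {S : Finset (Arrows V)} {v₀ : V}
  (D : TreeData (fun a : Arrows V => a.1) (fun a => a.2.1) S v₀ Finset.univ)

/-- The product of the coordinates along the path from the root to a vertex. -/
def pathCoord {T : Scheme.{0}} (x : T ⟶ (repSpace V).X) (v : V) : Γ(T, ⊤)ˣ :=
  ∏ a ∈ D.tree, unitPart (arrowCoord x a) ^ D.weight v a

theorem pathCoord_arrow {T : Scheme.{0}} {x : T ⟶ (repSpace V).X}
    (hx : ∀ p ∈ S, IsUnit (arrowCoord x p)) {a : Arrows V} (ha : a ∈ D.tree) :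
    (pathCoord D x a.2.1 : Γ(T, ⊤)) = pathCoord D x a.1 * arrowCoord x a := by
  rw [← coe_unitPart (hx a (D.tree_subset ha)), ← Units.val_mul]
  congr 1
  unfold pathCoord
  rw [show D.weight a.2.1 = D.weight a.1 + Pi.single a 1 from D.weight_arrow a ha]
  simp only [Pi.add_apply, zpow_add, Finset.prod_mul_distrib]
  congr 1
  rw [Finset.prod_eq_single_of_mem a ha fun b _ hb => by simp [hb]]
  simp

theorem pathCoord_comp {T T' : Scheme.{0}} (f : T' ⟶ T) {x : T ⟶ (repSpace V).X}
    (hx : ∀ p ∈ S, IsUnit (arrowCoord x p)) (v : V) :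
    pathCoord D (f ≫ x) v = Units.map f.appTop.hom (pathCoord D x v) := by
  unfold pathCoord
  rw [map_prod]
  refine Finset.prod_congr rfl fun a ha => ?_
  rw [map_zpow, arrowCoord_comp]
  congr 1
  exact (map_unitPart f.appTop.hom (hx a (D.tree_subset ha))).symm

theorem pathCoord_eq_one {T : Scheme.{0}} {x : T ⟶ (repSpace V).X}
    (hx : ∀ p ∈ D.tree, arrowCoord x p = 1) (v : V) : pathCoord D x v = 1 :=
  Finset.prod_eq_one fun a ha => by rw [hx a ha, unitPart_one, one_zpow]

/-- Along the path from the root the gauge factors telescope, which is the content of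
`TreeData.degree`. What is left over at the root reflects that scalars act trivially. -/
theorem pathCoord_smul {T : Scheme.{0}} {x x' : T ⟶ (repSpace V).X}
    (hx : ∀ p ∈ S, IsUnit (arrowCoord x p)) (hx' : ∀ p ∈ S, IsUnit (arrowCoord x' p))
    {u : V → Γ(T, ⊤)ˣ}
    (hu : ∀ p : Arrows V, arrowCoord x' p = u p.2.1 * arrowCoord x p * ↑(u p.1)⁻¹) (v : V) :
    pathCoord D x' v = pathCoord D x v * (u v / u v₀) := by
  unfold pathCoord
  rw [← D.degree v (Finset.mem_univ v) _ u, ← Finset.prod_mul_distrib]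
  refine Finset.prod_congr rfl fun a ha => ?_
  rw [← mul_zpow]
  congr 1
  ext
  rw [coe_unitPart (hx' a (D.tree_subset ha)), hu, Units.val_mul,
    coe_unitPart (hx a (D.tree_subset ha)), div_eq_mul_inv, Units.val_mul]
  ring

/-- The arrows outside of a tree. -/
abbrev Cotree : Type := {a : Arrows V // a ∉ D.tree}

/-- The arrows in `S` outside of a tree. -/
def cotreeSupport : Finset (Cotree D) := S.subtype _

/-- The slice: the representations for which the arrows of the tree act as the identity, and the
other arrows in `S` are invertible. -/
def treeSlice : Scheme.{0} := (coordOpen (cotreeSupport D) : Scheme.{0})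

/-- The inclusion of the slice in an affine space. -/
def treeSliceι : treeSlice D ⟶ 𝔸(Cotree D; SpecC) := (coordOpen (cotreeSupport D)).ι

instance : IsOpenImmersion (treeSliceι D) :=
  inferInstanceAs (IsOpenImmersion (coordOpen (cotreeSupport D)).ι)

theorem range_treeSliceι : Set.range (treeSliceι D) = coordOpen (cotreeSupport D) :=
  Scheme.Opens.range_ι _

theorem treeSliceι_mem : ∀ y, treeSliceι D y ∈ coordOpen (cotreeSupport D) :=
  ι_mem (coordOpen (cotreeSupport D))

theorem isUnit_treeSliceι {a : Arrows V} (ha : a ∈ S) (ha' : a ∉ D.tree) :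
    IsUnit ((treeSliceι D).appTop (AffineSpace.coord SpecC ⟨a, ha'⟩)) :=
  forall_mem_coordOpen_iff.mp (treeSliceι_mem D) ⟨a, ha'⟩ (Finset.mem_subtype.mpr ha)

/-- The structure morphism of the slice. -/
def treeSliceStr : treeSlice D ⟶ SpecC := treeSliceι D ≫ 𝔸(Cotree D; SpecC) ↘ SpecC

/-- The inclusion of the slice in the space of representations. -/
def treeSliceIncl : treeSlice D ⟶ (repSpace V).X :=
  repHom (treeSliceStr D) fun a => if h : a ∈ D.tree then 1 else
    (treeSliceι D).appTop (AffineSpace.coord SpecC ⟨a, h⟩)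

theorem arrowCoord_treeSliceIncl_of_mem {a : Arrows V} (h : a ∈ D.tree) :
    arrowCoord (treeSliceIncl D) a = 1 := by
  rw [treeSliceIncl, arrowCoord_repHom, dif_pos h]

theorem arrowCoord_treeSliceIncl_of_notMem {a : Arrows V} (h : a ∉ D.tree) :
    arrowCoord (treeSliceIncl D) a = (treeSliceι D).appTop (AffineSpace.coord SpecC ⟨a, h⟩) := by
  rw [treeSliceIncl, arrowCoord_repHom, dif_neg h]

theorem treeSliceIncl_str : treeSliceIncl D ≫ (repSpace V).str = treeSliceStr D := repHom_str _ _

theorem isUnit_treeSliceIncl : ∀ p ∈ S, IsUnit (arrowCoord (treeSliceIncl D) p) := by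
  intro p hp
  by_cases h : p ∈ D.tree
  · rw [arrowCoord_treeSliceIncl_of_mem D h]; exact isUnit_one
  · rw [arrowCoord_treeSliceIncl_of_notMem D h]; exact isUnit_treeSliceι D hp h

theorem treeSliceIncl_mem : ∀ y, treeSliceIncl D y ∈ arrowOpen S :=
  forall_mem_arrowOpen_iff.mpr (isUnit_treeSliceIncl D)

/-- The normal form in affine space of a representation for which the arrows in `S` are
invertible. -/
def normHom {T : Scheme.{0}} (x : T ⟶ (repSpace V).X) : T ⟶ 𝔸(Cotree D; SpecC) :=
  AffineSpace.homOfVector (x ≫ (repSpace V).str) fun a =>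
    pathCoord D x a.1.1 * arrowCoord x a.1 * ↑(pathCoord D x a.1.2.1)⁻¹

theorem range_normHom {T : Scheme.{0}} {x : T ⟶ (repSpace V).X} (hx : ∀ y, x y ∈ arrowOpen S) :
    Set.range (normHom D x) ⊆ Set.range (treeSliceι D) := by
  rw [range_treeSliceι]
  rintro _ ⟨y, rfl⟩
  refine forall_mem_coordOpen_iff.mpr (fun a ha => ?_) y
  rw [normHom, AffineSpace.homOfVector_appTop_coord]
  exact ((Units.isUnit _).mul (forall_mem_arrowOpen_iff.mp hx _ (Finset.mem_subtype.mp ha))).mul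
    (Units.isUnit _)

/-- The normal form of a representation for which the arrows in `S` are invertible. -/
def treeNorm {T : Scheme.{0}} (x : T ⟶ (repSpace V).X) (hx : ∀ y, x y ∈ arrowOpen S) :
    T ⟶ treeSlice D :=
  IsOpenImmersion.lift (treeSliceι D) (normHom D x) (range_normHom D hx)

theorem treeNorm_ι {T : Scheme.{0}} (x : T ⟶ (repSpace V).X) (hx : ∀ y, x y ∈ arrowOpen S) :
    treeNorm D x hx ≫ treeSliceι D = normHom D x :=
  IsOpenImmersion.lift_fac _ _ _

theorem comp_treeNorm {T T' : Scheme.{0}} (f : T' ⟶ T) (x : T ⟶ (repSpace V).X)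
    (hx : ∀ y, x y ∈ arrowOpen S) (hx' : ∀ y, (f ≫ x) y ∈ arrowOpen S) :
    f ≫ treeNorm D x hx = treeNorm D (f ≫ x) hx' := by
  rw [← cancel_mono (treeSliceι D), Category.assoc, treeNorm_ι, treeNorm_ι]
  have hu := forall_mem_arrowOpen_iff.mp hx
  refine AffineSpace.hom_ext ?_ fun a => ?_
  · simp only [normHom, Category.assoc, AffineSpace.homOfVector_over]
  · rw [appTop_comp_apply, normHom, normHom, AffineSpace.homOfVector_appTop_coord,
      AffineSpace.homOfVector_appTop_coord, arrowCoord_comp, pathCoord_comp D f hu,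
      pathCoord_comp D f hu, map_mul, map_mul, ← map_inv]
    rfl

theorem treeNorm_congr {T : Scheme.{0}} (x x' : T ⟶ (repSpace V).X)
    (hx : ∀ y, x y ∈ arrowOpen S) (hx' : ∀ y, x' y ∈ arrowOpen S) (h : SameOrbit x x') :
    treeNorm D x hx = treeNorm D x' hx' := by
  rw [← cancel_mono (treeSliceι D), treeNorm_ι, treeNorm_ι]
  obtain ⟨h0, u, hu⟩ := sameOrbit_iff.mp h
  have h1 := pathCoord_smul D (forall_mem_arrowOpen_iff.mp hx) (forall_mem_arrowOpen_iff.mp hx') hu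
  refine AffineSpace.hom_ext ?_ fun a => ?_
  · rw [normHom, normHom, AffineSpace.homOfVector_over, AffineSpace.homOfVector_over, h0]
  · rw [normHom, normHom, AffineSpace.homOfVector_appTop_coord,
      AffineSpace.homOfVector_appTop_coord, hu, h1, h1]
    have e1 : ∀ w w' z z' z₀ : Γ(T, ⊤)ˣ, ∀ c : Γ(T, ⊤), (w : Γ(T, ⊤)) * c * ↑w'⁻¹ =
        ↑(w * (z / z₀)) * (z' * c * ↑z⁻¹) * ↑(w' * (z' / z₀))⁻¹ := by
      intro w w' z z' z₀ c
      have : w * w'⁻¹ = (w * (z / z₀)) * (z' * z⁻¹) * (w' * (z' / z₀))⁻¹ := by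
        exact mul_inv_eq_of_ratio w w' z z' z₀
      calc (w : Γ(T, ⊤)) * c * ↑w'⁻¹ = ↑(w * w'⁻¹) * c := by rw [Units.val_mul]; ring
        _ = _ := by rw [this]; push_cast; ring
    exact e1 _ _ _ _ _ _

theorem treeNorm_incl (h : ∀ y, treeSliceIncl D y ∈ arrowOpen S) :
    treeNorm D (treeSliceIncl D) h = 𝟙 _ := by
  rw [← cancel_mono (treeSliceι D), treeNorm_ι, Category.id_comp]
  refine AffineSpace.hom_ext ?_ fun a => ?_
  · rw [normHom, AffineSpace.homOfVector_over, treeSliceIncl_str]; rfl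
  · rw [normHom, AffineSpace.homOfVector_appTop_coord,
      pathCoord_eq_one D fun p hp => arrowCoord_treeSliceIncl_of_mem D hp,
      pathCoord_eq_one D fun p hp => arrowCoord_treeSliceIncl_of_mem D hp,
      arrowCoord_treeSliceIncl_of_notMem D a.2]
    simp

/-- The path products themselves are the gauge transformation from the normal form to `x`. -/
theorem sameOrbit_treeNorm {T : Scheme.{0}} (x : T ⟶ (repSpace V).X)
    (hx : ∀ y, x y ∈ arrowOpen S) : SameOrbit (treeNorm D x hx ≫ treeSliceIncl D) x := by
  have hu := forall_mem_arrowOpen_iff.mp hx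
  refine sameOrbit_iff.mpr ⟨?_, pathCoord D x, fun p => ?_⟩
  · rw [Category.assoc, treeSliceIncl_str, treeSliceStr, ← Category.assoc, treeNorm_ι, normHom,
      AffineSpace.homOfVector_over]
  · rw [arrowCoord_comp]
    by_cases hp : p ∈ D.tree
    · rw [arrowCoord_treeSliceIncl_of_mem D hp, map_one, pathCoord_arrow D hu hp]
      have := (pathCoord D x p.1).mul_inv
      linear_combination (-arrowCoord x p) * this
    · rw [arrowCoord_treeSliceIncl_of_notMem D hp, ← appTop_comp_apply, treeNorm_ι, normHom,
        AffineSpace.homOfVector_appTop_coord]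
      have h1 := (pathCoord D x p.1).mul_inv
      have h2 := (pathCoord D x p.2.1).mul_inv
      linear_combination (-arrowCoord x p) * h2 -
        (arrowCoord x p * (pathCoord D x p.2.1) * ↑(pathCoord D x p.2.1)⁻¹) * h1

end Slices

end

end AbelianQuiver

namespace AbelianQuiver

noncomputable section

/-! ### The moduli space for a generic stability function -/

section Moduli

variable {V : Type} [Quiver.{0} V] [Fintype V] [DecidableEq V] [∀ i j : V, Finite (i ⟶ j)]
  [Fintype (Arrows V)] [DecidableEq (Arrows V)] {Z : Stability V}

/-- Distinct non-empty sets of vertices have distinct slopes. -/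
def Stability.IsGeneric {V : Type} (Z : Stability V) : Prop :=
  ∀ I J : Finset V, I.Nonempty → J.Nonempty → I ≠ J → Z.slopeSet I ≠ Z.slopeSet J

theorem cross_charge_neg (hZ : Z.IsGeneric) {S : Finset (Arrows V)}
    (hS : S ∈ semistableSupports Z) {I : Finset V} (hI : I.Nonempty) (hI' : I ≠ Finset.univ)
    (hc : ClosedUnder (fun a : Arrows V => a.1) (fun a => a.2.1) S I) :
    cross (Z.charge I) (Z.charge Finset.univ) < 0 := by
  have hu : (Finset.univ : Finset V).Nonempty := hI.mono (Finset.subset_univ _)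
  rw [← Z.slopeSet_lt_iff hI hu]
  exact lt_of_le_of_ne (mem_semistableSupports.mp hS I hI hc) (hZ I _ hI hu hI')

/-- By genericity `I` and its complement would both have slope strictly below that of the whole
vertex set, although their charges add up to its charge. The supports may differ: equal supports
give connectivity, different ones give separatedness. -/
theorem not_closedUnder_compl (hZ : Z.IsGeneric) {S S' : Finset (Arrows V)}
    (hS : S ∈ semistableSupports Z) (hS' : S' ∈ semistableSupports Z) {I : Finset V}
    (hI : I.Nonempty) (hI' : I ≠ Finset.univ)
    (hc : ClosedUnder (fun a : Arrows V => a.1) (fun a => a.2.1) S I) :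
    ¬ ClosedUnder (fun a : Arrows V => a.1) (fun a => a.2.1) S' Iᶜ := by
  intro hc'
  have h1 := cross_charge_neg hZ hS hI hI' hc
  have h2 := cross_charge_neg hZ hS' (I := Iᶜ) (by
    rw [Finset.nonempty_iff_ne_empty, Ne, Finset.compl_eq_empty_iff]; exact hI') (by
    rw [Ne, Finset.compl_eq_univ_iff]; exact hI.ne_empty) hc'
  have h3 := Z.charge_union (disjoint_compl_right (a := I))
  rw [Finset.union_compl] at h3
  have h4 := cross_self (Z.charge (Finset.univ : Finset V))
  nth_rewrite 1 [h3] at h4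
  rw [cross_add_left] at h4
  linarith

/-- If no arrow of `S` crossed the boundary of `B`, both `B` and its complement would be closed. -/
theorem nonempty_treeData_of_isGeneric (hZ : Z.IsGeneric) {S : Finset (Arrows V)}
    (hS : S ∈ semistableSupports Z) (v₀ : V) :
    Nonempty (TreeData (fun a : Arrows V => a.1) (fun a => a.2.1) S v₀ Finset.univ) := by
  refine nonempty_treeData v₀ fun B hB hB' => ?_
  by_contra hcon
  push Not at hcon
  refine not_closedUnder_compl hZ hS hS hB hB' (fun a ha h => ?_) (fun a ha h => ?_)
  · exact (hcon a ha).1 h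
  · rw [Finset.mem_compl] at h ⊢
    exact (hcon a ha).2 h

variable (Z) in
/-- The index set of the charts of the moduli space. -/
def SupportIndex : Type := {S : Finset (Arrows V) // S ∈ semistableSupports Z}

instance : SemilatticeSup (SupportIndex Z) :=
  Subtype.semilatticeSup fun S S' hS _ =>
    semistableSupports_upper Z S hS (S ⊔ S') (le_sup_left (a := S))

instance : Finite (SupportIndex Z) :=
  inferInstanceAs (Finite {S : Finset (Arrows V) // S ∈ semistableSupports Z})

instance : IsOpenImmersion (semistableInclusion Z) :=
  inferInstanceAs (IsOpenImmersion (semistableOpens Z).ι)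

theorem range_semistableInclusion : Set.range (semistableInclusion Z) = semistableOpens Z :=
  Scheme.Opens.range_ι _

theorem arrowOpen_le {S : Finset (Arrows V)} (hS : S ∈ semistableSupports Z) :
    arrowOpen S ≤ semistableOpens Z := fun _ hx =>
  mem_semistableOpens.mpr (semistableSupports_upper Z S hS _
    (mem_coordOpen (n := Arrows V).mp hx))

theorem semistableInclusion_str :
    semistableInclusion Z ≫ (repSpace V).str = (semistableLocus Z).str := rfl

variable {v₀ : V} (D : ∀ S : SupportIndex Z,
  TreeData (fun a : Arrows V => a.1) (fun a => a.2.1) S.1 v₀ Finset.univ)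

theorem range_treeSliceIncl (S : SupportIndex Z) :
    Set.range (treeSliceIncl (D S)) ⊆ Set.range (semistableInclusion Z) := by
  rw [range_semistableInclusion]
  rintro _ ⟨y, rfl⟩
  exact arrowOpen_le S.2 (treeSliceIncl_mem (D S) y)

/-- The inclusion of a slice in the semistable locus. -/
def stableSliceIncl (S : SupportIndex Z) : treeSlice (D S) ⟶ (semistableLocus Z).X :=
  IsOpenImmersion.lift (semistableInclusion Z) (treeSliceIncl (D S)) (range_treeSliceIncl D S)

theorem stableSliceIncl_comp (S : SupportIndex Z) :
    stableSliceIncl D S ≫ semistableInclusion Z = treeSliceIncl (D S) :=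
  IsOpenImmersion.lift_fac _ _ _

theorem comp_mem_of_mem {T X Y : Scheme.{0}} {x : T ⟶ X} {i : X ⟶ Y} {U : Y.Opens}
    (hx : ∀ t, x t ∈ i ⁻¹ᵁ U) (t : T) : (x ≫ i) t ∈ U := by
  rw [Scheme.Hom.comp_apply]; exact hx t

/-- The slices of the semistable locus. -/
def sliceSystem : SliceSystem (orbitRel Z) (SupportIndex Z) where
  opens S := semistableInclusion Z ⁻¹ᵁ arrowOpen S.1
  opens_sup S S' := congrArg (fun U => semistableInclusion Z ⁻¹ᵁ U)
    (coordOpen_union (n := Arrows V) S.1 S'.1)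
  exists_mem x := by
    have hx : semistableInclusion Z x ∈ semistableOpens Z := by
      rw [← SetLike.mem_coe, ← range_semistableInclusion]; exact ⟨x, rfl⟩
    exact ⟨⟨_, mem_semistableOpens.mp hx⟩, mem_coordOpen (n := Arrows V).mpr subset_rfl⟩
  invariant S T x x' h t := by
    have := invariantSet_arrowOpen S.1 h t
    rwa [Scheme.Hom.comp_apply, Scheme.Hom.comp_apply] at this
  slice S := treeSlice (D S)
  incl S := stableSliceIncl D S
  incl_mem S y := by
    change semistableInclusion Z (stableSliceIncl D S y) ∈ arrowOpen S.1
    rw [← Scheme.Hom.comp_apply, stableSliceIncl_comp]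
    exact treeSliceIncl_mem (D S) y
  norm S T x hx := treeNorm (D S) (x ≫ semistableInclusion Z) (comp_mem_of_mem hx)
  comp_norm S T T' f x hx hx' := by
    have h : ∀ t, (f ≫ x ≫ semistableInclusion Z) t ∈ arrowOpen S.1 := by
      rw [← Category.assoc]; exact comp_mem_of_mem hx'
    rw [comp_treeNorm (D S) f _ _ h]
    congr 1
  norm_congr S T x x' hx hx' h := treeNorm_congr (D S) _ _ _ _ h
  norm_incl S := by
    refine Eq.trans ?_ (treeNorm_incl (D S) (treeSliceIncl_mem (D S)))
    congr 1
    exact stableSliceIncl_comp D S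
  rel_norm S T x hx := by
    change SameOrbit ((_ ≫ stableSliceIncl D S) ≫ semistableInclusion Z) (x ≫ semistableInclusion Z)
    rw [Category.assoc, stableSliceIncl_comp]
    exact sameOrbit_treeNorm (D S) _ _

/-- The underlying scheme of the moduli space. -/
def moduliScheme : Scheme.{0} := (sliceSystem D).glued

/-- The quotient map to the moduli space. -/
def moduliProj : (semistableLocus Z).X ⟶ moduliScheme D := (sliceSystem D).proj

/-- The charts of the moduli space. -/
def moduliChart (S : SupportIndex Z) : treeSlice (D S) ⟶ moduliScheme D := (sliceSystem D).ι S

instance (S : SupportIndex Z) : IsOpenImmersion (moduliChart D S) :=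
  inferInstanceAs (IsOpenImmersion ((sliceSystem D).ι S))

theorem isLocalQuotient_moduliProj : IsLocalQuotient (orbitRel Z) (moduliProj D) :=
  (sliceSystem D).isLocalQuotient

theorem stableSliceIncl_moduliProj (S : SupportIndex Z) :
    stableSliceIncl D S ≫ moduliProj D = moduliChart D S := (sliceSystem D).incl_proj S

theorem exists_moduliChart_eq (y : moduliScheme D) : ∃ S z, moduliChart D S z = y :=
  (sliceSystem D).exists_ι_eq y

theorem moduliProj_preimage (S : SupportIndex Z) :
    moduliProj D ⁻¹ᵁ (moduliChart D S).opensRange = semistableInclusion Z ⁻¹ᵁ arrowOpen S.1 :=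
  (sliceSystem D).proj_preimage_opensRange S

theorem opensRange_moduliChart_sup (S S' : SupportIndex Z) :
    (moduliChart D (S ⊔ S')).opensRange =
      (moduliChart D S).opensRange ⊓ (moduliChart D S').opensRange :=
  (sliceSystem D).opensRange_ι_sup S S'

theorem exists_moduliStr : ∃ f : moduliScheme D ⟶ SpecC,
    moduliProj D ≫ f = (semistableLocus Z).str := by
  refine ((isLocalQuotient_moduliProj D).existsUnique_factor _ fun T x x' h => ?_).exists
  rw [← semistableInclusion_str, ← Category.assoc, ← Category.assoc]
  exact h.1

/-- The structure morphism of the moduli space. -/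
def moduliStr : moduliScheme D ⟶ SpecC := (exists_moduliStr D).choose

theorem moduliProj_str : moduliProj D ≫ moduliStr D = (semistableLocus Z).str :=
  (exists_moduliStr D).choose_spec

theorem moduliChart_str (S : SupportIndex Z) : moduliChart D S ≫ moduliStr D =
    treeSliceStr (D S) := by
  rw [← stableSliceIncl_moduliProj, Category.assoc, moduliProj_str, ← semistableInclusion_str,
    ← Category.assoc, stableSliceIncl_comp, treeSliceIncl_str]

end Moduli

end

end AbelianQuiver

namespace AbelianQuiver

noncomputable section

/-! ### The moduli space is a variety -/

/-- Over a chart, which is a monomorphism, equal images mean equal normal forms, and every point is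
equivalent to its normal form. -/
theorem SliceSystem.rel_of_comp_proj_eq {X : Scheme.{0}} {r : PointRel X} {P : Type}
    [SemilatticeSup P] (D : SliceSystem r P) {a : P} {T : Scheme.{0}} {x x' : T ⟶ X}
    (hx : ∀ t, x t ∈ D.opens a) (h : x ≫ D.proj = x' ≫ D.proj) : r.rel x x' := by
  have hx' : ∀ t, x' t ∈ D.opens a := fun t => by
    rw [← D.proj_mem_iff, ← Scheme.Hom.comp_apply, ← h, Scheme.Hom.comp_apply, D.proj_mem_iff]
    exact hx t
  rw [D.comp_proj x hx, D.comp_proj x' hx', cancel_mono] at h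
  have h1 := D.rel_norm a x hx
  rw [h] at h1
  exact r.trans (r.symm h1) (D.rel_norm a x' hx')

/-- A change of gauge between two representations over an extension of rings is defined over the
smaller ring, if the representations satisfy opposite connectivity conditions. -/
theorem exists_gauge_of_injective {U A : Type*} [Fintype U] [DecidableEq U] {s t : A → U}
    {R K : Type*} [CommRing R] [CommRing K] {φ : R →+* K} (hφ : Function.Injective φ)
    {c c' : A → R} {u : U → Kˣ} (h : ∀ a, φ (c' a) = u (t a) * φ (c a) * ↑(u (s a))⁻¹)
    {S S' : Finset A} (hS : ∀ a ∈ S, IsUnit (c a)) (hS' : ∀ a ∈ S', IsUnit (c' a))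
    (hI : ∀ I : Finset U, I.Nonempty → I ≠ Finset.univ → ClosedUnder s t S I →
      ¬ ClosedUnder s t S' Iᶜ) (v₀ : U) :
    ∃ w : U → Rˣ, ∀ a, c' a = w (t a) * c a * ↑(w (s a))⁻¹ := by
  classical
  -- `Q i j` says that the ratio of the gauges at `i` and `j` is defined over `R`; the claim is that
  -- all ratios are.
  let Q : U → U → Prop := fun i j => ∃ r : R, φ r = ↑(u i * (u j)⁻¹)
  have htrans : ∀ {i j k}, Q i j → Q j k → Q i k := by
    rintro i j k ⟨r, hr⟩ ⟨r', hr'⟩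
    refine ⟨r * r', ?_⟩
    rw [map_mul, hr, hr', ← Units.val_mul]
    congr 1
    group
  have hQ : ∀ i j, Q i j := by
    intro i j
    let I : Finset U := {i | Q i j}
    have hmem : ∀ k, k ∈ I ↔ Q k j := fun k => by simp [I]
    by_contra hcon
    refine hI I ⟨j, (hmem j).mpr ⟨1, by simp⟩⟩ (fun h' => hcon ?_) (fun a ha h' => ?_)
      (fun a ha h' => ?_)
    · rw [← hmem, h']; exact Finset.mem_univ _
    -- Along an arrow of `S` the ratio of the gauges at target and source is `c' a / c a`, which
    -- lies in `R` because `c a` is a unit.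
    · rw [hmem] at h' ⊢
      obtain ⟨d, hd⟩ := hS a ha
      refine htrans ⟨c' a * ↑d⁻¹, ?_⟩ h'
      have h1 : φ (d : R) * φ (↑d⁻¹ : R) = 1 := by rw [← map_mul, d.mul_inv, map_one]
      rw [map_mul, h, ← hd, Units.val_mul]
      linear_combination (↑(u (t a)) * ↑(u (s a))⁻¹ : K) * h1
    -- Along an arrow of `S'` it is the inverse ratio `c a / c' a` that lies in `R`, so it is the
    -- complement that is closed.
    · rw [Finset.mem_compl, hmem] at h' ⊢
      refine fun h2 => h' (htrans ?_ h2)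
      obtain ⟨d, hd⟩ := hS' a ha
      refine ⟨c a * ↑d⁻¹, ?_⟩
      have h1 : φ (d : R) * φ (↑d⁻¹ : R) = 1 := by rw [← map_mul, d.mul_inv, map_one]
      have h3 := h a
      rw [← hd] at h3
      have h4 := (u (t a)).mul_inv
      have h5 := (u (s a)).mul_inv
      rw [map_mul, Units.val_mul]
      linear_combination (-(φ (c a)) * φ ↑d⁻¹) * h4 +
        (↑(u (s a)) * ↑(u (t a))⁻¹ : K) * h1 - (↑(u (s a)) * ↑(u (t a))⁻¹ * φ (↑d⁻¹ : R) : K) * h3 -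
        (↑(u (t a)) * ↑(u (t a))⁻¹ * φ (c a) * φ (↑d⁻¹ : R) : K) * h5
  choose r hr using hQ
  -- Dividing by the gauge at `v₀` does not change the action; the ratio and its inverse both come
  -- from `R`, so it is a unit there.
  let w : U → Rˣ := fun i => ⟨r i v₀, r v₀ i, hφ (by
      rw [map_mul, hr, hr, ← Units.val_mul, map_one, ← Units.val_one]; congr 1; group), hφ (by
      rw [map_mul, hr, hr, ← Units.val_mul, map_one, ← Units.val_one]; congr 1; group)⟩
  refine ⟨w, fun a => hφ ?_⟩
  have h1 : φ (w (t a) : R) = ↑(u (t a) * (u v₀)⁻¹) := hr _ _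
  have h2 : φ (↑(w (s a))⁻¹ : R) = ↑(u v₀ * (u (s a))⁻¹) := hr _ _
  rw [map_mul, map_mul, h1, h2, h, Units.val_mul, Units.val_mul]
  linear_combination (-(↑(u (t a)) * φ (c a) * ↑(u (s a))⁻¹) : K) * (u v₀).inv_mul

section Moduli

variable {V : Type} [Quiver.{0} V] [Fintype V] [DecidableEq V] [∀ i j : V, Finite (i ⟶ j)]
  [Fintype (Arrows V)] [DecidableEq (Arrows V)] {Z : Stability V}
  {v₀ : V} (D : ∀ S : SupportIndex Z,
  TreeData (fun a : Arrows V => a.1) (fun a => a.2.1) S.1 v₀ Finset.univ)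

theorem isAffineOpen_coordOpen {n : Type} [Fintype n] (S : Finset n) :
    IsAffineOpen (coordOpen S) := (isAffineOpen_top _).basicOpen _

instance (S : SupportIndex Z) : IsAffine (treeSlice (D S)) :=
  isAffineOpen_coordOpen _

instance (S : SupportIndex Z) : LocallyOfFiniteType (treeSliceStr (D S)) := by
  unfold treeSliceStr
  infer_instance

/-- The open cover of the moduli space by its charts. -/
def moduliCover : (moduliScheme D).OpenCover where
  I₀ := SupportIndex Z
  X S := treeSlice (D S)
  f S := moduliChart D S
  mem₀ := by
    rw [Scheme.presieve₀_mem_precoverage_iff]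
    exact ⟨fun y => exists_moduliChart_eq D y, inferInstance⟩

instance : LocallyOfFiniteType (moduliStr D) := by
  have h1 (S : SupportIndex Z) : IsAffine ((moduliCover D).X S) :=
    inferInstanceAs (IsAffine (treeSlice (D S)))
  have h2 : ∀ S, IsAffine ((moduliCover D).X S) := h1
  have h3 (S : SupportIndex Z) : LocallyOfFiniteType (moduliChart D S ≫ moduliStr D) := by
    rw [moduliChart_str]
    infer_instance
  exact HasRingHomProperty.of_source_openCover (P := @LocallyOfFiniteType) (moduliCover D)
    fun S => HasRingHomProperty.appTop (P := @LocallyOfFiniteType) _ (h3 S)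

instance : CompactSpace (moduliScheme D) := by
  refine ⟨?_⟩
  have h : (Set.univ : Set (moduliScheme D)) = ⋃ S, Set.range (moduliChart D S) := by
    refine (Set.eq_univ_of_forall fun y => ?_).symm
    obtain ⟨S, z, hz⟩ := exists_moduliChart_eq D y
    exact Set.mem_iUnion.mpr ⟨S, z, hz⟩
  rw [h]
  exact isCompact_iUnion fun S => isCompact_range (moduliChart D S).continuous

instance : QuasiCompact (moduliStr D) := (quasiCompact_iff_compactSpace _).mpr inferInstance

instance : QuasiSeparated (moduliStr D) := by
  have : IsLocallyNoetherian (moduliScheme D) :=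
    LocallyOfFiniteType.isLocallyNoetherian (moduliStr D)
  infer_instance

/-- The preimage of a chart is the locus where the arrows of one support are invertible, a principal
open subset of affine space. -/
theorem isAffineHom_moduliProj : IsAffineHom (moduliProj D) := by
  refine isAffineHom_of_forall_exists_isAffineOpen _ fun y => ?_
  obtain ⟨S, z, rfl⟩ := exists_moduliChart_eq D y
  refine ⟨(moduliChart D S).opensRange, ⟨z, rfl⟩, isAffineOpen_opensRange _, ?_⟩
  rw [moduliProj_preimage]
  refine IsAffineOpen.preimage_of_isOpenImmersion (Y := (repSpace V).X) (U := arrowOpen S.1)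
    (isAffineOpen_coordOpen (n := Arrows V) S.1) (semistableInclusion Z) ?_
  intro x hx
  have := arrowOpen_le S.2 hx
  rwa [← SetLike.mem_coe, ← range_semistableInclusion] at this

/-- A chart containing the image of the closed point contains the image of the whole local spectrum,
and the inclusion of its slice is a section. -/
theorem exists_lift_of_isLocalRing {R : Type} [CommRing R] [IsLocalRing R]
    (l : Spec (CommRingCat.of R) ⟶ moduliScheme D) :
    ∃ (S : SupportIndex Z) (x : Spec (CommRingCat.of R) ⟶ (semistableLocus Z).X),
      x ≫ moduliProj D = l ∧ ∀ t, (x ≫ semistableInclusion Z) t ∈ arrowOpen S.1 := by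
  obtain ⟨S, z, hz⟩ := exists_moduliChart_eq D (l (IsLocalRing.closedPoint R))
  have htop : l ⁻¹ᵁ (moduliChart D S).opensRange = ⊤ :=
    (IsLocalRing.closedPoint_mem_iff _).mp ⟨z, hz⟩
  have hr : Set.range l ⊆ Set.range (moduliChart D S) := by
    rintro _ ⟨y, rfl⟩
    have : y ∈ l ⁻¹ᵁ (moduliChart D S).opensRange := by rw [htop]; trivial
    exact this
  refine ⟨S, IsOpenImmersion.lift (moduliChart D S) l hr ≫ stableSliceIncl D S, ?_, ?_⟩
  · rw [Category.assoc, stableSliceIncl_moduliProj, IsOpenImmersion.lift_fac]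
  · rw [Category.assoc, stableSliceIncl_comp]
    exact SliceSystem.comp_mem _ (treeSliceIncl_mem _)

/-- Two extensions over a valuation ring lift to representations whose arrows in semistable supports
`S` and `S'` are invertible. Over the fraction field they differ by a gauge transformation, and by
`not_closedUnder_compl` that transformation can be chosen over the valuation ring. -/
theorem isSeparated_moduliStr (hZ : Z.IsGeneric) : IsSeparated (moduliStr D) := by
  refine IsSeparated.of_valuativeCriterion _ fun q => ⟨fun l l' => ?_⟩
  obtain ⟨S, x, hx, hxS⟩ := exists_lift_of_isLocalRing D l.l
  obtain ⟨S', x', hx', hxS'⟩ := exists_lift_of_isLocalRing D l'.l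
  let j : Spec (CommRingCat.of q.K) ⟶ Spec (CommRingCat.of q.R) :=
    Spec.map (CommRingCat.ofHom (algebraMap q.R q.K))
  have hj : Function.Injective j.appTop.hom := by
    intro f g hfg
    have h1 : ∀ f, (Scheme.ΓSpecIso (CommRingCat.of q.K)).hom (j.appTop f) =
        algebraMap q.R q.K ((Scheme.ΓSpecIso (CommRingCat.of q.R)).hom f) := fun f => by
      have := Scheme.ΓSpecIso_naturality (CommRingCat.ofHom (algebraMap q.R q.K))
      exact congrArg (fun k => k f) this
    have h2 := (h1 f).symm.trans ((congrArg _ hfg).trans (h1 g))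
    have h3 := IsFractionRing.injective q.R q.K h2
    have h4 := congrArg (Scheme.ΓSpecIso (CommRingCat.of q.R)).inv h3
    rwa [Iso.hom_inv_id_apply, Iso.hom_inv_id_apply] at h4
  have hrel : (orbitRel Z).rel (j ≫ x) (j ≫ x') := by
    refine (sliceSystem D).rel_of_comp_proj_eq (a := S) (fun t => ?_) ?_
    · have := SliceSystem.comp_mem j hxS t
      rw [← Category.assoc, Scheme.Hom.comp_apply] at this
      exact this
    · change (j ≫ x) ≫ moduliProj D = (j ≫ x') ≫ moduliProj D
      rw [Category.assoc, Category.assoc, hx, hx']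
      exact l.fac_left.trans l'.fac_left.symm
  obtain ⟨-, u, hu⟩ := sameOrbit_iff.mp hrel
  have hu' : ∀ p : Arrows V, j.appTop.hom (arrowCoord (x' ≫ semistableInclusion Z) p) =
      u p.2.1 * j.appTop.hom (arrowCoord (x ≫ semistableInclusion Z) p) * ↑(u p.1)⁻¹ := by
    intro p
    have := hu p
    rw [Category.assoc, Category.assoc, arrowCoord_comp, arrowCoord_comp] at this
    exact this
  obtain ⟨w, hw⟩ := exists_gauge_of_injective hj hu' (forall_mem_arrowOpen_iff.mp hxS)
    (forall_mem_arrowOpen_iff.mp hxS')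
    (fun I hI hI' hc => not_closedUnder_compl hZ S.2 S'.2 hI hI' hc) v₀
  have hrel' : (orbitRel Z).rel x x' := by
    refine sameOrbit_iff.mpr ⟨?_, w, hw⟩
    rw [Category.assoc, Category.assoc, semistableInclusion_str, ← moduliProj_str D,
      ← Category.assoc, ← Category.assoc, hx, hx', l.fac_right, l'.fac_right]
  ext1
  rw [← hx, ← hx']
  exact (isLocalQuotient_moduliProj D).invariant hrel'

/-- The moduli space as a variety. -/
def moduliVariety (hZ : Z.IsGeneric) : Variety :=
  have := isSeparated_moduliStr D hZ
  { X := moduliScheme D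
    str := moduliStr D }

theorem isGITQuotient_moduliProj (hZ : Z.IsGeneric) :
    IsGITQuotient Z (moduliVariety D hZ) (moduliProj D) :=
  IsLocalQuotient.isGITQuotient (M := moduliVariety D hZ) (isLocalQuotient_moduliProj D)
    (isAffineHom_moduliProj D) (moduliProj_str D)

end Moduli

end

end AbelianQuiver

namespace AbelianQuiver

noncomputable section

/-! ### The motive of the moduli space -/

theorem sum_pow_card_of_subset {n R : Type*} [Fintype n] [DecidableEq n] [CommRing R] (x : R)
    (S : Finset n) : ∑ T ∈ {T : Finset n | S ⊆ T}, x ^ T.card =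
      x ^ S.card * (x + 1) ^ (Fintype.card n - S.card) := by
  have h := Finset.prod_add (fun _ : n => x) (fun i => if i ∈ S then 0 else 1) Finset.univ
  have h1 : ∏ i : n, (x + if i ∈ S then 0 else 1) =
      x ^ S.card * (x + 1) ^ (Fintype.card n - S.card) := by
    rw [← Finset.prod_mul_prod_compl S, Finset.prod_congr rfl (g := fun _ => x)
      (fun i hi => by rw [if_pos hi, add_zero]), Finset.prod_congr (s₁ := Sᶜ) rfl
      (g := fun _ => x + 1) (fun i hi => by rw [if_neg (Finset.mem_compl.mp hi)]),
      Finset.prod_const, Finset.prod_const, Finset.card_compl]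
  rw [← h1, h, Finset.powerset_univ, Finset.sum_filter]
  refine Finset.sum_congr rfl fun T _ => ?_
  rw [Finset.prod_const]
  split_ifs with hT
  · rw [Finset.prod_eq_one, mul_one]
    intro i hi
    rw [if_neg fun hiS => (Finset.mem_sdiff.mp hi).2 (hT hiS)]
  · obtain ⟨i, hi, hi'⟩ := Finset.not_subset.mp hT
    symm
    refine mul_eq_zero_of_right _ (Finset.prod_eq_zero (i := i) ?_ ?_)
    · exact Finset.mem_sdiff.mpr ⟨Finset.mem_univ i, hi'⟩
    · exact if_pos hi

theorem cls_coordOpen {n : Type} [Fintype n] (S : Finset n) :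
    K0.cls ((Variety.affine n).ofOpens (coordOpen S)) =
      (K0.lefschetz - 1) ^ S.card * K0.lefschetz ^ (Fintype.card n - S.card) := by
  classical
  have h : coordOpen S = coordOpens ({T : Finset n | S ⊆ T} : Finset (Finset n)) := by
    ext x
    refine mem_coordOpen.trans (Iff.trans ?_ (mem_coordOpens_of_upper ?_).symm)
    · simp
    · intro T hT T' hT'
      simp only [Finset.mem_filter_univ] at hT ⊢
      exact hT.trans hT'
  rw [h]
  refine (cls_coordOpens _ ?_).trans ?_
  · intro T hT T' hT'
    simp only [Finset.mem_filter_univ] at hT ⊢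
    exact hT.trans hT'
  · rw [sum_pow_card_of_subset, sub_add_cancel]

theorem K0.cls_ofOpens_opensRange {X Y : Variety} (j : Y.X ⟶ X.X) [IsOpenImmersion j]
    (hj : j ≫ X.str = Y.str) : K0.cls (X.ofOpens j.opensRange) = K0.cls Y := by
  refine (K0.cls_eq_of_iso (Y := X.ofOpens j.opensRange) j.isoOpensRange ?_).symm
  change j.isoOpensRange.hom ≫ j.opensRange.ι ≫ X.str = Y.str
  rw [← Category.assoc, Scheme.Hom.isoOpensRange_hom_ι, hj]

/-- Proportionality of classes can be checked on a family of open subsets that is closed under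
finite intersections. -/
theorem K0.cls_ofOpens_iSup {X Y : Variety} {P ι : Type*} [SemilatticeSup P] {U : P → X.X.Opens}
    {W : P → Y.X.Opens} (hU : ∀ a b, U (a ⊔ b) = U a ⊓ U b) (hW : ∀ a b, W (a ⊔ b) = W a ⊓ W b)
    {c : K0} (h : ∀ a, K0.cls (X.ofOpens (U a)) = c * K0.cls (Y.ofOpens (W a)))
    (s : Finset ι) (f : ι → P) :
    K0.cls (X.ofOpens (⨆ i ∈ s, U (f i))) = c * K0.cls (Y.ofOpens (⨆ i ∈ s, W (f i))) := by
  classical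
  induction s using Finset.induction_on generalizing f with
  | empty => simp only [Finset.notMem_empty, iSup_false, iSup_bot, cls_ofOpens_bot, mul_zero]
  | insert a s ha ih =>
    rw [Finset.iSup_insert, Finset.iSup_insert]
    have h1 := K0.cls_ofOpens_sup X (U (f a)) (⨆ i ∈ s, U (f i))
    have h2 := K0.cls_ofOpens_sup Y (W (f a)) (⨆ i ∈ s, W (f i))
    -- The family is closed under intersections, so the induction hypothesis also covers the overlap
    -- of `U (f a)` with the remaining union.
    have h3 := ih fun i => f a ⊔ f i
    simp only [hU, hW, ← inf_iSup_eq] at h3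
    have h4 := ih f
    have h5 := h (f a)
    linear_combination h1 + h5 + h4 - h3 - c * h2

/-- The dimension of a space is bounded by the dimensions of the sets of an open cover. -/
theorem topologicalKrullDim_le_of_forall_exists {X : Scheme.{0}} {d : WithBot ℕ∞}
    (h : ∀ x : X, ∃ (Y : Scheme.{0}) (f : Y ⟶ X), IsOpenImmersion f ∧ x ∈ Set.range f ∧
      topologicalKrullDim Y ≤ d) : topologicalKrullDim X ≤ d := by
  rw [topologicalKrullDim, Order.krullDim_eq_iSup_coheight]
  refine iSup_le fun C => ?_
  obtain ⟨x, hx⟩ := C.2.nonempty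
  obtain ⟨Y, f, hf, ⟨y, rfl⟩, hd⟩ := h x
  have hC := (TopologicalSpace.IrreducibleCloseds.orderIsoOfIsOpenEmbedding f
    f.isOpenEmbedding).apply_symm_apply ⟨C, ⟨y, hx⟩⟩
  have hC' := congrArg Subtype.val hC
  change TopologicalSpace.IrreducibleCloseds.map f f.isOpenEmbedding.continuous _ = C at hC'
  rw [← hC', f.isOpenEmbedding.coheight_map]
  exact (Order.coheight_le_krullDim _).trans hd

section Moduli

variable {V : Type} [Quiver.{0} V] [Fintype V] [DecidableEq V] [∀ i j : V, Finite (i ⟶ j)]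
  [Fintype (Arrows V)] [DecidableEq (Arrows V)] {Z : Stability V}
  {v₀ : V}

section Slice

variable {S : Finset (Arrows V)} (D : TreeData (fun a : Arrows V => a.1) (fun a => a.2.1) S v₀
  Finset.univ)

theorem card_cotree : Fintype.card (Cotree D) + D.tree.card = Fintype.card (Arrows V) := by
  rw [Fintype.card_subtype_compl, Fintype.card_coe]
  exact Nat.sub_add_cancel (Finset.card_le_univ _)

theorem card_cotreeSupport : (cotreeSupport D).card + D.tree.card = S.card := by
  rw [cotreeSupport, Finset.card_subtype, ← Finset.card_sdiff_add_card_eq_card D.tree_subset]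
  congr 2
  ext a
  simp

/-- Passing to the slice normalizes the tree arrows, each of which ranges over a punctured line. -/
theorem cls_arrowOpen : K0.cls ((repSpace V).ofOpens (arrowOpen S)) =
    (K0.lefschetz - 1) ^ D.tree.card *
      K0.cls ((Variety.affine (Cotree D)).ofOpens (coordOpen (cotreeSupport D))) := by
  refine (cls_coordOpen (n := Arrows V) S).trans ?_
  rw [cls_coordOpen, ← mul_assoc, ← pow_add]
  have h1 := card_cotree D
  have h2 := card_cotreeSupport D
  congr 2 <;> omega

end Slice

variable (D : ∀ S : SupportIndex Z,
  TreeData (fun a : Arrows V => a.1) (fun a => a.2.1) S.1 v₀ Finset.univ) (hZ : Z.IsGeneric)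

/-- The charts of the moduli space, as morphisms of varieties. -/
def moduliVarietyChart (S : SupportIndex Z) :
    ((Variety.affine (Cotree (D S))).ofOpens (coordOpen (cotreeSupport (D S)))).X ⟶
      (moduliVariety D hZ).X := moduliChart D S

instance (S : SupportIndex Z) : IsOpenImmersion (moduliVarietyChart D hZ S) :=
  inferInstanceAs (IsOpenImmersion (moduliChart D S))

theorem cls_opensRange_moduliVarietyChart (S : SupportIndex Z) :
    K0.cls ((moduliVariety D hZ).ofOpens (moduliVarietyChart D hZ S).opensRange) =
      K0.cls ((Variety.affine (Cotree (D S))).ofOpens (coordOpen (cotreeSupport (D S)))) :=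
  K0.cls_ofOpens_opensRange _ (moduliChart_str D S)

/-- Spanning trees all have the same number of arrows, so the factor is the same on every chart, and
charts are closed under intersection. Inclusion–exclusion then suffices. -/
theorem cls_semistableLocus_eq_mul :
    K0.cls (semistableLocus Z) =
      (K0.lefschetz - 1) ^ (Fintype.card V - 1) * K0.cls (moduliVariety D hZ) := by
  have := Fintype.ofFinite (SupportIndex Z)
  have h := K0.cls_ofOpens_iSup (X := repSpace V) (Y := moduliVariety D hZ)
    (U := fun S : SupportIndex Z => arrowOpen S.1)
    (W := fun S => (moduliVarietyChart D hZ S).opensRange)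
    (c := (K0.lefschetz - 1) ^ (Fintype.card V - 1))
    (fun S S' => coordOpen_union (n := Arrows V) S.1 S'.1)
    (opensRange_moduliChart_sup D) (fun S => by
      rw [cls_opensRange_moduliVarietyChart, cls_arrowOpen (D S)]
      have := (D S).card_tree
      rw [Finset.card_univ] at this
      rw [← this, Nat.add_sub_cancel]) Finset.univ id
  have h1 : ⨆ S ∈ (Finset.univ : Finset (SupportIndex Z)), arrowOpen (id S).1 =
      semistableOpens Z := by
    refine le_antisymm (iSup₂_le fun S _ => arrowOpen_le S.2) fun x hx => ?_
    have hx' := mem_semistableOpens.mp hx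
    refine TopologicalSpace.Opens.mem_iSup.mpr ⟨⟨_, hx'⟩, ?_⟩
    refine TopologicalSpace.Opens.mem_iSup.mpr ⟨Finset.mem_univ _, ?_⟩
    exact mem_coordOpen (n := Arrows V).mpr subset_rfl
  have h2 : ⨆ S ∈ (Finset.univ : Finset (SupportIndex Z)),
      (moduliVarietyChart D hZ (id S)).opensRange = ⊤ := by
    refine top_le_iff.mp fun y _ => ?_
    obtain ⟨S, z, hz⟩ := exists_moduliChart_eq D y
    refine TopologicalSpace.Opens.mem_iSup.mpr ⟨S, ?_⟩
    exact TopologicalSpace.Opens.mem_iSup.mpr ⟨Finset.mem_univ _, z, hz⟩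
  rw [h1, h2, K0.cls_ofOpens_top] at h
  exact h

theorem topologicalKrullDim_treeSlice (S : SupportIndex Z) :
    topologicalKrullDim (treeSlice (D S)) =
      ((Fintype.card (Arrows V) - (Fintype.card V - 1) : ℕ) : WithBot ℕ∞) := by
  refine (topologicalKrullDim_opens (fun x hx => mem_coordOpen.mpr
    ((Finset.subset_univ _).trans (mem_coordOpen.mp hx)))).trans ?_
  have h1 := card_cotree (D S)
  have h2 := (D S).card_tree
  rw [Finset.card_univ] at h2
  congr 2
  omega

/-- Every chart is open in the affine space of the arrows outside a spanning tree and contains its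
torus. At least one chart is needed, hence the hypothesis `h`. -/
theorem dimension_moduliVariety (h : (semistableSupports Z).Nonempty) :
    dimension (moduliVariety D hZ) + (Fintype.card V - 1) = Fintype.card (Arrows V) := by
  have h0 : topologicalKrullDim (moduliScheme D) =
      ((Fintype.card (Arrows V) - (Fintype.card V - 1) : ℕ) : WithBot ℕ∞) := by
    refine le_antisymm (topologicalKrullDim_le_of_forall_exists fun y => ?_) ?_
    · obtain ⟨S, z, hz⟩ := exists_moduliChart_eq D y
      exact ⟨_, moduliChart D S, inferInstance, ⟨z, hz⟩, (topologicalKrullDim_treeSlice D S).le⟩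
    · obtain ⟨S, hS⟩ := h
      let S' : SupportIndex Z := ⟨S, hS⟩
      rw [← topologicalKrullDim_treeSlice D S']
      exact topologicalKrullDim_le_of_isOpenImmersion (moduliChart D S')
  have h1 : dimension (moduliVariety D hZ) = Fintype.card (Arrows V) - (Fintype.card V - 1) := by
    rw [dimension]
    change ((topologicalKrullDim (moduliScheme D)).unbotD 0).toNat = _
    rw [h0]
    rfl
  obtain ⟨S, hS⟩ := h
  have h2 := (D ⟨S, hS⟩).card_tree
  have h3 := card_cotree (D ⟨S, hS⟩)
  rw [Finset.card_univ] at h2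
  omega

/-- The locus has the extra factor `(𝕃 - 1)^(|V| - 1)` and the matching extra dimension, which
together give `gam ^ (|V| - 1)`. The torus has `gam ^ |V|`, so one `gam` remains. -/
theorem virtualMotive_moduliVariety :
    virtualMotive (moduliVariety D hZ) = gam • stackMotive Z := by
  have hcls := congrArg K0.toMot (cls_semistableLocus_eq_mul D hZ)
  rw [map_mul, toMot_lefschetz_sub_one_pow] at hcls
  have hg := gam_ne_zero
  have hq := qh_ne_zero
  have hL := qh_sq_sub_one_ne_zero
  rw [stackMotive, virtualMotive_torus, inverse_algebraMap (pow_ne_zero _ hg), virtualMotive_eq,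
    virtualMotive_eq, hcls, Algebra.smul_def]
  obtain ⟨k, hk⟩ : ∃ k, Fintype.card V = k + 1 :=
    ⟨Fintype.card V - 1, (Nat.sub_add_cancel (Fintype.card_pos_iff.mpr ⟨v₀⟩)).symm⟩
  -- Without semistable points the dimension formula fails, but the class of the quotient is zero in
  -- `𝒱`, where `𝕃 - 1` is invertible.
  rcases (semistableSupports Z).eq_empty_or_nonempty with h | h
  · have h1 : K0.cls (semistableLocus Z) = 0 := by rw [cls_semistableLocus, h, Finset.sum_empty]
    have h2 : K0.toMot (K0.cls (moduliVariety D hZ)) = 0 := by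
      rw [h1, map_zero] at hcls
      exact (isUnit_algebraMap (pow_ne_zero _ hL)).mul_right_eq_zero.mp hcls.symm
    rw [h2]
    ring
  · have hd := dimension_moduliVariety D hZ h
    rw [dimension_semistableLocus h, ← hd, hk, Nat.add_sub_cancel]
    have key : (qh⁻¹) ^ dimension (moduliVariety D hZ) = gam *
        ((qh⁻¹) ^ (dimension (moduliVariety D hZ) + k) * (qh ^ 2 - 1) ^ k * (gam ^ (k + 1))⁻¹) := by
      rw [gam_eq, mul_pow, pow_add, pow_succ qh⁻¹ k, pow_succ (qh ^ 2 - 1) k]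
      simp only [inv_pow]
      field_simp
    rw [key]
    simp only [map_mul]
    ring

end Moduli

end

end AbelianQuiver

namespace AbelianQuiver

noncomputable section

/-! ### Rays -/

section Rays

variable {V : Type} {Z : Stability V} {l : Set ℂ}

theorem IsRay.add_mem (hl : IsRay l) {z w : ℂ} (hz : z ∈ l) (hw : w ∈ l) : z + w ∈ l := by
  obtain ⟨u, -, rfl⟩ := hl
  obtain ⟨t, ht, rfl⟩ := hz
  obtain ⟨t', ht', rfl⟩ := hw
  exact ⟨t + t', add_pos ht ht', by push_cast; ring⟩

theorem zero_notMem_upperHalf : (0 : ℂ) ∉ upperHalf := by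
  rw [mem_upperHalf_iff]; simp

theorem IsRay.zero_notMem (hl : IsRay l) : (0 : ℂ) ∉ l := by
  obtain ⟨u, hu, rfl⟩ := hl
  rintro ⟨t, ht, h⟩
  rcases mul_eq_zero.mp h.symm with h | h
  · exact ht.ne' (by exact_mod_cast h)
  · exact zero_notMem_upperHalf (h ▸ hu)

theorem toInt_add (α β : V →₀ ℕ) : toInt (α + β) = toInt α + toInt β :=
  Finsupp.mapRange_add (fun _ _ => Nat.cast_add _ _) _ _

theorem coeff_raySeries_of_mem (c : OnRay Z l → Mot) (α : OnRay Z l) :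
    MvPowerSeries.coeff α.1 (raySeries Z l c) = (multiFactorial α.1 : HalfField)⁻¹ • c α :=
  dif_pos α.2

theorem coeff_raySeries_of_notMem (c : OnRay Z l → Mot) {α : V →₀ ℕ} (h : Z.Z (toInt α) ∉ l) :
    MvPowerSeries.coeff α (raySeries Z l c) = 0 := dif_neg h

theorem coeff_zero_raySeries (hl : IsRay l) (c : OnRay Z l → Mot) :
    MvPowerSeries.constantCoeff (raySeries Z l c) = 0 := by
  refine coeff_raySeries_of_notMem c ?_
  have : toInt (0 : V →₀ ℕ) = 0 := Finsupp.mapRange_zero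
  rw [this, map_zero]
  exact hl.zero_notMem

theorem coeff_smul_series (x : HalfField) (F : MvPowerSeries V Mot) (α : V →₀ ℕ) :
    MvPowerSeries.coeff α (x • F) = x • MvPowerSeries.coeff α F := rfl

theorem multiFactorial_ne_zero (α : V →₀ ℕ) : (multiFactorial α : HalfField) ≠ 0 := by
  have : CharZero HalfField := inferInstanceAs (CharZero (RatFunc ℚ))
  exact Nat.cast_ne_zero.mpr (Finset.prod_ne_zero_iff.mpr fun i _ => Nat.factorial_ne_zero _)

theorem raySeries_injective : Function.Injective (raySeries Z l) := by
  intro c c' h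
  funext α
  have h1 := congrArg (MvPowerSeries.coeff α.1) h
  rw [coeff_raySeries_of_mem, coeff_raySeries_of_mem] at h1
  have h2 := congrArg (fun y => (multiFactorial α.1 : HalfField) • y) h1
  simpa only [smul_inv_smul₀ (multiFactorial_ne_zero α.1)] using h2

/-- A power series supported on a ray is of the form `raySeries`. -/
theorem exists_raySeries_eq {F : MvPowerSeries V Mot}
    (h : ∀ α, Z.Z (toInt α) ∉ l → MvPowerSeries.coeff α F = 0) :
    ∃ c : OnRay Z l → Mot, raySeries Z l c = F := by
  refine ⟨fun α => (multiFactorial α.1 : HalfField) • MvPowerSeries.coeff α.1 F, ?_⟩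
  ext α
  by_cases hα : Z.Z (toInt α) ∈ l
  · rw [coeff_raySeries_of_mem _ ⟨α, hα⟩, inv_smul_smul₀ (multiFactorial_ne_zero α)]
  · rw [coeff_raySeries_of_notMem _ hα, h α hα]

/-- The solution is `gam` times the logarithm of the left-hand side. It is supported on the ray
because the ray is closed under addition. -/
theorem existsUnique_isAbelianInvariant [Quiver.{0} V] [∀ i j : V, Finite (i ⟶ j)]
    (hl : IsRay l) : ∃! g : OnRay Z l → Mot, IsAbelianInvariant Z l g := by
  let f : MvPowerSeries V Mot := raySeries Z l fun α => fInv Z α.1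
  have hf : MvPowerSeries.constantCoeff f = 0 := coeff_zero_raySeries hl _
  obtain ⟨h0, hexp⟩ := exp_subst_log_subst hf
  have hsupp : ∀ α, Z.Z (toInt α) ∉ l →
      MvPowerSeries.coeff α ((PowerSeries.log Mot).subst f : MvPowerSeries V Mot) = 0 :=
    coeff_subst_eq_zero hf (P := {α | Z.Z (toInt α) ∈ l})
      (fun α hα β hβ => by
        rw [Set.mem_ofPred_eq, toInt_add, map_add]
        exact hl.add_mem hα hβ)
      (fun α hα => coeff_raySeries_of_notMem _ hα) _ (by simp)
  obtain ⟨g, hg⟩ := exists_raySeries_eq (F := gam • (PowerSeries.log Mot).subst f)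
    fun α hα => by rw [coeff_smul_series, hsupp α hα, smul_zero]
  refine ⟨g, ?_, fun g' hg' => raySeries_injective ?_⟩
  · change 1 + f = (PowerSeries.exp Mot).subst (gam⁻¹ • raySeries Z l g)
    rw [hg, inv_smul_smul₀ gam_ne_zero, hexp]
  · have h1 : gam⁻¹ • raySeries Z l g' = (PowerSeries.log Mot).subst f := by
      refine exp_subst_injective ?_ h0 (hg'.symm.trans hexp.symm)
      have := coeff_zero_raySeries hl g'
      rw [← MvPowerSeries.coeff_zero_eq_constantCoeff_apply] at this ⊢
      rw [coeff_smul_series, this, smul_zero]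
    rw [hg, ← h1, smul_inv_smul₀ gam_ne_zero]

end Rays

/-! ### Subsets of the split quiver -/

section Split

variable {V : Type} [Quiver.{0} V]

/-- The map from the vertices of `Q(α)` to the vertices of `Q`. -/
def Split.base {α : V →₀ ℕ} : Split α → V := Sigma.fst

theorem Stability.slopeSet_congr {U U' : Type} {Z : Stability U} {Z' : Stability U'}
    {I : Finset U} {I' : Finset U'} (h : Z.charge I = Z'.charge I') :
    Z.slopeSet I = Z'.slopeSet I' := by
  rw [Stability.charge, Stability.charge] at h
  rw [Stability.slopeSet, Stability.slopeSet, Stability.slope, Stability.slope, h]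

theorem Stability.charge_split (Z : Stability V) (α : V →₀ ℕ) (I : Finset (Split α)) :
    (Z.split α).charge I = ∑ u ∈ I, Z.Z (Finsupp.single (Split.base u) 1) := by
  rw [Stability.charge_eq_sum]
  refine Finset.sum_congr rfl fun u _ => ?_
  exact congrArg Z.Z Finsupp.mapDomain_single

theorem toInt_fiberCount {U : Type} (p : U → V) (W : Finset U) :
    toInt (fiberCount p W) = ∑ u ∈ W, Finsupp.single (p u) 1 := by
  classical
  induction W using Finset.induction_on with
  | empty => exact Finsupp.mapRange_zero
  | insert v W hv ih =>
    rw [fiberCount_insert p hv, toInt_add, ih, Finset.sum_insert hv, add_comm]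
    congr 1
    exact Finsupp.mapRange_single

theorem Stability.charge_split_eq (Z : Stability V) (α : V →₀ ℕ) (I : Finset (Split α)) :
    (Z.split α).charge I = Z.Z (toInt (fiberCount Split.base I)) := by
  rw [Stability.charge_split, toInt_fiberCount, map_sum]

theorem fiberCount_apply {U : Type} (p : U → V) (W : Finset U) (i : V) [DecidableEq V] :
    fiberCount p W i = (W.filter fun u => p u = i).card := by
  rw [fiberCount, Finsupp.finsetSum_apply, Finset.card_filter]
  exact Finset.sum_congr rfl fun u _ => Finsupp.single_apply

theorem fiberCount_base_univ (α : V →₀ ℕ) [Fintype (Split α)] :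
    fiberCount Split.base (Finset.univ : Finset (Split α)) = α := by
  classical
  ext i
  rw [fiberCount_apply]
  let e : Fin (α i) ≃ {u : Split α // Split.base u = i} :=
    { toFun k := ⟨⟨i, k⟩, rfl⟩
      invFun u := Fin.cast (congrArg α u.2) u.1.2
      left_inv k := rfl
      right_inv := by rintro ⟨⟨j, k⟩, rfl⟩; rfl }
  rw [← Fintype.card_subtype, ← Fintype.card_congr e, Fintype.card_fin]

/-- Any vertex set `W` of `Q(α)` spans a copy of `Q(β)`, where `β` is the dimension vector of `W`.
This lets all the relevant `f_Z(β)` be computed inside one quiver, as in `fInv_fiberCount`. -/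
theorem exists_split_embedding {U : Type} (p : U → V) (W : Finset U) :
    ∃ φ : Split (fiberCount p W) ↪ U, (∀ u, u ∈ Set.range φ ↔ u ∈ W) ∧ p ∘ φ = Split.base := by
  classical
  let e : ∀ i, Fin (fiberCount p W i) ≃ {u : W // p u = i} := fun i =>
    (Fintype.equivFinOfCardEq (by
      rw [fiberCount_apply, Fintype.card_subtype]
      refine Finset.card_bij (fun u _ => u.1) (fun u hu => ?_) (fun u _ v _ h => Subtype.ext h)
        (fun u hu => ?_)
      · exact Finset.mem_filter.mpr ⟨u.2, (Finset.mem_filter.mp hu).2⟩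
      · obtain ⟨h, h'⟩ := Finset.mem_filter.mp hu
        exact ⟨⟨u, h⟩, Finset.mem_filter.mpr ⟨Finset.mem_univ _, h'⟩, rfl⟩)).symm
  let E : Split (fiberCount p W) ≃ W :=
    (Equiv.sigmaCongrRight e).trans (Equiv.sigmaFiberEquiv fun u : W => p u)
  refine ⟨E.toEmbedding.trans (Function.Embedding.subtype _), fun u => ?_, ?_⟩
  · constructor
    · rintro ⟨x, rfl⟩
      exact (E x).2
    · exact fun hu => ⟨E.symm ⟨u, hu⟩, congrArg Subtype.val (E.apply_symm_apply _)⟩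
  · funext x
    exact (e x.1 x.2).2

/-- Counting supports is compatible with embeddings of sets of vertices over the vertices of the
quiver. -/
theorem weightedCount_embedding {k : Type*} [CommRing k] (a b x : k) {U U' : Type}
    [DecidableEq U] [DecidableEq U'] {p : U → V} {p' : U' → V} (φ : U' ↪ U) (hφ : p ∘ φ = p')
    [Fintype (Σ u v : U, (p u ⟶ p v))] [DecidableEq (Σ u v : U, (p u ⟶ p v))]
    [Fintype (Σ u v : U', (p' u ⟶ p' v))] [DecidableEq (Σ u v : U', (p' u ⟶ p' v))]
    {P : Finset U → Prop} {P' : Finset U' → Prop} {W : Finset U'}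
    (hP : ∀ I ⊆ W, I.Nonempty → (P' I ↔ P (I.map φ))) :
    weightedCount (fun a : Σ u v : U, (p u ⟶ p v) => a.1) (fun a => a.2.1) a b x P (W.map φ) =
      weightedCount (fun a : Σ u v : U', (p' u ⟶ p' v) => a.1) (fun a => a.2.1) a b x P' W := by
  subst hφ
  let ψ : (Σ u v : U', ((p ∘ φ) u ⟶ (p ∘ φ) v)) ↪ (Σ u v : U, (p u ⟶ p v)) :=
    { toFun a := ⟨φ a.1, φ a.2.1, a.2.2⟩
      inj' := by
        rintro ⟨u, v, a⟩ ⟨u', v', a'⟩ h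
        obtain rfl := φ.injective (congrArg Sigma.fst h)
        have h' := eq_of_heq (Sigma.mk.inj h).2
        obtain rfl := φ.injective (congrArg Sigma.fst h')
        have h'' := eq_of_heq (Sigma.mk.inj h').2
        exact congrArg (fun a => (⟨u, v, a⟩ : Σ u v : U', ((p ∘ φ) u ⟶ (p ∘ φ) v))) h'' }
  refine weightedCount_map φ ψ a b x (fun _ => rfl) (fun _ => rfl) ?_ hP
  rintro ⟨_, _, a⟩ ⟨u, rfl⟩ ⟨v, rfl⟩
  exact ⟨⟨u, v, a⟩, rfl⟩

theorem fInv_fiberCount [∀ i j : V, Finite (i ⟶ j)] (Z : Stability V) (α : V →₀ ℕ)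
    [DecidableEq (Split α)] [Fintype (Arrows (Split α))] [DecidableEq (Arrows (Split α))]
    (W : Finset (Split α)) :
    fInv Z (fiberCount Split.base W) = algebraMap HalfField Mot
      (weightedCount (fun a : Arrows (Split α) => a.1) (fun a => a.2.1) gam⁻¹ qh⁻¹ (qh ^ 2 - 1)
        (fun I => (Z.split α).slopeSet I ≤ (Z.split α).slopeSet W) W) := by
  classical
  obtain ⟨φ, hφ, hp⟩ := exists_split_embedding Split.base W
  have := Fintype.ofFinite (Split (fiberCount Split.base W))
  have := Fintype.ofFinite (Arrows (Split (fiberCount Split.base W)))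
  rw [fInv, stackMotive_eq]
  congr 1
  have hcharge : ∀ I, (Z.split (fiberCount Split.base W)).charge I =
      (Z.split α).charge (I.map φ) := fun I => by
    rw [Stability.charge_split, Stability.charge_split, Finset.sum_map, ← hp]
    rfl
  have hW : (Finset.univ : Finset (Split (fiberCount Split.base W))).map φ = W := by
    ext u
    rw [← hφ u]
    simp
  let _ : Fintype (Σ u v : Split α, (Split.base u ⟶ Split.base v)) :=
    inferInstanceAs (Fintype (Arrows (Split α)))
  let _ : DecidableEq (Σ u v : Split α, (Split.base u ⟶ Split.base v)) :=
    inferInstanceAs (DecidableEq (Arrows (Split α)))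
  let _ : Fintype (Σ u v : Split (fiberCount Split.base W), (Split.base u ⟶ Split.base v)) :=
    inferInstanceAs (Fintype (Arrows (Split (fiberCount Split.base W))))
  have h := weightedCount_embedding gam⁻¹ qh⁻¹ (qh ^ 2 - 1) (p := Split.base (α := α)) φ hp
    (P := fun I => (Z.split α).slopeSet I ≤ (Z.split α).slopeSet W)
    (P' := fun I => (Z.split (fiberCount Split.base W)).slopeSet I ≤
      (Z.split (fiberCount Split.base W)).slopeSet Finset.univ) (W := Finset.univ)
    (fun I _ _ => by
      rw [Stability.slopeSet_congr (hcharge I), Stability.slopeSet_congr (hcharge Finset.univ), hW])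
  rw [hW] at h
  exact h.symm

end Split

end

end AbelianQuiver

namespace AbelianQuiver

noncomputable section

/-! ### The skew form and admissible rays -/

section Admissible

variable {V : Type} [Quiver.{0} V]

theorem arrowForm_add_left (α α' β : V →₀ ℤ) :
    arrowForm V (α + α') β = arrowForm V α β + arrowForm V α' β := by
  refine Finsupp.sum_add_index' (fun i => by simp) fun i m m' => ?_
  rw [← Finsupp.sum_add]
  exact Finsupp.sum_congr fun j _ => by ring

theorem arrowForm_single (i j : V) :
    arrowForm V (Finsupp.single i 1) (Finsupp.single j 1) = Nat.card (i ⟶ j) := by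
  simp [arrowForm]

theorem arrowForm_add_right (α β β' : V →₀ ℤ) :
    arrowForm V α (β + β') = arrowForm V α β + arrowForm V α β' := by
  rw [arrowForm, arrowForm, arrowForm, ← Finsupp.sum_add]
  exact Finsupp.sum_congr fun i _ =>
    Finsupp.sum_add_index' (fun j => by simp) fun j n n' => by ring

theorem arrowForm_sum {U : Type} (p : U → V) (K W : Finset U) :
    arrowForm V (∑ u ∈ K, Finsupp.single (p u) 1) (∑ u ∈ W, Finsupp.single (p u) 1) =
      ∑ u ∈ K, ∑ v ∈ W, (Nat.card (p u ⟶ p v) : ℤ) := by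
  let B : (V →₀ ℤ) →+ (V →₀ ℤ) →+ ℤ := AddMonoidHom.mk' (fun α =>
    AddMonoidHom.mk' (arrowForm V α) (arrowForm_add_right α)) fun α α' =>
      AddMonoidHom.ext fun β => arrowForm_add_left α α' β
  have h : ∀ α β, B α β = arrowForm V α β := fun _ _ => rfl
  rw [← h, map_sum B, AddMonoidHom.finsetSum_apply]
  refine Finset.sum_congr rfl fun u _ => ?_
  rw [map_sum]
  exact Finset.sum_congr rfl fun v _ => (h _ _).trans (arrowForm_single _ _)

theorem skewForm_eq (α β : V →₀ ℤ) :
    skewForm V α β = arrowForm V β α - arrowForm V α β := by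
  have h : (α.sum fun i m => m * β i) = β.sum fun i m => m * α i := by
    classical
    rw [Finsupp.sum_of_support_subset α (Finset.subset_union_left (s₂ := β.support)) _ (by simp),
      Finsupp.sum_of_support_subset β (Finset.subset_union_right (s₁ := α.support)) _ (by simp)]
    exact Finset.sum_congr rfl fun i _ => mul_comm _ _
  rw [skewForm, eulerForm, eulerForm, h]
  ring

theorem card_arrowsBetween_split [∀ i j : V, Finite (i ⟶ j)] {α : V →₀ ℕ}
    [DecidableEq (Split α)] [Fintype (Arrows (Split α))] [DecidableEq (Arrows (Split α))]
    (K W : Finset (Split α)) :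
    ((arrowsBetween (fun a : Arrows (Split α) => a.1) (fun a => a.2.1) K W).card : ℤ) =
      arrowForm V (toInt (fiberCount Split.base K)) (toInt (fiberCount Split.base W)) := by
  have (u v : Split α) : Fintype (u ⟶ v) := Fintype.ofFinite _
  have h : arrowsBetween (fun a : Arrows (Split α) => a.1) (fun a => a.2.1) K W =
      K.sigma fun _ => W.sigma fun _ => Finset.univ := by
    ext a
    simp [mem_arrowsBetween, Finset.mem_sigma]
  rw [h, Finset.card_sigma, toInt_fiberCount, toInt_fiberCount, arrowForm_sum]
  push_cast
  refine Finset.sum_congr rfl fun u _ => ?_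
  rw [Finset.card_sigma]
  push_cast
  refine Finset.sum_congr rfl fun v _ => ?_
  rw [Finset.card_univ, ← Nat.card_eq_fintype_card]
  rfl

/-- The count is a polynomial in `q^{1/2}`; at the value `2` each support contributes a power of
`3`, so the sum is positive. -/
theorem supportCount_ne_zero {U A : Type*} [DecidableEq U] [DecidableEq A] [Fintype A]
    {s t : A → U} {P : Finset U → Prop} {W : Finset U}
    (h : ∃ S ⊆ arrowsBetween s t W W, AllClosed s t P W S) :
    supportCount s t (qh ^ 2 - 1) P W ≠ 0 := by
  classical
  have h1 : supportCount (k := HalfField) s t (qh ^ 2 - 1) P W =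
      algebraMap ℚ[X] (RatFunc ℚ) (supportCount s t (Polynomial.X ^ 2 - 1) P W) := by
    rw [supportCount, supportCount, map_sum]
    refine Finset.sum_congr rfl fun S _ => ?_
    rw [map_pow, map_sub, map_pow, RatFunc.algebraMap_X, map_one]
    rfl
  intro h0
  replace h0 := (map_eq_zero_iff _ (FaithfulSMul.algebraMap_injective ℚ[X] (RatFunc ℚ))).mp
    (h1.symm.trans h0)
  have h2 := congrArg (Polynomial.eval 2) h0
  rw [supportCount, Polynomial.eval_finsetSum, Polynomial.eval_zero] at h2
  obtain ⟨S, hS, hS'⟩ := h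
  refine (Finset.sum_pos (fun S _ => ?_) ⟨S, ?_⟩).ne' h2
  · norm_num
  · exact Finset.mem_filter.mpr ⟨Finset.mem_powerset.mpr hS, hS'⟩

theorem weightedCount_ne_zero {U A : Type*} [DecidableEq U] [DecidableEq A] [Fintype A]
    {s t : A → U} {P : Finset U → Prop} {W : Finset U}
    (h : ∃ S ⊆ arrowsBetween s t W W, AllClosed s t P W S) :
    weightedCount s t gam⁻¹ qh⁻¹ (qh ^ 2 - 1) P W ≠ 0 :=
  mul_ne_zero (mul_ne_zero (pow_ne_zero _ (inv_ne_zero gam_ne_zero))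
    (pow_ne_zero _ (inv_ne_zero qh_ne_zero))) (supportCount_ne_zero h)

variable {Z : Stability V} {z : ℂ}

/-- The condition of semistability for a set of vertices on a ray. -/
theorem slopeSet_le_iff_of_mem_ray {U : Type} {Z : Stability U} (hz : z ∈ upperHalf)
    {I W : Finset U} (hI : I.Nonempty) (hW : ∃ t : ℝ, 0 < t ∧ Z.charge W = t * z) :
    Z.slopeSet I ≤ Z.slopeSet W ↔
      cross (Z.charge I) z < 0 ∨ ∃ t : ℝ, 0 < t ∧ Z.charge I = t * z := by
  obtain ⟨t, ht, hW⟩ := hW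
  have hne : W.Nonempty := by
    rw [Finset.nonempty_iff_ne_empty]
    rintro rfl
    rw [Z.charge_eq_sum, Finset.sum_empty] at hW
    rcases mul_eq_zero.mp hW.symm with h | h
    · exact ht.ne' (by exact_mod_cast h)
    · exact zero_notMem_upperHalf (h ▸ hz)
  rw [Z.slopeSet_le_iff hI hne, ← cross_eq_zero_iff (Z.charge_mem hI) hz, ← le_iff_lt_or_eq, hW]
  have : cross (Z.charge I) (t * z) = t * cross (Z.charge I) z := by
    simp [cross]; ring
  rw [this]
  exact ⟨fun h => nonpos_of_mul_nonpos_right h ht, fun h => mul_nonpos_of_nonneg_of_nonpos ht.le h⟩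

theorem weightedCount_slope_eq {A k : Type*} {U : Type} [DecidableEq U] [DecidableEq A]
    [Fintype A] [CommRing k] {s t : A → U} (a b x : k) {Z : Stability U} (hz : z ∈ upperHalf)
    {W : Finset U} (hW : ∃ t : ℝ, 0 < t ∧ Z.charge W = t * z) :
    weightedCount s t a b x (fun I => Z.slopeSet I ≤ Z.slopeSet W) W =
      weightedCount s t a b x
        (fun I => cross (Z.charge I) z < 0 ∨ ∃ t : ℝ, 0 < t ∧ Z.charge I = t * z) W := by
  rw [weightedCount, weightedCount]
  congr 1
  exact supportCount_congr s t x fun I _ hI => slopeSet_le_iff_of_mem_ray hz hI hW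

variable [∀ i j : V, Finite (i ⟶ j)] {α : V →₀ ℕ} [Fintype (Split α)] [DecidableEq (Split α)]
  [Fintype (Arrows (Split α))] [DecidableEq (Arrows (Split α))]

/-- The abelian quiver invariants are stack counts for a generic deformation. -/
theorem polarCoeff_eq_weightedCount (hz : z ∈ upperHalf)
    (hadm : IsAdmissibleRay Z {w | ∃ t : ℝ, 0 < t ∧ w = t * z}) {Zdef : Stability (Split α)}
    (hdef : IsDeformation (Z.split α) Zdef) {G : MvPowerSeries V Mot}
    (hG : MvPowerSeries.constantCoeff G = 0)
    (hGsupp : ∀ β, (¬ ∃ t : ℝ, 0 < t ∧ Z.Z (toInt β) = t * z) → MvPowerSeries.coeff β G = 0)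
    (hexp : 1 + raySeries Z {w | ∃ t : ℝ, 0 < t ∧ w = t * z} (fun α => fInv Z α.1) =
      (PowerSeries.exp Mot).subst G) (W : Finset (Split α))
    (hW : ∃ t : ℝ, 0 < t ∧ (Z.split α).charge W = t * z) :
    polarCoeff Split.base G W = algebraMap HalfField Mot
      (weightedCount (fun a : Arrows (Split α) => a.1) (fun a => a.2.1) gam⁻¹ qh⁻¹ (qh ^ 2 - 1)
        (fun I => Zdef.slopeSet I ≤ Zdef.slopeSet W) W) := by
  classical
  -- In the zero ring there is nothing to prove. Otherwise `HalfField` embeds in `𝒱`, so a non-zero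
  -- count gives a non-zero `f_Z`, as the admissibility condition requires.
  cases subsingleton_or_nontrivial Mot with
  | inl h => exact Subsingleton.elim _ _
  | inr hnt =>
  set s : Arrows (Split α) → Split α := fun a => a.1 with hs
  set t : Arrows (Split α) → Split α := fun a => a.2.1 with ht
  set l : Set ℂ := {w | ∃ t : ℝ, 0 < t ∧ w = t * z} with hl
  set low : Finset (Split α) → Prop := fun J => cross ((Z.split α).charge J) z < 0 with hlow
  set L : Finset (Split α) → Prop := fun J => ∃ t : ℝ, 0 < t ∧ (Z.split α).charge J = t * z with hL
  have hray : IsRay l := ⟨z, hz, rfl⟩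
  have hμ : SlopeData low L Zdef.slopeSet := slopeData_of_isDeformation hdef hz
  have hmem : ∀ J, L J ↔ Z.Z (toInt (fiberCount Split.base J)) ∈ l := fun J => by
    rw [← Stability.charge_split_eq]
    rfl
  have hfInv : ∀ J, L J → fInv Z (fiberCount Split.base J) = algebraMap HalfField Mot
      (weightedCount s t gam⁻¹ qh⁻¹ (qh ^ 2 - 1) (fun I => low I ∨ L I) J) := fun J hJ => by
    rw [fInv_fiberCount, weightedCount_slope_eq _ _ _ hz hJ]
  -- The empty set is included because it occurs as the complement of `J = W` in the recursion.
  have hF : ∀ J, J = ∅ ∨ L J → polarCoeff Split.base ((PowerSeries.exp Mot).subst G) J =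
      algebraMap HalfField Mot
        (weightedCount s t gam⁻¹ qh⁻¹ (qh ^ 2 - 1) (fun I => low I ∨ L I) J) := by
    rintro J (rfl | hJ)
    · rw [weightedCount_empty, map_one, polarCoeff, fiberCount_empty,
        MvPowerSeries.coeff_zero_eq_constantCoeff_apply, constantCoeff_exp_subst hG]
      simp [multiFactorial]
    · have hne : fiberCount Split.base J ≠ 0 := fun h => hray.zero_notMem (by
        have h1 := (hmem J).mp hJ
        have h2 : toInt (0 : V →₀ ℕ) = 0 := Finsupp.mapRange_zero
        rwa [h, h2, map_zero] at h1)
      rw [← hexp, polarCoeff, map_add, MvPowerSeries.coeff_one, if_neg hne, zero_add,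
        coeff_raySeries_of_mem _ ⟨_, (hmem J).mp hJ⟩, ← hfInv J hJ, ← nsmul_eq_mul,
        ← Nat.cast_smul_eq_nsmul HalfField, smul_inv_smul₀ (multiFactorial_ne_zero _)]
  have hb : (qh⁻¹) ^ 2 * (qh ^ 2 - 1 + 1) = 1 := by
    rw [sub_add_cancel, ← mul_pow, inv_mul_cancel₀ qh_ne_zero, one_pow]
  have hcard : ∀ K W, L K → L W → Disjoint K W →
      (∃ S ⊆ arrowsBetween s t K K, AllClosed s t (fun I => low I ∨ L I) K S) →
      (∃ S ⊆ arrowsBetween s t W W, AllClosed s t (fun I => low I ∨ L I) W S) →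
      (arrowsBetween s t K W).card = (arrowsBetween s t W K).card := by
    intro K W hK hW _ hSK hSW
    have hne : ∀ J, L J → (∃ S ⊆ arrowsBetween s t J J,
        AllClosed s t (fun I => low I ∨ L I) J S) → fInv Z (fiberCount Split.base J) ≠ 0 :=
      fun J hJ hS => by
        rw [hfInv J hJ]
        exact (map_ne_zero_iff _ algebraMap_injective).mpr (weightedCount_ne_zero hS)
    have h := hadm ⟨_, (hmem K).mp hK⟩ ⟨_, (hmem W).mp hW⟩ (hne K hK hSK) (hne W hW hSW)
    rw [skewForm_eq, ← card_arrowsBetween_split, ← card_arrowsBetween_split, sub_eq_zero] at h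
    exact_mod_cast h.symm
  -- Both sides satisfy the same recursion over the blocks containing a fixed vertex, which
  -- determines the value at `W` from smaller sets.
  induction hn : W.card using Nat.strong_induction_on generalizing W with
  | _ n ih =>
  obtain ⟨v, hv⟩ := hμ.nonempty W hW
  have h1 := polarCoeff_exp_subst Split.base hG hv
  have h2 := congrArg (algebraMap HalfField Mot)
    (hμ.weightedCount_eq_sum (a := gam⁻¹) hb hcard hW hv)
  rw [hF W (Or.inr hW)] at h1
  have h3 := h1.symm.trans h2
  -- Blocks off the ray drop out because `G` is supported on the ray; both sums then have the same
  -- index set.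
  rw [← Finset.sum_filter_of_ne (p := L) (fun J _ hJ => by
      by_contra hcon
      refine hJ ?_
      rw [polarCoeff, hGsupp _ (fun h => hcon ((hmem J).mpr h)), mul_zero, zero_mul]),
    Finset.filter_filter, map_sum] at h3
  -- The block `J = W` is isolated: it carries the unknown coefficient with factor `1`, while all
  -- other terms agree by induction.
  have hset : (W.powerset.filter fun J => v ∈ J ∧ L J) =
      insert W ((W.powerset.filter fun J => L J ∧ v ∈ J).erase W) := by
    rw [Finset.insert_erase]
    · exact Finset.filter_congr fun J _ => and_comm
    · exact Finset.mem_filter.mpr ⟨Finset.mem_powerset_self _, hW, hv⟩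
  have hset' : (W.powerset.filter fun J => L J ∧ v ∈ J) =
      insert W ((W.powerset.filter fun J => L J ∧ v ∈ J).erase W) := by
    rw [← hset]
    exact Finset.filter_congr fun J _ => and_comm
  rw [hset, hset', Finset.sum_insert (Finset.notMem_erase _ _),
    Finset.sum_insert (Finset.notMem_erase _ _), Finset.erase_insert (Finset.notMem_erase _ _)] at h3
  have h4 : ∀ J ∈ (W.powerset.filter fun J => L J ∧ v ∈ J).erase W,
      polarCoeff Split.base G J * polarCoeff Split.base ((PowerSeries.exp Mot).subst G) (W \ J) =
        algebraMap HalfField Mot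
          (weightedCount s t gam⁻¹ qh⁻¹ (qh ^ 2 - 1) (fun I => Zdef.slopeSet I ≤ Zdef.slopeSet J) J *
          weightedCount s t gam⁻¹ qh⁻¹ (qh ^ 2 - 1) (fun I => low I ∨ L I) (W \ J)) := by
    intro J hJ
    obtain ⟨hne, hJ⟩ := Finset.mem_erase.mp hJ
    obtain ⟨hJW, hJL, hvJ⟩ := Finset.mem_filter.mp hJ
    rw [Finset.mem_powerset] at hJW
    rw [map_mul, ih J.card (hn ▸ Finset.card_lt_card (hJW.ssubset_of_ne hne)) J hJL rfl]
    congr 1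
    refine hF _ ?_
    rcases (W \ J).eq_empty_or_nonempty with h | h
    · exact Or.inl h
    · exact Or.inr (hμ.sdiff J W hJL hW hJW h)
  rw [Finset.sum_congr rfl h4] at h3
  have h5 := add_right_cancel h3
  rw [map_mul, sdiff_self, Finset.bot_eq_empty, hF ∅ (Or.inl rfl), weightedCount_empty, map_one,
    mul_one, mul_one] at h5
  exact h5

end Admissible

end

end AbelianQuiver

/-! ### Comparison of the invariants with the moduli space. -/

namespace AbelianQuiver

/-- The moduli space for a generic stability function exists, and its virtual motive is determined
by the motive of the stack. -/
theorem exists_isGITQuotient {V : Type} [Quiver.{0} V] [Finite V] [∀ i j : V, Finite (i ⟶ j)]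
    [Nonempty V] {Z : Stability V} (hZ : Z.IsGeneric) :
    ∃ (M : Variety) (π : (semistableLocus Z).X ⟶ M.X), IsGITQuotient Z M π ∧
      virtualMotive M = gam • stackMotive Z := by
  classical
  have := Fintype.ofFinite V
  have := Fintype.ofFinite (Arrows V)
  obtain ⟨v₀⟩ := ‹Nonempty V›
  let D : ∀ S : SupportIndex Z,
      TreeData (fun a : Arrows V => a.1) (fun a => a.2.1) S.1 v₀ Finset.univ := fun S =>
    (nonempty_treeData_of_isGeneric hZ S.2 v₀).some
  exact ⟨moduliVariety D hZ, moduliProj D, isGITQuotient_moduliProj D hZ,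
    virtualMotive_moduliVariety D hZ⟩

theorem nonempty_split {V : Type} {α : V →₀ ℕ} (h : α ≠ 0) : Nonempty (Split α) := by
  obtain ⟨i, hi⟩ := Finsupp.ne_iff.mp h
  exact ⟨⟨i, 0, Nat.pos_of_ne_zero hi⟩⟩

theorem IsRay.ne_zero {V : Type} {Z : Stability V} {l : Set ℂ} (hl : IsRay l) (α : OnRay Z l) :
    α.1 ≠ 0 := fun h => hl.zero_notMem (by
  have h1 := α.2
  have h2 : toInt (0 : V →₀ ℕ) = 0 := Finsupp.mapRange_zero
  rwa [h, h2, map_zero] at h1)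

/-- This is `polarCoeff_eq_weightedCount` for the set of all vertices of `Q(α)`, where the factor
`α!` cancels. -/
theorem abelianInvariant_eq {V : Type} [Quiver.{0} V] [∀ i j : V, Finite (i ⟶ j)]
    {Z : Stability V} {l : Set ℂ} (hl : IsRay l) (hadm : IsAdmissibleRay Z l)
    {g : OnRay Z l → Mot} (hg : IsAbelianInvariant Z l g) (α : OnRay Z l)
    {Zdef : Stability (Split α.1)} (hdef : IsDeformation (Z.split α.1) Zdef) :
    g α = gam • stackMotive Zdef := by
  classical
  have := Fintype.ofFinite (Split α.1)
  have := Fintype.ofFinite (Arrows (Split α.1))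
  have hl' := hl
  obtain ⟨z, hz, rfl⟩ := hl
  have h0 : MvPowerSeries.constantCoeff (gam⁻¹ • raySeries Z _ g) = 0 := by
    have := coeff_zero_raySeries hl' g
    rw [← MvPowerSeries.coeff_zero_eq_constantCoeff_apply] at this ⊢
    rw [coeff_smul_series, this, smul_zero]
  have hcount := fiberCount_base_univ α.1
  have h := polarCoeff_eq_weightedCount hz hadm hdef h0
    (fun β hβ => by rw [coeff_smul_series, coeff_raySeries_of_notMem g hβ, smul_zero]) hg
    Finset.univ (by rw [Stability.charge_split_eq, hcount]; exact α.2)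
  rw [polarCoeff, hcount, coeff_smul_series, coeff_raySeries_of_mem, ← nsmul_eq_mul,
    ← Nat.cast_smul_eq_nsmul HalfField, smul_comm, smul_inv_smul₀ (multiFactorial_ne_zero _),
    ← stackMotive_eq] at h
  rw [← h, smul_inv_smul₀ gam_ne_zero]

end AbelianQuiver

theorem mainTheorem3 (V : Type) [Quiver.{0} V] [∀ i j : V, Finite (i ⟶ j)]
    (Z : AbelianQuiver.Stability V) (l : Set ℂ) (hl : AbelianQuiver.IsRay l)
    (hadm : AbelianQuiver.IsAdmissibleRay Z l) :
    (∀ α : V →₀ ℕ, IsUnit (AbelianQuiver.virtualMotive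
      (AbelianQuiver.torus (AbelianQuiver.Split α)))) ∧
    (∃! g : AbelianQuiver.OnRay Z l → AbelianQuiver.Mot,
      AbelianQuiver.IsAbelianInvariant Z l g) ∧
    ∀ g : AbelianQuiver.OnRay Z l → AbelianQuiver.Mot,
      AbelianQuiver.IsAbelianInvariant Z l g →
      ∀ (α : AbelianQuiver.OnRay Z l) (Zdef : AbelianQuiver.Stability (AbelianQuiver.Split α.1)),
        AbelianQuiver.IsDeformation (Z.split α.1) Zdef →
        g α = AbelianQuiver.gam •
          (AbelianQuiver.virtualMotive (AbelianQuiver.semistableLocus Zdef) *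
            Ring.inverse (AbelianQuiver.virtualMotive
              (AbelianQuiver.torus (AbelianQuiver.Split α.1)))) ∧
        (∃ (M : AbelianQuiver.Variety) (π : (AbelianQuiver.semistableLocus Zdef).X ⟶ M.X),
          AbelianQuiver.IsGITQuotient Zdef M π) ∧
        ∀ (M : AbelianQuiver.Variety) (π : (AbelianQuiver.semistableLocus Zdef).X ⟶ M.X),
          AbelianQuiver.IsGITQuotient Zdef M π → g α = AbelianQuiver.virtualMotive M := by
  refine ⟨fun α => AbelianQuiver.isUnit_virtualMotive_torus _,
    AbelianQuiver.existsUnique_isAbelianInvariant hl, fun g hg α Zdef hdef => ?_⟩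
  have h := AbelianQuiver.abelianInvariant_eq hl hadm hg α hdef
  -- A ray omits `0`, so `Q(α)` has a vertex, which serves as the root of the spanning trees.
  have := AbelianQuiver.nonempty_split (hl.ne_zero α)
  obtain ⟨M, π, hM, hmot⟩ := AbelianQuiver.exists_isGITQuotient (Z := Zdef) hdef.1
  -- The virtual motive of the constructed quotient is that of any other, by the universal property.
  exact ⟨h, ⟨M, π, hM⟩, fun M' π' hM' => by rw [h, ← hmot, hM.virtualMotive_eq hM']⟩
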